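/- Let $m\ge 1$ be an integer. Let $\mathcal W^{k,2}[0,1]$ be the space of functions $f:[0,1]\to\mathbb R$ such that $f,f',\dots,f^{(k-1)}$ are absolutely continuous and $f^{(k)}\in L^2[0,1]$, and for $\lambda>0$ put $\|f\|_{m,\lambda}^2=\int_0^1 f^2+\lambda\int_0^1 (f^{(m)})^2$. For every $n$ let $t_{1n},\dots,t_{nn}\in[0,1]$ be non-random design points and let $Y_i=f_o(t_{in})+\epsilon_i$ ($i=1,\dots,n$), where $\epsilon_1,\epsilon_2,\dots$ are independent and identically distributed real random variables. Assume: (A1) $\rho:\mathbb R\to\mathbb R$ is convex and $\psi$ is a choice of its subgradient, i.e. $\rho(y)\ge\rho(x)+\psi(x)(y-x)$ for all real $x,y$; (A2) $\lim_{t\to0}\mathbb E\{\psi(\epsilon_1+t)-\psi(\epsilon_1)\}^2=0$; (A3) $\mathbb E|\psi(\epsilon_1)|^2<\infty$, $\mathbb E\,\psi(\epsilon_1)=0$, and for some constant $\xi>0$, $\mathbb E\,\psi(\epsilon_1+t)=\xi t+o(|t|)$ as $t\to0$; (A4) there is a constant $c$ such that for all $n\ge2$ and all $f\in\mathcal W^{1,2}[0,1]$,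 $$\Bigl|\frac1n\sum_{i=1}^n f(t_{in})-\int_0^1 f(t)\,dt\Bigr|\le\frac cn\Bigl(\int_0^1 (f')^2\Bigr)^{1/2}.$$ Let $\lambda=\lambda_n>0$ be non-random with $\lambda_n\to0$ and $n^m\lambda_n\to\infty$, and let $f_o\in\mathcal W^{2m,2}[0,1]$ satisfy $f_o^{(s)}(0)=f_o^{(s)}(1)=0$ for all $m\le s\le 2m-1$. Then there exists a sequence of M-type smoothing splines $\widehat f_n$, that is, for every $n\ge m$ (and all values of the responses) $\widehat f_n$ is a function of the responses that minimizes $$\frac1n\sum_{i=1}^n\rho\bigl(Y_i-f(t_{in})\bigr)+\lambda_n\int_0^1\{f^{(m)}(x)\}^2\,dx$$ over $f\in\mathcal W^{m,2}[0,1]$, such that $$\|\widehat f_n-f_o\|_{m,\lambda_n}^2=O_P\Bigl(\lambda_n^2+\bigl(n\lambda_n^{1/(2m)}\bigr)^{-1}\Bigr).$$ Consequently, if $\lambda_n\asymp n^{-2m/(4m+1)}$, then $\|\widehat f_n-f_o\|_{m,\lambda_n}^2=O_P(n^{-4m/(4m+1)})$, and in particular $\int_0^1(\widehat f_n-f_o)^2=O_P(n^{-4m/(4m+1)})$.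 (If the random quantities are not measurable, $O_P$ is understood with outer probability.) -/

import Mathlib

open MeasureTheory ProbabilityTheory Filter Topology Set Asymptotics

noncomputable section

namespace MSpline

/-- The `j`-th derivative of `f` on the interval `[0,1]` (one-sided at the end points). It depends
on the values of `f` on `[0,1]` only. For `f` with an absolutely continuous derivative of order
`j - 1` it is the usual `j`-th derivative at almost every point of `[0,1]`. -/
def derivI (j : ℕ) (f : ℝ → ℝ) : ℝ → ℝ :=
  iteratedDerivWithin j f (Icc (0 : ℝ) 1)

/-- Membership in the Sobolev space `W^{m,2}([0,1])`, for `m ≥ 1`: the restriction of `f` to `[0,1]`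
has `m - 1` continuous derivatives, the last of which is absolutely continuous (so that `f` and its
lower derivatives, being continuously differentiable, are absolutely continuous too), and the
derivative of order `m`, which exists almost everywhere, is square integrable. -/
structure MemSobolev (m : ℕ) (f : ℝ → ℝ) : Prop where
  contDiffOn : ContDiffOn ℝ ((m - 1 : ℕ) : WithTop ℕ∞) f (Icc (0 : ℝ) 1)
  absolutelyContinuous : AbsolutelyContinuousOnInterval (derivI (m - 1) f) 0 1
  memLp_two : MemLp (derivI m f) 2 (volume.restrict (Icc (0 : ℝ) 1))

/-- The squared norm `‖f‖₂² + lam ‖f^(m)‖₂²` on `W^{m,2}([0,1])`. -/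
def sqNorm (m : ℕ) (lam : ℝ) (f : ℝ → ℝ) : ℝ :=
  (∫ x in (0 : ℝ)..1, f x ^ 2) + lam * ∫ x in (0 : ℝ)..1, derivI m f x ^ 2

/-- The penalized empirical loss
`(1/n) ∑ ρ (y i - f (t i)) + lam ‖f^(m)‖₂²` for the responses `y` at the design points `t`. -/
def objective (m : ℕ) (ρ : ℝ → ℝ) (lam : ℝ) {n : ℕ} (t y : Fin n → ℝ) (f : ℝ → ℝ) : ℝ :=
  (1 / (n : ℝ)) * ∑ i, ρ (y i - f (t i)) + lam * ∫ x in (0 : ℝ)..1, derivI m f x ^ 2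

/-- `f` is an M-type smoothing spline for the data `(t, y)`: a minimizer of the penalized
empirical loss over `W^{m,2}([0,1])`. -/
def IsMSpline (m : ℕ) (ρ : ℝ → ℝ) (lam : ℝ) {n : ℕ} (t y : Fin n → ℝ) (f : ℝ → ℝ) : Prop :=
  MemSobolev m f ∧ ∀ g : ℝ → ℝ, MemSobolev m g → objective m ρ lam t y f ≤ objective m ρ lam t y g

/-- `ψ` is a choice of subgradient of `ρ`. -/
def IsSubgradientChoice (ρ ψ : ℝ → ℝ) : Prop :=
  ∀ x y : ℝ, ρ x + ψ x * (y - x) ≤ ρ y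

/-- A triangular array of design points in `[0,1]` is quasi-uniform. -/
def QuasiUniform (t : (n : ℕ) → Fin n → ℝ) : Prop :=
  ∃ c : ℝ, ∀ n : ℕ, 2 ≤ n → ∀ f : ℝ → ℝ, MemSobolev 1 f →
    |(1 / (n : ℝ)) * ∑ i, f (t n i) - ∫ x in (0 : ℝ)..1, f x|
      ≤ c / n * Real.sqrt (∫ x in (0 : ℝ)..1, derivI 1 f x ^ 2)

/-- `X n = O_P(a n)`: for every `δ > 0` there is a `K` with `P (|X n| > K * a n) ≤ δ` for all
large `n`. For `X n` that are not measurable, `P` is the outer probability. -/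
def IsBigOInProb {Ω : Type*} [MeasurableSpace Ω] (P : Measure Ω) (X : ℕ → Ω → ℝ) (a : ℕ → ℝ) :
    Prop :=
  ∀ δ : ℝ, 0 < δ → ∃ K : ℝ, 0 < K ∧
    ∀ᶠ n in atTop, P {ω | K * a n < |X n ω|} ≤ ENNReal.ofReal δ

end MSpline

end

/-! Put `h = lam^(1/(2m))`, so that the penalty is `h^(2m) ∫ (f^(m))²`, and let `d = fhat - fo`.
Everything is measured at the scale `h`. Interpolation gives `∫ f² + h² ∫ f'² ≤ C ‖f‖²`
(`exists_sqNorm_one_le`), and representing `f t` by kernels supported on an interval of length `h`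
(`exists_evaluation_kernel`) gives `sup f² ≤ 2 C ‖f‖² / h`.

Comparing the objective at `fhat` and at `fo`, with convexity of `ρ` used to shrink `d` to `θ d`,
bounds the averaged remainders of the linearized loss plus the penalty of `θ d` by a score term and
a bias term (`IsMSpline.basic_inequality`). For the bias, `m` integrations by parts under the
natural boundary conditions leave a multiple of `lam ‖d‖` (`sq_integral_mul_le_of_boundary`). For
the score, the kernels separate the randomness from `d`, which gives order `(n h)^(-1/2) ‖d‖`
uniformly in `d` (`exists_score_bound`).

The heart is a quadratic lower bound for the remainders, uniform in the perturbation, obtained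
without entropy or chaining. Cut the unit interval into cells of length of order `h`, on which a
function of controlled norm oscillates little on average. If all perturbations on a cell have one
sign and size at least `2 a / 2^k`, monotonicity of `ψ` bounds each remainder below by `a / 2^k`
times an increment of `ψ` between two dyadic points, and this increment does not depend on the
perturbation. Thus each cell involves one random sum for each dyadic level and sign. Its mean per
observation is at least of order `ξ a / 2^k`, and the second moments of the nonnegative telescoping
increments add up over all levels to at most those of `ψ (ε ± a) - ψ ε`. So the expected error of a
cell is bounded, and the order `1/h` many cells cost `1/(n h)` after averaging (`sum_remainder_ge`,
`integral_cellError_le`, `sum_remainder_ge_of_primitive`).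

With `δ² = lam² + 1/(n h)`, suppose `‖d‖ > K δ` and choose `θ` with `‖θ d‖ = K δ`. The sup norm of
`θ d` is then at most `a` for large `n`, because `h + 1/(n h²)` tends to zero, so the lower bound
applies. A term of order `K² δ²` would be at most one of order `(1 + K) δ²`, which is false for
large `K` (`IsMSpline.sqNorm_sub_le`). Markov's inequality controls the two stochastic terms.

Existence is a representer argument: the data see `f^(m)` only through finitely many inner products
in `L²`, so the problem reduces to a coercive one in finite dimension (`exists_isMSpline`). -/

namespace MSpline

/-! ### Square integrable functions on the unit interval -/

/-- Lebesgue measure on the unit interval. -/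
noncomputable abbrev unitMeasure : Measure ℝ := volume.restrict (Icc (0 : ℝ) 1)

theorem integral_unit (f : ℝ → ℝ) : ∫ x in (0 : ℝ)..1, f x = ∫ x, f x ∂unitMeasure := by
  rw [intervalIntegral.integral_of_le zero_le_one, integral_Icc_eq_integral_Ioc]

theorem intervalIntegrable_of_integrable_unit {f : ℝ → ℝ} (hf : Integrable f unitMeasure) {a b : ℝ}
    (ha : a ∈ Icc (0 : ℝ) 1) (hb : b ∈ Icc (0 : ℝ) 1) : IntervalIntegrable f volume a b := by
  rw [intervalIntegrable_iff]
  refine IntegrableOn.mono_set (t := Icc 0 1) hf ?_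
  intro x hx
  rw [mem_uIoc] at hx
  rcases hx with hx | hx
  · exact ⟨ha.1.trans hx.1.le, hx.2.trans hb.2⟩
  · exact ⟨hb.1.trans hx.1.le, hx.2.trans ha.2⟩

theorem integrable_unit_of_continuousOn {f : ℝ → ℝ} (hf : ContinuousOn f (Icc 0 1)) :
    Integrable f unitMeasure :=
  hf.integrableOn_compact isCompact_Icc

theorem memLp_unit_of_continuousOn {f : ℝ → ℝ} (hf : ContinuousOn f (Icc 0 1)) :
    MemLp f 2 unitMeasure := by
  rw [memLp_two_iff_integrable_sq (hf.aestronglyMeasurable measurableSet_Icc)]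
  exact integrable_unit_of_continuousOn (hf.pow 2)

/-- The Cauchy-Schwarz inequality for integrals of products. -/
theorem sq_integral_mul_le {α : Type*} [MeasurableSpace α] {μ : Measure α} {f g : α → ℝ}
    (hf : MemLp f 2 μ) (hg : MemLp g 2 μ) :
    (∫ x, f x * g x ∂μ) ^ 2 ≤ (∫ x, f x ^ 2 ∂μ) * ∫ x, g x ^ 2 ∂μ := by
  have hff := hf.integrable_sq
  have hgg := hg.integrable_sq
  have hfg : Integrable (fun x => f x * g x) μ := hf.integrable_mul hg
  have key : ∀ s : ℝ, 0 ≤ (∫ x, g x ^ 2 ∂μ) * (s * s) + (2 * ∫ x, f x * g x ∂μ) * s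
      + ∫ x, f x ^ 2 ∂μ := by
    intro s
    have h : ∫ x, (f x + s * g x) ^ 2 ∂μ = (∫ x, g x ^ 2 ∂μ) * (s * s)
        + (2 * ∫ x, f x * g x ∂μ) * s + ∫ x, f x ^ 2 ∂μ := by
      have : ∀ x, (f x + s * g x) ^ 2 = (s * s) * g x ^ 2 + (2 * s) * (f x * g x) + f x ^ 2 := by
        intro x; ring
      simp_rw [this]
      rw [integral_add _ hff, integral_add, integral_const_mul, integral_const_mul]
      · ring
      · exact hgg.const_mul _
      · exact hfg.const_mul _
      · exact (hgg.const_mul _).add (hfg.const_mul _)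
    rw [← h]
    exact integral_nonneg fun x => sq_nonneg _
  have := discrim_le_zero key
  unfold discrim at this
  nlinarith

/-! ### Primitives of square integrable functions -/

/-- `f` is, on the unit interval, a primitive of the square integrable function `g`. -/
structure L2Primitive (f g : ℝ → ℝ) : Prop where
  memLp : MemLp g 2 unitMeasure
  eq : ∀ x ∈ Icc (0 : ℝ) 1, f x = f 0 + ∫ u in (0 : ℝ)..x, g u

namespace L2Primitive

variable {f g f₁ g₁ f₂ g₂ : ℝ → ℝ}

theorem integrable (h : L2Primitive f g) : Integrable g unitMeasure := h.memLp.integrable one_le_two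

theorem intervalIntegrable (h : L2Primitive f g) {a b : ℝ} (ha : a ∈ Icc (0 : ℝ) 1)
    (hb : b ∈ Icc (0 : ℝ) 1) : IntervalIntegrable g volume a b :=
  intervalIntegrable_of_integrable_unit h.integrable ha hb

theorem sub_eq (h : L2Primitive f g) {x y : ℝ} (hx : x ∈ Icc (0 : ℝ) 1)
    (hy : y ∈ Icc (0 : ℝ) 1) : f y - f x = ∫ u in x..y, g u := by
  rw [h.eq x hx, h.eq y hy, ← intervalIntegral.integral_interval_sub_left
    (h.intervalIntegrable (a := 0) (by simp) hy) (h.intervalIntegrable (a := 0) (by simp) hx)]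
  ring

theorem absolutelyContinuousOnInterval (h : L2Primitive f g) :
    AbsolutelyContinuousOnInterval f 0 1 := by
  have h0 := (h.intervalIntegrable (a := 0) (b := 1)
    (by simp) (by simp)).absolutelyContinuousOnInterval_intervalIntegral (c := 0) (by simp)
  have h1 : AbsolutelyContinuousOnInterval (fun _ : ℝ => f 0) 0 1 :=
    (LipschitzWith.const (f 0)).lipschitzOnWith.absolutelyContinuousOnInterval
  have h2 := h1.add h0
  rw [absolutelyContinuousOnInterval_iff] at h2 ⊢
  intro ε hε
  obtain ⟨δ, hδ, H⟩ := h2 ε hε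
  refine ⟨δ, hδ, fun E hE hlt => ?_⟩
  convert H E hE hlt using 2 with i hi
  have hE' := hE
  simp only [AbsolutelyContinuousOnInterval.disjWithin, mem_ofPred_eq] at hE'
  have := hE'.1 i hi
  rw [uIcc_of_le zero_le_one] at this
  simp only [Pi.add_apply]
  rw [h.eq _ this.1, h.eq _ this.2]

theorem continuousOn (h : L2Primitive f g) : ContinuousOn f (Icc 0 1) := by
  have := h.absolutelyContinuousOnInterval.continuousOn
  rwa [uIcc_of_le zero_le_one] at this

theorem memLp_fun (h : L2Primitive f g) : MemLp f 2 unitMeasure :=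
  memLp_unit_of_continuousOn h.continuousOn

theorem hasDerivAt_ae (h : L2Primitive f g) :
    ∀ᵐ x, x ∈ Ioo (0 : ℝ) 1 → HasDerivAt f (g x) x := by
  filter_upwards [(h.intervalIntegrable (a := 0) (b := 1)
    (by simp) (by simp)).ae_hasDerivAt_integral] with x hx hx1
  rw [uIcc_of_le zero_le_one] at hx
  have := (hx (Ioo_subset_Icc_self hx1) 0 (by simp)).const_add (f 0)
  refine this.congr_of_eventuallyEq ?_
  filter_upwards [Icc_mem_nhds hx1.1 hx1.2] with y hy
  exact h.eq y hy

theorem ae_Ioo {p : ℝ → Prop} (h : ∀ᵐ x, x ∈ Ioo (0 : ℝ) 1 → p x) : ∀ᵐ x ∂unitMeasure, p x := by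
  rw [unitMeasure, ← Measure.restrict_congr_set (Ioo_ae_eq_Icc (μ := volume) (a := (0 : ℝ)) (b := 1))]
  exact (ae_restrict_iff' measurableSet_Ioo).2 h

theorem derivWithin_ae_eq (h : L2Primitive f g) :
    derivWithin f (Icc 0 1) =ᵐ[unitMeasure] g := by
  refine ae_Ioo ?_
  filter_upwards [h.hasDerivAt_ae] with x hx hx1
  rw [derivWithin_of_mem_nhds (Icc_mem_nhds hx1.1 hx1.2)]
  exact (hx hx1).deriv

/-- This is the fundamental theorem of calculus for absolutely continuous functions; `derivWithin`
and `deriv` can differ only at the two end points, a null set. -/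
theorem of_absolutelyContinuous (h : AbsolutelyContinuousOnInterval f 0 1)
    (hg : derivWithin f (Icc 0 1) =ᵐ[unitMeasure] g) (hL : MemLp g 2 unitMeasure) :
    L2Primitive f g := by
  refine ⟨hL, fun x hx => ?_⟩
  have hac : AbsolutelyContinuousOnInterval f 0 x := by
    refine h.mono ?_
    rw [uIcc_of_le zero_le_one, uIcc_of_le hx.1]
    exact Icc_subset_Icc_right hx.2
  have := hac.integral_deriv_eq_sub
  have h2 : ∫ u in (0:ℝ)..x, g u = ∫ u in (0:ℝ)..x, deriv f u := by
    refine intervalIntegral.integral_congr_ae ?_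
    rw [Filter.EventuallyEq, ae_restrict_iff' measurableSet_Icc] at hg
    have hne : ∀ᵐ u : ℝ, u ≠ 1 := by simp [ae_iff, measure_singleton]
    filter_upwards [hg, hne] with u hu hu1 hux
    rw [uIoc_of_le hx.1] at hux
    have : u ∈ Ioo (0:ℝ) 1 := ⟨hux.1, lt_of_le_of_ne (hux.2.trans hx.2) hu1⟩
    rw [← hu (Ioo_subset_Icc_self this), derivWithin_of_mem_nhds (Icc_mem_nhds this.1 this.2)]
  rw [h2, this]; ring

theorem congr (h : L2Primitive f g) (hf : EqOn f₁ f (Icc 0 1)) (hg : g₁ =ᵐ[unitMeasure] g) :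
    L2Primitive f₁ g₁ := by
  refine ⟨h.memLp.ae_eq hg.symm, fun x hx => ?_⟩
  rw [hf hx, hf (by simp : (0:ℝ) ∈ Icc (0:ℝ) 1), h.eq x hx]
  congr 1
  refine intervalIntegral.integral_congr_ae ?_
  rw [Filter.EventuallyEq, ae_restrict_iff' measurableSet_Icc] at hg
  filter_upwards [hg] with u hu hux
  rw [uIoc_of_le hx.1] at hux
  exact (hu ⟨hux.1.le, hux.2.trans hx.2⟩).symm

theorem hasDerivWithinAt (h : L2Primitive f g) (hg : ContinuousOn g (Icc 0 1)) {x : ℝ}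
    (hx : x ∈ Icc (0 : ℝ) 1) : HasDerivWithinAt f (g x) (Icc 0 1) x := by
  have : Fact (x ∈ Icc (0:ℝ) 1) := ⟨hx⟩
  have h1 := intervalIntegral.integral_hasDerivWithinAt_right
    (h.intervalIntegrable (a := 0) (by simp) hx) (s := Icc 0 1) (t := Icc 0 1)
    ⟨Icc 0 1, self_mem_nhdsWithin, hg.aestronglyMeasurable measurableSet_Icc⟩ (hg x hx)
  exact (h1.const_add (f 0)).congr h.eq (h.eq x hx)

theorem add (h₁ : L2Primitive f₁ g₁) (h₂ : L2Primitive f₂ g₂) :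
    L2Primitive (fun x => f₁ x + f₂ x) (fun x => g₁ x + g₂ x) := by
  refine ⟨h₁.memLp.add h₂.memLp, fun x hx => ?_⟩
  rw [intervalIntegral.integral_add (h₁.intervalIntegrable (by simp) hx)
    (h₂.intervalIntegrable (by simp) hx), h₁.eq x hx, h₂.eq x hx]
  ring

theorem const_mul (h : L2Primitive f g) (c : ℝ) :
    L2Primitive (fun x => c * f x) (fun x => c * g x) := by
  refine ⟨h.memLp.const_mul c, fun x hx => ?_⟩
  rw [intervalIntegral.integral_const_mul, h.eq x hx]
  ring

theorem mul (h₁ : L2Primitive f₁ g₁) (h₂ : L2Primitive f₂ g₂) :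
    L2Primitive (fun x => f₁ x * f₂ x) (fun x => g₁ x * f₂ x + f₁ x * g₂ x) := by
  refine of_absolutelyContinuous
    (h₁.absolutelyContinuousOnInterval.fun_mul h₂.absolutelyContinuousOnInterval) ?_ ?_
  · refine ae_Ioo ?_
    filter_upwards [h₁.hasDerivAt_ae, h₂.hasDerivAt_ae] with x hx1 hx2 hx
    rw [derivWithin_of_mem_nhds (Icc_mem_nhds hx.1 hx.2)]
    exact ((hx1 hx).mul (hx2 hx)).deriv
  · have aux : ∀ {u v : ℝ → ℝ}, ContinuousOn u (Icc 0 1) → MemLp v 2 unitMeasure →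
        MemLp (fun x => u x * v x) 2 unitMeasure := by
      intro u v hu hv
      obtain ⟨C, hC⟩ := isCompact_Icc.exists_bound_of_continuousOn hu
      refine (hv.const_mul C).mono ?_ ?_
      · exact (hu.aestronglyMeasurable measurableSet_Icc).mul hv.1
      · refine (ae_restrict_iff' measurableSet_Icc).2 (Eventually.of_forall fun x hx => ?_)
        rw [norm_mul, norm_mul]
        gcongr
        exact (hC x hx).trans (le_abs_self C)
    refine MemLp.add ?_ (aux h₁.continuousOn h₂.memLp)
    simp_rw [mul_comm (g₁ _)]
    exact aux h₂.continuousOn h₁.memLp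

/-- Integration by parts. -/
theorem integral_mul_eq (h₁ : L2Primitive f₁ g₁) (h₂ : L2Primitive f₂ g₂) {a b : ℝ}
    (ha : a ∈ Icc (0 : ℝ) 1) (hb : b ∈ Icc (0 : ℝ) 1) :
    ∫ x in a..b, f₁ x * g₂ x = f₁ b * f₂ b - f₁ a * f₂ a - ∫ x in a..b, g₁ x * f₂ x := by
  rw [(h₁.mul h₂).sub_eq ha hb, intervalIntegral.integral_add]
  · ring
  · exact intervalIntegrable_of_integrable_unit (h₁.memLp.integrable_mul h₂.memLp_fun) ha hb
  · exact intervalIntegrable_of_integrable_unit (h₁.memLp_fun.integrable_mul h₂.memLp) ha hb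

/-- The primitive of a function with value zero at the origin. -/
theorem of_integral (hg : MemLp g 2 unitMeasure) : L2Primitive (fun x => ∫ u in (0:ℝ)..x, g u) g :=
  ⟨hg, fun x _ => by simp⟩

end L2Primitive

/-! ### Sobolev functions as chains of primitives -/

theorem derivI_zero (f : ℝ → ℝ) : derivI 0 f = f := iteratedDerivWithin_zero

theorem derivI_succ (j : ℕ) (f : ℝ → ℝ) :
    derivI (j + 1) f = derivWithin (derivI j f) (Icc 0 1) := iteratedDerivWithin_succ

/-- Each of the functions `F 0, …, F (m - 1)` is a primitive of its successor. -/
def SobolevChain (m : ℕ) (F : ℕ → ℝ → ℝ) : Prop :=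
  ∀ j < m, L2Primitive (F j) (F (j + 1))

/-- Below order `m - 1` the derivatives are continuously differentiable; only the last link needs
absolute continuity and the square integrability of the top derivative. -/
theorem MemSobolev.chain {m : ℕ} {f : ℝ → ℝ} (hf : MemSobolev m f) (hm : 1 ≤ m) :
    SobolevChain m (fun j => derivI j f) := by
  intro j hj
  obtain rfl | hj' := eq_or_lt_of_le (Nat.le_sub_one_of_lt hj)
  · have h := hf.absolutelyContinuous
    refine L2Primitive.of_absolutelyContinuous h ?_ ?_
    · rw [← derivI_succ]
    · have := hf.memLp_two
      rwa [← Nat.sub_add_cancel hm] at this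
  · have hc := (contDiffOn_nat_iff_continuousOn_differentiableOn_deriv
      uniqueDiffOn_Icc_zero_one).1 hf.contDiffOn
    have hd := hc.2 j hj'
    have hcont : ContinuousOn (derivI (j + 1) f) (Icc 0 1) := hc.1 (j + 1) hj'
    have h1 : ContDiffOn ℝ 1 (derivI j f) (Icc 0 1) :=
      (contDiffOn_one_iff_derivWithin uniqueDiffOn_Icc_zero_one).2
        ⟨hd, by rwa [derivI_succ] at hcont⟩
    refine L2Primitive.of_absolutelyContinuous ?_ ?_ (memLp_unit_of_continuousOn hcont)
    · refine ContDiffOn.absolutelyContinuousOnInterval ?_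
      rwa [uIcc_of_le zero_le_one]
    · rw [← derivI_succ]

/-- For `j + 1 < m` the function `F (j + 1)` is itself a primitive, hence continuous, so
differentiation is valid at every point. At the top index only almost everywhere equality survives.
-/
theorem SobolevChain.derivI_eqOn {m : ℕ} {F : ℕ → ℝ → ℝ} (hF : SobolevChain m F) :
    ∀ j < m, EqOn (derivI j (F 0)) (F j) (Icc 0 1) := by
  intro j
  induction j with
  | zero => intro _; rw [derivI_zero]; exact fun _ _ => rfl
  | succ j ih =>
    intro hj x hx
    have ih' := ih (by omega)
    rw [derivI_succ, derivWithin_congr ih' (ih' hx)]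
    exact ((hF j (by omega)).hasDerivWithinAt (hF (j + 1) hj).continuousOn hx).derivWithin
      (uniqueDiffOn_Icc_zero_one x hx)

theorem SobolevChain.derivI_ae_eq {m : ℕ} {F : ℕ → ℝ → ℝ} (hF : SobolevChain m F) :
    ∀ j ≤ m, derivI j (F 0) =ᵐ[unitMeasure] F j := by
  intro j hj
  rcases j with _ | j
  · rw [derivI_zero]
  · have h := (hF j hj).congr (hF.derivI_eqOn j hj) ae_eq_rfl
    rw [derivI_succ]
    exact h.derivWithin_ae_eq

theorem SobolevChain.memSobolev {m : ℕ} {F : ℕ → ℝ → ℝ} (hF : SobolevChain m F) (hm : 1 ≤ m) :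
    MemSobolev m (F 0) := by
  have hlast := hF (m - 1) (by omega)
  rw [Nat.sub_add_cancel hm] at hlast
  refine ⟨?_, ?_, ?_⟩
  · rw [contDiffOn_nat_iff_continuousOn_differentiableOn_deriv uniqueDiffOn_Icc_zero_one]
    refine ⟨fun j hj => ?_, fun j hj => ?_⟩
    · exact (hF j (by omega)).continuousOn.congr (hF.derivI_eqOn j (by omega))
    · intro x hx
      have := (hF j (by omega)).hasDerivWithinAt (hF (j + 1) (by omega)).continuousOn hx
      have he := hF.derivI_eqOn j (by omega)
      exact (this.congr he (he hx)).differentiableWithinAt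
  · exact (hlast.congr (hF.derivI_eqOn _ (by omega)) ae_eq_rfl).absolutelyContinuousOnInterval
  · exact hlast.memLp.ae_eq (hF.derivI_ae_eq m le_rfl).symm

theorem MemSobolev.mono {k m : ℕ} {f : ℝ → ℝ} (hf : MemSobolev m f) (hk : 1 ≤ k) (hkm : k ≤ m) :
    MemSobolev k f := by
  have h : SobolevChain k (fun j => derivI j f) := fun j hj => hf.chain (hk.trans hkm) j (by omega)
  have := h.memSobolev hk
  rwa [derivI_zero] at this

theorem MemSobolev.add {m : ℕ} {f g : ℝ → ℝ} (hf : MemSobolev m f) (hg : MemSobolev m g)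
    (hm : 1 ≤ m) : MemSobolev m (fun x => f x + g x) ∧ ∀ j ≤ m,
      derivI j (fun x => f x + g x) =ᵐ[unitMeasure] fun x => derivI j f x + derivI j g x := by
  have h : SobolevChain m (fun j x => derivI j f x + derivI j g x) :=
    fun j hj => (hf.chain hm j hj).add (hg.chain hm j hj)
  have h1 := h.memSobolev hm
  have h2 := h.derivI_ae_eq
  simp only [derivI_zero] at h1 h2
  exact ⟨h1, h2⟩

theorem MemSobolev.const_mul {m : ℕ} {f : ℝ → ℝ} (hf : MemSobolev m f) (hm : 1 ≤ m) (c : ℝ) :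
    MemSobolev m (fun x => c * f x) ∧ ∀ j ≤ m,
      derivI j (fun x => c * f x) =ᵐ[unitMeasure] fun x => c * derivI j f x := by
  have h : SobolevChain m (fun j x => c * derivI j f x) :=
    fun j hj => (hf.chain hm j hj).const_mul c
  have h1 := h.memSobolev hm
  have h2 := h.derivI_ae_eq
  simp only [derivI_zero] at h1 h2
  exact ⟨h1, h2⟩

theorem MemSobolev.sub {m : ℕ} {f g : ℝ → ℝ} (hf : MemSobolev m f) (hg : MemSobolev m g)
    (hm : 1 ≤ m) : MemSobolev m (fun x => f x - g x) ∧ ∀ j ≤ m,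
      derivI j (fun x => f x - g x) =ᵐ[unitMeasure] fun x => derivI j f x - derivI j g x := by
  have h : SobolevChain m (fun j x => derivI j f x + (-1) * derivI j g x) :=
    fun j hj => (hf.chain hm j hj).add ((hg.chain hm j hj).const_mul (-1))
  have h1 := h.memSobolev hm
  have h2 := h.derivI_ae_eq
  simp only [derivI_zero, neg_one_mul, ← sub_eq_add_neg] at h1 h2
  exact ⟨h1, h2⟩

theorem L2Primitive.memSobolev {f g : ℝ → ℝ} (h : L2Primitive f g) :
    MemSobolev 1 f ∧ derivI 1 f =ᵐ[unitMeasure] g := by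
  have hc : SobolevChain 1 (fun j => if j = 0 then f else g) := by
    intro j hj
    obtain rfl : j = 0 := by omega
    simpa using h
  exact ⟨hc.memSobolev le_rfl, hc.derivI_ae_eq 1 le_rfl⟩

/-- The `k`-fold iterated primitive. -/
noncomputable def iterPrimitive : ℕ → (ℝ → ℝ) → ℝ → ℝ
  | 0, g => g
  | k + 1, g => fun x => ∫ u in (0 : ℝ)..x, iterPrimitive k g u

theorem memLp_iterPrimitive {g : ℝ → ℝ} (hg : MemLp g 2 unitMeasure) (k : ℕ) :
    MemLp (iterPrimitive k g) 2 unitMeasure := by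
  induction k with
  | zero => exact hg
  | succ k ih => exact (L2Primitive.of_integral ih).memLp_fun

theorem sobolevChain_iterPrimitive {g : ℝ → ℝ} (hg : MemLp g 2 unitMeasure) (m : ℕ) :
    SobolevChain m (fun j => iterPrimitive (m - j) g) := by
  intro j hj
  obtain ⟨k, hk⟩ : ∃ k, m - j = k + 1 := ⟨m - j - 1, by omega⟩
  have hk' : m - (j + 1) = k := by omega
  simp only [hk, hk']
  exact L2Primitive.of_integral (memLp_iterPrimitive hg k)

theorem memSobolev_iterPrimitive {g : ℝ → ℝ} (hg : MemLp g 2 unitMeasure) {m : ℕ} (hm : 1 ≤ m) :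
    MemSobolev m (iterPrimitive m g) ∧ derivI m (iterPrimitive m g) =ᵐ[unitMeasure] g := by
  have h := sobolevChain_iterPrimitive hg m
  refine ⟨h.memSobolev hm, ?_⟩
  have := h.derivI_ae_eq m le_rfl
  simpa [iterPrimitive] using this

/-! ### Point evaluation at a given scale -/

theorem integral_indicator_Ioc_unit {α β : ℝ} (hα : 0 ≤ α) (hαβ : α ≤ β) (hβ : β ≤ 1)
    (f : ℝ → ℝ) : ∫ x, (Ioc α β).indicator f x ∂unitMeasure = ∫ x in α..β, f x := by
  rw [intervalIntegral.integral_of_le hαβ, integral_indicator measurableSet_Ioc, unitMeasure,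
    Measure.restrict_restrict measurableSet_Ioc, inter_eq_left.2]
  exact fun x hx => ⟨hα.trans hx.1.le, hx.2.trans hβ⟩

theorem memLp_unit_of_bounded {f : ℝ → ℝ} (hf : Measurable f) {C : ℝ} (hC : ∀ x, |f x| ≤ C) :
    MemLp f 2 unitMeasure :=
  MemLp.of_bound hf.aestronglyMeasurable C (Eventually.of_forall fun x => by simpa using hC x)

/-- Point evaluation is represented by a pair of functions that act on a function and on its
derivative and live on an interval of length `l`. -/
theorem exists_evaluation_kernel {l t : ℝ} (hl : 0 < l) (hl1 : l ≤ 1) (ht : t ∈ Icc (0 : ℝ) 1) :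
    ∃ a b : ℝ → ℝ, MemLp a 2 unitMeasure ∧ MemLp b 2 unitMeasure ∧
      ∫ x, a x ^ 2 ∂unitMeasure ≤ 1 / l ∧ ∫ x, b x ^ 2 ∂unitMeasure ≤ l ∧
      ∀ f g : ℝ → ℝ, L2Primitive f g →
        f t = ∫ x, a x * f x ∂unitMeasure + ∫ x, b x * g x ∂unitMeasure := by
  obtain ⟨α, β, hα, hαt, htβ, hβ, hαβ⟩ : ∃ α β : ℝ, 0 ≤ α ∧ α ≤ t ∧ t ≤ β ∧ β ≤ 1 ∧ β = α + l := by
    rcases le_total t (1 - l) with h | h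
    · exact ⟨t, t + l, ht.1, le_rfl, by linarith, by linarith, rfl⟩
    · exact ⟨1 - l, 1, by linarith, h, ht.2, le_rfl, by ring⟩
  have hle : α ≤ β := hαt.trans htβ
  -- `a` averages over the interval, and `b` is a sawtooth of slope `1/l` vanishing at `α` and `β`,
  -- with a unit jump at `t`. Integrating `b * g` by parts on both sides of `t` yields `f t` minus
  -- the average of `f`.
  set a : ℝ → ℝ := (Ioc α β).indicator fun _ => 1 / l
  set b : ℝ → ℝ := fun x =>
    (Ioc α t).indicator (fun u => (u - α) / l) x + (Ioc t β).indicator (fun u => (u - β) / l) x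
  have hb_bd : ∀ x, |b x| ≤ (Ioc α β).indicator (fun _ => 1) x := by
    intro x
    simp only [b, indicator_apply, mem_Ioc]
    by_cases h1 : α < x ∧ x ≤ t
    · have h2 : ¬ (t < x ∧ x ≤ β) := fun h => absurd h.1 (not_lt.2 h1.2)
      have h3 : α < x ∧ x ≤ β := ⟨h1.1, h1.2.trans htβ⟩
      rw [if_pos h1, if_neg h2, if_pos h3, add_zero, abs_of_nonneg (div_nonneg (by linarith) hl.le),
        div_le_one hl]
      linarith
    · by_cases h2 : t < x ∧ x ≤ β
      · have h3 : α < x ∧ x ≤ β := ⟨hαt.trans_lt h2.1, h2.2⟩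
        rw [if_neg h1, if_pos h2, if_pos h3, zero_add, abs_div, abs_of_pos hl, div_le_one hl,
          abs_of_nonpos (by linarith)]
        linarith
      · rw [if_neg h1, if_neg h2]
        simp only [add_zero, abs_zero]
        split_ifs <;> norm_num
  have ha_meas : Measurable a := measurable_const.indicator measurableSet_Ioc
  have hb_meas : Measurable b :=
    (((measurable_id.sub_const α).div_const l).indicator measurableSet_Ioc).add
      (((measurable_id.sub_const β).div_const l).indicator measurableSet_Ioc)
  have ha2 : ∀ x, a x ^ 2 = (Ioc α β).indicator (fun _ => (1 / l) ^ 2) x := by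
    intro x
    simp only [a, indicator_apply]
    split_ifs <;> simp
  have hb2 : ∀ x, b x ^ 2 ≤ (Ioc α β).indicator (fun _ => 1) x := by
    intro x
    have h := hb_bd x
    rw [← sq_abs]
    simp only [indicator_apply] at h ⊢
    split_ifs at h ⊢
    · exact pow_le_one₀ (abs_nonneg _) h
    · rw [le_antisymm h (abs_nonneg _)]; norm_num
  have ha_mem : MemLp a 2 unitMeasure := by
    refine memLp_unit_of_bounded ha_meas (C := 1 / l) fun x => ?_
    simp only [a, indicator_apply]
    split_ifs
    · rw [abs_of_pos (by positivity)]
    · simp [hl.le]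
  have hb_mem : MemLp b 2 unitMeasure := by
    refine memLp_unit_of_bounded hb_meas (C := 1) fun x => (hb_bd x).trans ?_
    simp only [indicator_apply]
    split_ifs <;> norm_num
  refine ⟨a, b, ha_mem, hb_mem, ?_, ?_, ?_⟩
  · simp_rw [ha2]
    rw [integral_indicator_Ioc_unit hα hle hβ, intervalIntegral.integral_const, smul_eq_mul, hαβ]
    apply le_of_eq
    field_simp
    ring
  · calc ∫ x, b x ^ 2 ∂unitMeasure ≤ ∫ x, (Ioc α β).indicator (fun _ => (1 : ℝ)) x ∂unitMeasure :=
          integral_mono hb_mem.integrable_sq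
            ((integrable_const (1 : ℝ)).indicator measurableSet_Ioc) hb2
      _ = l := by
          rw [integral_indicator_Ioc_unit hα hle hβ, intervalIntegral.integral_const, smul_eq_mul,
            hαβ]
          ring
  · intro f g hfg
    have hαm : α ∈ Icc (0 : ℝ) 1 := ⟨hα, hle.trans hβ⟩
    have hβm : β ∈ Icc (0 : ℝ) 1 := ⟨hα.trans hle, hβ⟩
    have hA : ∫ x, a x * f x ∂unitMeasure = 1 / l * ∫ x in α..β, f x := by
      have : ∀ x, a x * f x = (Ioc α β).indicator (fun u => 1 / l * f u) x := by
        intro x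
        simp only [a, indicator_apply]
        split_ifs <;> simp
      simp_rw [this]
      rw [integral_indicator_Ioc_unit hα hle hβ, intervalIntegral.integral_const_mul]
    have hlin : ∀ c : ℝ, L2Primitive (fun u => (u - c) / l) (fun _ => 1 / l) := by
      intro c
      refine ⟨memLp_const _, fun x hx => ?_⟩
      rw [intervalIntegral.integral_const, smul_eq_mul]
      field_simp
      ring
    have hpiece : ∀ u v c : ℝ, 0 ≤ u → u ≤ v → v ≤ 1 →
        ∫ x, (Ioc u v).indicator (fun w => (w - c) / l) x * g x ∂unitMeasure
          = (v - c) / l * f v - (u - c) / l * f u - 1 / l * ∫ x in u..v, f x := by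
      intro u v c hu huv hv
      have : ∀ x, (Ioc u v).indicator (fun w => (w - c) / l) x * g x
          = (Ioc u v).indicator (fun w => (w - c) / l * g w) x := by
        intro x
        simp only [indicator_apply]
        split_ifs <;> simp
      simp_rw [this]
      rw [integral_indicator_Ioc_unit hu huv hv,
        (hlin c).integral_mul_eq hfg ⟨hu, huv.trans hv⟩ ⟨hu.trans huv, hv⟩,
        intervalIntegral.integral_const_mul]
    have hB : ∫ x, b x * g x ∂unitMeasure = f t - 1 / l * ∫ x in α..β, f x := by
      simp only [b, add_mul]
      rw [integral_add, hpiece α t α hα hαt ht.2, hpiece t β β ht.1 htβ hβ,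
        ← intervalIntegral.integral_add_adjacent_intervals
          (intervalIntegrable_of_integrable_unit (hfg.memLp_fun.integrable one_le_two) hαm ht)
          (intervalIntegrable_of_integrable_unit (hfg.memLp_fun.integrable one_le_two) ht hβm),
        hαβ]
      · field_simp
        ring
      · exact ((hlin α).memLp_fun.indicator measurableSet_Ioc).integrable_mul hfg.memLp
      · exact ((hlin β).memLp_fun.indicator measurableSet_Ioc).integrable_mul hfg.memLp
    rw [hA, hB]
    ring

theorem L2Primitive.sq_le {f g : ℝ → ℝ} (h : L2Primitive f g) {l t : ℝ} (hl : 0 < l) (hl1 : l ≤ 1)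
    (ht : t ∈ Icc (0 : ℝ) 1) :
    f t ^ 2 ≤ 2 / l * ∫ x, f x ^ 2 ∂unitMeasure + 2 * l * ∫ x, g x ^ 2 ∂unitMeasure := by
  obtain ⟨a, b, ha, hb, ha2, hb2, H⟩ := exists_evaluation_kernel hl hl1 ht
  rw [H f g h]
  have h1 := sq_integral_mul_le ha h.memLp_fun
  have h2 := sq_integral_mul_le hb h.memLp
  have hf0 : 0 ≤ ∫ x, f x ^ 2 ∂unitMeasure := integral_nonneg fun x => sq_nonneg _
  have hg0 : 0 ≤ ∫ x, g x ^ 2 ∂unitMeasure := integral_nonneg fun x => sq_nonneg _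
  have h3 := mul_le_mul_of_nonneg_right ha2 hf0
  have h4 := mul_le_mul_of_nonneg_right hb2 hg0
  calc _ ≤ 2 * (∫ x, a x * f x ∂unitMeasure) ^ 2 + 2 * (∫ x, b x * g x ∂unitMeasure) ^ 2 := by
        nlinarith [sq_nonneg (∫ x, a x * f x ∂unitMeasure - ∫ x, b x * g x ∂unitMeasure)]
    _ ≤ 2 * (1 / l * ∫ x, f x ^ 2 ∂unitMeasure) + 2 * (l * ∫ x, g x ^ 2 ∂unitMeasure) := by
        linarith
    _ = _ := by ring

/-! ### Interpolation inequalities for derivatives -/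

theorem abs_integral_mul_le {α : Type*} [MeasurableSpace α] {μ : Measure α} {f g : α → ℝ}
    (hf : MemLp f 2 μ) (hg : MemLp g 2 μ) {c : ℝ} (hc : 0 < c) :
    |∫ x, f x * g x ∂μ| ≤ (c⁻¹ * ∫ x, f x ^ 2 ∂μ + c * ∫ x, g x ^ 2 ∂μ) / 2 := by
  have hf0 : 0 ≤ ∫ x, f x ^ 2 ∂μ := integral_nonneg fun x => sq_nonneg _
  have hg0 : 0 ≤ ∫ x, g x ^ 2 ∂μ := integral_nonneg fun x => sq_nonneg _
  refine abs_le_of_sq_le_sq ((sq_integral_mul_le hf hg).trans ?_) (by positivity)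
  have h1 : (∫ x, f x ^ 2 ∂μ) * ∫ x, g x ^ 2 ∂μ
      = (c⁻¹ * ∫ x, f x ^ 2 ∂μ) * (c * ∫ x, g x ^ 2 ∂μ) := by
    field_simp
  rw [h1]
  nlinarith [sq_nonneg ((c⁻¹ * ∫ x, f x ^ 2 ∂μ) - (c * ∫ x, g x ^ 2 ∂μ))]

/-- Interpolation of the first derivative between a function and its second derivative. -/
theorem integral_sq_deriv_le {f g k : ℝ → ℝ} (hf : L2Primitive f g) (hg : L2Primitive g k) {l : ℝ}
    (hl : 0 < l) (hl1 : l ≤ 1) :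
    ∫ x, g x ^ 2 ∂unitMeasure
      ≤ 2050 * ((l ^ 2)⁻¹ * ∫ x, f x ^ 2 ∂unitMeasure + l ^ 2 * ∫ x, k x ^ 2 ∂unitMeasure) := by
  have hibp := hf.integral_mul_eq hg (a := 0) (b := 1) (by simp) (by simp)
  rw [integral_unit, integral_unit] at hibp
  have hcs := abs_integral_mul_le hf.memLp_fun hg.memLp (c := l ^ 2) (by positivity)
  have hgg : ∫ x, g x * g x ∂unitMeasure = ∫ x, g x ^ 2 ∂unitMeasure := by simp_rw [sq]
  rw [hgg] at hibp
  -- The boundary terms must be absorbed: the scale `l / 64` for `f` and the weight `8 / l` leave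
  -- `1/4` of `∫ g²` at each end point, so half of `∫ g²` remains on the left.
  have hend : ∀ t ∈ Icc (0 : ℝ) 1, |f t * g t| ≤ 512 * ((l ^ 2)⁻¹ * ∫ x, f x ^ 2 ∂unitMeasure)
      + 1 / 4 * ∫ x, g x ^ 2 ∂unitMeasure + 1 / 8 * (l ^ 2 * ∫ x, k x ^ 2 ∂unitMeasure) := by
    intro t ht
    have h1 := hf.sq_le (l := l / 64) (by positivity) (by linarith) ht
    have h2 := hg.sq_le hl hl1 ht
    have h3 : |f t * g t| ≤ (8 / l * f t ^ 2 + l / 8 * g t ^ 2) / 2 := by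
      rw [abs_mul]
      have e1 : 8 / l * f t ^ 2 + l / 8 * g t ^ 2 - 2 * (|f t| * |g t|)
          = 8 / l * (|f t| - l / 8 * |g t|) ^ 2 := by
        rw [← sq_abs (f t), ← sq_abs (g t)]
        field_simp
        ring
      have : 0 ≤ 8 / l * (|f t| - l / 8 * |g t|) ^ 2 := by positivity
      linarith
    have h4 := mul_le_mul_of_nonneg_left h1 (show 0 ≤ 8 / l by positivity)
    have h5 := mul_le_mul_of_nonneg_left h2 (show 0 ≤ l / 8 by positivity)
    calc _ ≤ _ := h3
      _ ≤ (8 / l * (2 / (l / 64) * ∫ x, f x ^ 2 ∂unitMeasure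
            + 2 * (l / 64) * ∫ x, g x ^ 2 ∂unitMeasure)
          + l / 8 * (2 / l * ∫ x, g x ^ 2 ∂unitMeasure
            + 2 * l * ∫ x, k x ^ 2 ∂unitMeasure)) / 2 := by linarith
      _ = _ := by
        field_simp
        ring
  have h0 := abs_le.1 (hend 0 (by simp))
  have h1 := abs_le.1 (hend 1 (by simp))
  have h2 := abs_le.1 hcs
  have hk0 : 0 ≤ l ^ 2 * ∫ x, k x ^ 2 ∂unitMeasure :=
    mul_nonneg (by positivity) (integral_nonneg fun x => sq_nonneg _)
  linarith

/-- Induction on `k`: the previous step with weight `θ² / (2C)` turns `C θ⁻² A (k+1)` into half of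
`A (k+2)`, which is absorbed on the left, plus a multiple of `A 0`. The constant is chosen before
`A`, so it does not depend on the function or on the bandwidth. -/
theorem exists_interpolation_step (m : ℕ) (C : ℝ) (hC : 0 < C) (k : ℕ) :
    ∀ η : ℝ, 0 < η → ∃ K : ℝ, 0 ≤ K ∧ ∀ A : ℕ → ℝ, (∀ j, 0 ≤ A j) →
      (∀ j, j + 2 ≤ m → ∀ θ : ℝ, 0 < θ → θ ≤ 1 →
        A (j + 1) ≤ C * ((θ ^ 2)⁻¹ * A j + θ ^ 2 * A (j + 2))) →
      k + 2 ≤ m → A (k + 1) ≤ η * A (k + 2) + K * A 0 := by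
  have hθ : ∀ η : ℝ, 0 < η → ∃ θ : ℝ, 0 < θ ∧ θ ≤ 1 ∧ 2 * C * θ ^ 2 ≤ η := by
    intro η hη
    refine ⟨min 1 (η / (2 * C)), lt_min one_pos (by positivity), min_le_left _ _, ?_⟩
    have h1 : min 1 (η / (2 * C)) ^ 2 ≤ η / (2 * C) := by
      have ha : (0:ℝ) ≤ min 1 (η / (2 * C)) := (lt_min one_pos (by positivity)).le
      calc min 1 (η / (2 * C)) ^ 2 = min 1 (η / (2 * C)) * min 1 (η / (2 * C)) := sq _
        _ ≤ 1 * (η / (2 * C)) :=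
          mul_le_mul (min_le_left _ _) (min_le_right _ _) ha zero_le_one
        _ = _ := one_mul _
    calc 2 * C * min 1 (η / (2 * C)) ^ 2 ≤ 2 * C * (η / (2 * C)) := by gcongr
      _ = η := by field_simp
  induction k with
  | zero =>
    intro η hη
    obtain ⟨θ, h0, h1, h2⟩ := hθ η hη
    refine ⟨C * (θ ^ 2)⁻¹, by positivity, fun A hA H hm => ?_⟩
    have := H 0 hm θ h0 h1
    have h3 : C * θ ^ 2 * A 2 ≤ η * A 2 :=
      mul_le_mul_of_nonneg_right (by nlinarith [mul_pos hC (pow_pos h0 2)]) (hA 2)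
    simp only [zero_add] at this ⊢
    linarith
  | succ k ih =>
    intro η hη
    obtain ⟨θ, h0, h1, h2⟩ := hθ η hη
    obtain ⟨K, hK, HK⟩ := ih (θ ^ 2 / (2 * C)) (by positivity)
    refine ⟨2 * C * (θ ^ 2)⁻¹ * K, by positivity, fun A hA H hm => ?_⟩
    have e1 := H (k + 1) hm θ h0 h1
    have e2 := HK A hA H (by omega)
    have e3 := mul_le_mul_of_nonneg_left e2 (show 0 ≤ C * (θ ^ 2)⁻¹ by positivity)
    have e4 : C * (θ ^ 2)⁻¹ * (θ ^ 2 / (2 * C) * A (k + 2) + K * A 0)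
        = A (k + 2) / 2 + C * (θ ^ 2)⁻¹ * K * A 0 := by
      field_simp
    have e5 := mul_le_mul_of_nonneg_right h2 (hA (k + 3))
    simp only [add_assoc, Nat.reduceAdd] at e1 e2 e3 e4 e5 ⊢
    linarith

/-- Steps of weight one telescope from index `1` up to index `m`, each adding only a multiple of `A
0`. -/
theorem exists_interpolation_const (m : ℕ) (hm : 1 ≤ m) (C : ℝ) (hC : 0 < C) :
    ∃ K : ℝ, 0 < K ∧ ∀ A : ℕ → ℝ, (∀ j, 0 ≤ A j) →
      (∀ j, j + 2 ≤ m → ∀ θ : ℝ, 0 < θ → θ ≤ 1 →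
        A (j + 1) ≤ C * ((θ ^ 2)⁻¹ * A j + θ ^ 2 * A (j + 2))) →
      A 1 ≤ K * (A 0 + A m) := by
  have key : ∀ k : ℕ, ∃ K : ℝ, 0 ≤ K ∧ ∀ A : ℕ → ℝ, (∀ j, 0 ≤ A j) →
      (∀ j, j + 2 ≤ m → ∀ θ : ℝ, 0 < θ → θ ≤ 1 →
        A (j + 1) ≤ C * ((θ ^ 2)⁻¹ * A j + θ ^ 2 * A (j + 2))) →
      k + 1 ≤ m → A 1 ≤ A (k + 1) + K * A 0 := by
    intro k
    induction k with
    | zero => exact ⟨0, le_rfl, fun A hA H _ => by simp⟩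
    | succ k ih =>
      obtain ⟨K, hK, HK⟩ := ih
      obtain ⟨K', hK', HK'⟩ := exists_interpolation_step m C hC k 1 one_pos
      refine ⟨K + K', by positivity, fun A hA H hm => ?_⟩
      have e1 := HK A hA H (by omega)
      have e2 := HK' A hA H hm
      simp only [add_assoc, Nat.reduceAdd] at e1 e2 ⊢
      linarith
  obtain ⟨K, hK, H⟩ := key (m - 1)
  refine ⟨K + 1, by positivity, fun A hA HA => ?_⟩
  have := H A hA HA (by omega)
  rw [Nat.sub_add_cancel hm] at this
  nlinarith [hA 0, hA m, mul_nonneg hK (hA m)]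

/-- The scaled first derivative is controlled by the function and the scaled derivative of order
`m`. -/
theorem exists_sobolev_interpolation (m : ℕ) (hm : 1 ≤ m) :
    ∃ K : ℝ, 0 < K ∧ ∀ F : ℕ → ℝ → ℝ, SobolevChain m F → ∀ h : ℝ, 0 < h → h ≤ 1 →
      h ^ 2 * ∫ x, F 1 x ^ 2 ∂unitMeasure
        ≤ K * (∫ x, F 0 x ^ 2 ∂unitMeasure + h ^ (2 * m) * ∫ x, F m x ^ 2 ∂unitMeasure) := by
  obtain ⟨K, hK, H⟩ := exists_interpolation_const m hm 2050 (by norm_num)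
  refine ⟨K, hK, fun F hF h h0 h1 => ?_⟩
  -- The weights `h^(2j)` make the second-order inequality at length `θ h` scale invariant, so that
  -- one constant serves every `h`.
  have := H (fun j => h ^ (2 * j) * ∫ x, F j x ^ 2 ∂unitMeasure)
    (fun j => mul_nonneg (by positivity) (integral_nonneg fun x => sq_nonneg _)) ?_
  · simpa using this
  · intro j hj θ hθ0 hθ1
    have e := integral_sq_deriv_le (hF j (by omega)) (hF (j + 1) hj) (l := θ * h) (by positivity)
      (mul_le_one₀ hθ1 h0.le h1)
    have e' := mul_le_mul_of_nonneg_left e (show 0 ≤ h ^ (2 * (j + 1)) by positivity)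
    refine e'.trans (le_of_eq ?_)
    have : h ^ (2 * (j + 2)) = h ^ (2 * j) * h ^ 4 := by ring
    rw [this, show h ^ (2 * (j + 1)) = h ^ (2 * j) * h ^ 2 by ring]
    field_simp

/-! ### The bias term -/

/-- Repeated integration by parts under natural boundary conditions. -/
theorem sq_integral_mul_le_of_boundary {m : ℕ} {F G : ℕ → ℝ → ℝ} (hF : SobolevChain (2 * m) F)
    (hG : SobolevChain m G) (hbd : ∀ s, m ≤ s → s < 2 * m → F s 0 = 0 ∧ F s 1 = 0) (hm : 1 ≤ m) :
    (∫ x, F m x * G m x ∂unitMeasure) ^ 2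
      ≤ (∫ x, F (2 * m) x ^ 2 ∂unitMeasure) * ∫ x, G 0 x ^ 2 ∂unitMeasure := by
  -- One derivative at a time moves from `G` to `F`; the boundary terms carry `F s` with `m ≤ s <
  -- 2m` and vanish at both ends. Squaring discards the alternating sign.
  have key : ∀ i ≤ m, (∫ x, F m x * G m x ∂unitMeasure) ^ 2
      = (∫ x, F (m + i) x * G (m - i) x ∂unitMeasure) ^ 2 := by
    intro i
    induction i with
    | zero => intro _; simp
    | succ i ih =>
      intro hi
      rw [ih (by omega)]
      obtain ⟨k, hk⟩ : ∃ k, m - i = k + 1 := ⟨m - i - 1, by omega⟩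
      have hk' : m - (i + 1) = k := by omega
      have hb := hbd (m + i) (by omega) (by omega)
      have := (hF (m + i) (by omega)).integral_mul_eq (hG k (by omega)) (a := 0) (b := 1)
        (by simp) (by simp)
      rw [integral_unit, integral_unit, hb.1, hb.2] at this
      rw [hk, hk', this]
      ring_nf
  have h1 := key m le_rfl
  rw [Nat.sub_self, ← two_mul] at h1
  rw [h1]
  have h2 := hF (2 * m - 1) (by omega)
  rw [Nat.sub_add_cancel (by omega)] at h2
  exact sq_integral_mul_le h2.memLp (hG 0 (by omega)).memLp_fun

/-! ### Consequences of a quasi-uniform design -/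

/-- A continuously differentiable function is a primitive of its derivative. -/
theorem L2Primitive.of_hasDerivAt {f f' : ℝ → ℝ} (h : ∀ x, HasDerivAt f (f' x) x)
    (hc : Continuous f') : L2Primitive f f' := by
  refine ⟨memLp_unit_of_continuousOn hc.continuousOn, fun x _ => ?_⟩
  rw [intervalIntegral.integral_eq_sub_of_hasDerivAt (fun u _ => h u) (hc.intervalIntegrable _ _)]
  ring

/-- The quasi-uniformity of the design, stated for primitives. -/
theorem QuasiUniform.exists_bound {t : (n : ℕ) → Fin n → ℝ} (ht : QuasiUniform t) :
    ∃ c : ℝ, 0 < c ∧ ∀ n : ℕ, 2 ≤ n → ∀ f g : ℝ → ℝ, L2Primitive f g →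
      |(1 / (n : ℝ)) * ∑ i, f (t n i) - ∫ x, f x ∂unitMeasure|
        ≤ c / n * Real.sqrt (∫ x, g x ^ 2 ∂unitMeasure) := by
  obtain ⟨c, hc⟩ := ht
  refine ⟨|c| + 1, by positivity, fun n hn f g hfg => ?_⟩
  obtain ⟨h1, h2⟩ := hfg.memSobolev
  have h3 := hc n hn f h1
  rw [integral_unit, integral_unit] at h3
  have h4 : ∫ x, derivI 1 f x ^ 2 ∂unitMeasure = ∫ x, g x ^ 2 ∂unitMeasure := by
    refine integral_congr_ae ?_
    filter_upwards [h2] with x hx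
    rw [hx]
  rw [h4] at h3
  refine h3.trans ?_
  gcongr
  exact (le_abs_self c).trans (by linarith)

/-- A bound for the number of design points near a given point. -/
theorem card_near_le {n : ℕ} {c : ℝ} {t : Fin n → ℝ}
    (H : ∀ f g : ℝ → ℝ, L2Primitive f g →
      |(1 / (n : ℝ)) * ∑ i, f (t i) - ∫ x, f x ∂unitMeasure|
        ≤ c / n * Real.sqrt (∫ x, g x ^ 2 ∂unitMeasure)) (hc : 0 < c) (x₀ : ℝ) {l : ℝ} (hl : 0 < l)
    (J : Finset (Fin n)) (hJ : ∀ i ∈ J, |t i - x₀| ≤ l) :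
    (J.card : ℝ) / n ≤ 2 * Real.pi * l + 2 * c / (n * l) := by
  -- A smooth substitute for the indicator of a window: it is at least `1/2` within distance `l` of
  -- `x₀`, its integral is at most `π l`, and its slope is at most `1 / l`.
  set f : ℝ → ℝ := fun x => (1 + ((x - x₀) / l) ^ 2)⁻¹
  set f' : ℝ → ℝ := fun x =>
    -(2 * ((x - x₀) / l) * (1 / l)) / (1 + ((x - x₀) / l) ^ 2) ^ 2
  have hpos : ∀ x : ℝ, 0 < 1 + ((x - x₀) / l) ^ 2 := fun x => by positivity
  have hder : ∀ x, HasDerivAt f (f' x) x := by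
    intro x
    have h1 : HasDerivAt (fun x : ℝ => (x - x₀) / l) (1 / l) x :=
      ((hasDerivAt_id x).sub_const x₀).div_const l
    have h2 : HasDerivAt f _ x := ((h1.pow 2).const_add 1).inv (hpos x).ne'
    exact h2.congr_deriv (by simp [f'])
  have hcont : Continuous f' := by
    refine Continuous.div (by fun_prop) (by fun_prop) fun x => (pow_pos (hpos x) 2).ne'
  have hprim := L2Primitive.of_hasDerivAt hder hcont
  have hA := H f f' hprim
  have hf'_bd : ∀ x, f' x ^ 2 ≤ (1 / l) ^ 2 := by
    intro x
    have h1 : |f' x| ≤ 1 / l := by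
      simp only [f']
      rw [abs_div, abs_neg, abs_mul, abs_of_pos (pow_pos (hpos x) 2),
        abs_of_pos (show 0 < 1 / l by positivity), div_le_iff₀ (pow_pos (hpos x) 2), mul_comm]
      gcongr
      set y := (x - x₀) / l
      rw [abs_le]
      constructor <;> nlinarith [sq_nonneg (1 + y), sq_nonneg (1 - y), sq_nonneg (y ^ 2)]
    exact sq_le_sq' (abs_le.1 h1).1 (abs_le.1 h1).2
  have hsq : Real.sqrt (∫ x, f' x ^ 2 ∂unitMeasure) ≤ 1 / l := by
    rw [Real.sqrt_le_left (by positivity)]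
    calc ∫ x, f' x ^ 2 ∂unitMeasure ≤ ∫ x, (1 / l) ^ 2 ∂unitMeasure :=
          integral_mono hprim.memLp.integrable_sq (integrable_const _) hf'_bd
      _ = (1 / l) ^ 2 := by simp
  have hint : ∫ x, f x ∂unitMeasure ≤ Real.pi * l := by
    rw [← integral_unit]
    have h1 : ∀ x ∈ uIcc (0 : ℝ) 1, HasDerivAt (fun x => l * Real.arctan ((x - x₀) / l)) (f x) x := by
      intro x _
      have h1 : HasDerivAt (fun x : ℝ => (x - x₀) / l) (1 / l) x :=
        ((hasDerivAt_id x).sub_const x₀).div_const l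
      have h2 := (h1.arctan).const_mul l
      refine h2.congr_deriv ?_
      change l * (1 / (1 + ((x - x₀) / l) ^ 2) * (1 / l)) = (1 + ((x - x₀) / l) ^ 2)⁻¹
      field_simp
    have hfc : Continuous f := Continuous.inv₀ (by fun_prop) fun x => (hpos x).ne'
    rw [intervalIntegral.integral_eq_sub_of_hasDerivAt h1 (hfc.intervalIntegrable _ _)]
    have h2 := Real.arctan_lt_pi_div_two ((1 - x₀) / l)
    have h3 := Real.neg_pi_div_two_lt_arctan ((0 - x₀) / l)
    nlinarith
  have hsum : (J.card : ℝ) / 2 ≤ ∑ i, f (t i) := by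
    calc (J.card : ℝ) / 2 = ∑ i ∈ J, (1 / 2 : ℝ) := by rw [Finset.sum_const, nsmul_eq_mul]; ring
      _ ≤ ∑ i ∈ J, f (t i) := by
          refine Finset.sum_le_sum fun i hi => ?_
          simp only [f]
          rw [one_div]
          apply inv_anti₀ (hpos _)
          have : ((t i - x₀) / l) ^ 2 ≤ 1 := by
            rw [sq_le_one_iff_abs_le_one, abs_div, abs_of_pos hl, div_le_one hl]
            exact hJ i hi
          linarith
      _ ≤ ∑ i, f (t i) :=
          Finset.sum_le_sum_of_subset_of_nonneg (Finset.subset_univ _)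
            fun i _ _ => (inv_pos.2 (hpos _)).le
  have h1 := (abs_le.1 hA).2
  have h2 : c / n * Real.sqrt (∫ x, f' x ^ 2 ∂unitMeasure) ≤ c / n * (1 / l) := by gcongr
  have h3 : (1 / (n : ℝ)) * (J.card / 2) ≤ (1 / (n : ℝ)) * ∑ i, f (t i) := by gcongr
  have h4 : (J.card : ℝ) / n = 2 * ((1 / (n : ℝ)) * (J.card / 2)) := by ring
  have h5 : c / n * (1 / l) = c / (n * l) := by rw [div_mul_div_comm, mul_one]
  rw [h4, mul_div_assoc]
  linarith

/-- The empirical second moment of a function is bounded below by its `L²` norm. -/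
theorem integral_sq_sub_le_sum {n : ℕ} {c : ℝ} {t : Fin n → ℝ}
    (H : ∀ f g : ℝ → ℝ, L2Primitive f g →
      |(1 / (n : ℝ)) * ∑ i, f (t i) - ∫ x, f x ∂unitMeasure|
        ≤ c / n * Real.sqrt (∫ x, g x ^ 2 ∂unitMeasure)) (hc : 0 < c) {f g : ℝ → ℝ}
    (hfg : L2Primitive f g) {S : ℝ} (hS0 : 0 ≤ S) (hS : ∀ x ∈ Icc (0 : ℝ) 1, |f x| ≤ S) :
    ∫ x, f x ^ 2 ∂unitMeasure - 2 * c / n * (S * Real.sqrt (∫ x, g x ^ 2 ∂unitMeasure))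
      ≤ (1 / (n : ℝ)) * ∑ i, f (t i) ^ 2 := by
  -- Quasi-uniformity is applied to `f²`, whose derivative `2 f g` has `L²` norm at most `2 S` times
  -- that of `g`.
  have hprim := hfg.mul hfg
  have hA := (abs_le.1 (H _ _ hprim)).1
  have hsq : Real.sqrt (∫ x, (g x * f x + f x * g x) ^ 2 ∂unitMeasure)
      ≤ 2 * (S * Real.sqrt (∫ x, g x ^ 2 ∂unitMeasure)) := by
    rw [Real.sqrt_le_left (by positivity), mul_pow, mul_pow,
      Real.sq_sqrt (integral_nonneg fun x => sq_nonneg _), ← mul_assoc, ← integral_const_mul]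
    refine integral_mono_ae hprim.memLp.integrable_sq (hfg.memLp.integrable_sq.const_mul _) ?_
    refine (ae_restrict_iff' measurableSet_Icc).2 (Eventually.of_forall fun x hx => ?_)
    have h1 : f x ^ 2 ≤ S ^ 2 := sq_le_sq' (abs_le.1 (hS x hx)).1 (abs_le.1 (hS x hx)).2
    have h2 := mul_le_mul_of_nonneg_right h1 (sq_nonneg (g x))
    change (g x * f x + f x * g x) ^ 2 ≤ 2 ^ 2 * S ^ 2 * g x ^ 2
    nlinarith
  have h2 := mul_le_mul_of_nonneg_left hsq (show 0 ≤ c / n by positivity)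
  simp only [← sq] at hA
  have h3 : 2 * c / n * (S * Real.sqrt (∫ x, g x ^ 2 ∂unitMeasure))
      = c / n * (2 * (S * Real.sqrt (∫ x, g x ^ 2 ∂unitMeasure))) := by ring
  rw [h3]
  linarith

/-- On a partition of the unit interval into cells of length `1 / p`, the squared oscillations of a
function over the cells have a sum of order `1 / p`. -/
theorem L2Primitive.exists_oscillation {f g : ℝ → ℝ} (h : L2Primitive f g) {p : ℕ} (hp : 1 ≤ p) :
    ∃ T : ℕ → ℝ, (∀ k, 0 ≤ T k) ∧
      ∑ k ∈ Finset.range (p + 1), T k = 1 / p * ∫ x, g x ^ 2 ∂unitMeasure ∧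
      ∀ x ∈ Icc (0 : ℝ) 1, ∀ y ∈ Icc (0 : ℝ) 1, ⌊x * p⌋₊ = ⌊y * p⌋₊ →
        (f x - f y) ^ 2 ≤ T ⌊x * p⌋₊ := by
  have hp0 : (0 : ℝ) < p := by exact_mod_cast hp
  have hint : ∀ {a b : ℝ}, a ∈ Icc (0 : ℝ) 1 → b ∈ Icc (0 : ℝ) 1 →
      IntervalIntegrable (fun x => g x ^ 2) volume a b :=
    fun ha hb => intervalIntegrable_of_integrable_unit h.memLp.integrable_sq ha hb
  -- `Γ` is the cumulative energy of `g`, frozen beyond `1`. By Cauchy-Schwarz, `1/p` times its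
  -- increment over a cell bounds the squared oscillation there. There are `p + 1` cells because `x
  -- = 1` has floor `p`; this last cell has no energy.
  set Γ : ℝ → ℝ := fun x => ∫ u in (0 : ℝ)..min x 1, g u ^ 2
  have hmem : ∀ {x : ℝ}, 0 ≤ x → min x 1 ∈ Icc (0 : ℝ) 1 :=
    fun hx => ⟨le_min hx zero_le_one, min_le_right _ _⟩
  have hΓ : ∀ {x y : ℝ}, 0 ≤ x → 0 ≤ y → Γ y - Γ x = ∫ u in min x 1..min y 1, g u ^ 2 :=
    fun hx hy => intervalIntegral.integral_interval_sub_left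
      (hint (by simp) (hmem hy)) (hint (by simp) (hmem hx))
  have hmono : ∀ {x y : ℝ}, 0 ≤ x → x ≤ y → Γ x ≤ Γ y := by
    intro x y hx hxy
    have : 0 ≤ Γ y - Γ x := by
      rw [hΓ hx (hx.trans hxy)]
      exact intervalIntegral.integral_nonneg (min_le_min_right _ hxy) fun u _ => sq_nonneg _
    linarith
  have hosc : ∀ x ∈ Icc (0 : ℝ) 1, ∀ y ∈ Icc (0 : ℝ) 1, x ≤ y →
      (f x - f y) ^ 2 ≤ (y - x) * (Γ y - Γ x) := by
    intro x hx y hy hxy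
    rw [hΓ hx.1 hy.1, min_eq_left hx.2, min_eq_left hy.2, ← neg_sub (f y), neg_sq, h.sub_eq hx hy,
      intervalIntegral.integral_of_le hxy, intervalIntegral.integral_of_le hxy]
    have hsub : Ioc x y ⊆ Icc (0 : ℝ) 1 := fun u hu => ⟨hx.1.trans hu.1.le, hu.2.trans hy.2⟩
    have := sq_integral_mul_le (μ := volume.restrict (Ioc x y)) (memLp_const (1 : ℝ))
      (h.memLp.mono_measure (Measure.restrict_mono hsub le_rfl))
    simpa [hxy] using this
  refine ⟨fun k => 1 / p * (Γ ((k + 1 : ℕ) / p) - Γ ((k : ℕ) / p)), fun k => ?_, ?_, ?_⟩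
  · refine mul_nonneg (by positivity) (sub_nonneg.2 (hmono (by positivity) ?_))
    gcongr
    exact Nat.le_succ k
  · rw [← Finset.mul_sum, Finset.sum_range_sub (fun k : ℕ => Γ ((k : ℕ) / p))]
    congr 1
    have h1 : (1 : ℝ) ≤ ((p + 1 : ℕ) : ℝ) / p := by
      rw [le_div_iff₀ hp0]; push_cast; linarith
    simp only [Γ, min_eq_right h1]
    simp [← integral_unit]
  · have key : ∀ x ∈ Icc (0 : ℝ) 1, ∀ y ∈ Icc (0 : ℝ) 1, x ≤ y → ∀ k : ℕ, ⌊x * p⌋₊ = k →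
        ⌊y * p⌋₊ = k → (f x - f y) ^ 2 ≤ 1 / p * (Γ ((k + 1 : ℕ) / p) - Γ ((k : ℕ) / p)) := by
      intro x hx y hy hxy k hkx hky
      have e1 : (k : ℝ) / p ≤ x := by
        rw [div_le_iff₀ hp0, ← hkx]
        exact Nat.floor_le (mul_nonneg hx.1 hp0.le)
      have e2 : y ≤ ((k + 1 : ℕ) : ℝ) / p := by
        rw [le_div_iff₀ hp0, ← hky]
        push_cast
        exact (Nat.lt_floor_add_one _).le
      have e3 : ((k + 1 : ℕ) : ℝ) / p = (k : ℝ) / p + 1 / p := by push_cast; ring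
      have e4 := hmono hy.1 e2
      have e5 := hmono (show (0 : ℝ) ≤ (k : ℝ) / p by positivity) e1
      have e6 := hmono hx.1 hxy
      refine (hosc x hx y hy hxy).trans ?_
      apply mul_le_mul <;> linarith [show (0 : ℝ) ≤ 1 / p by positivity]
    intro x hx y hy hxy
    rcases le_total x y with hle | hle
    · exact key x hx y hy hle _ rfl hxy.symm
    · rw [← neg_sub, neg_sq]
      exact key y hy x hx hle _ hxy.symm rfl

/-! ### Convexity: remainders and dyadic increments of the score -/

theorem IsSubgradientChoice.monotone {ρ ψ : ℝ → ℝ} (h : IsSubgradientChoice ρ ψ) : Monotone ψ := by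
  intro x y hxy
  rcases hxy.eq_or_lt with rfl | hlt
  · exact le_rfl
  · have h1 := h x y
    have h2 := h y x
    by_contra hc
    nlinarith [mul_pos (sub_pos.2 (not_le.1 hc)) (sub_pos.2 hlt)]

/-- Mirror symmetry, by which negative perturbations are reduced to positive ones. -/
theorem IsSubgradientChoice.reflect {ρ ψ : ℝ → ℝ} (h : IsSubgradientChoice ρ ψ) :
    IsSubgradientChoice (fun y => ρ (-y)) (fun y => -ψ (-y)) := by
  intro x y
  have := h (-x) (-y)
  simp only
  linarith

/-- The remainder of the linearization of `ρ` at `e`. -/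
def remainder (ρ ψ : ℝ → ℝ) (e x : ℝ) : ℝ := ρ (e + x) - ρ e - ψ e * x

theorem remainder_nonneg {ρ ψ : ℝ → ℝ} (h : IsSubgradientChoice ρ ψ) (e x : ℝ) :
    0 ≤ remainder ρ ψ e x := by
  have := h e (e + x)
  unfold remainder
  linarith [show ψ e * (e + x - e) = ψ e * x by ring]

/-- The increment of `ψ` over a dyadic shell. -/
noncomputable def shellIncr (ψ : ℝ → ℝ) (b : ℝ) (k : ℕ) (e : ℝ) : ℝ :=
  ψ (e + b / 2 ^ k) - ψ (e + b / 2 ^ (k + 1))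

theorem shellIncr_nonneg {ψ : ℝ → ℝ} (h : Monotone ψ) {b : ℝ} (hb : 0 ≤ b) (k : ℕ) (e : ℝ) :
    0 ≤ shellIncr ψ b k e := by
  refine sub_nonneg.2 (h ?_)
  gcongr
  · norm_num
  · exact Nat.le_succ k

theorem shellIncr_neg (ψ : ℝ → ℝ) (b : ℝ) (k : ℕ) (e : ℝ) :
    shellIncr ψ (-b) k e = -shellIncr (fun y => -ψ (-y)) b k (-e) := by
  simp only [shellIncr, neg_add, neg_neg, neg_div]
  ring

/-- With `s = a / 2^k`, the subgradient inequalities at `e + s` and at `e` give a remainder of at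
least `(x - s) (ψ (e + s) - ψ e)`. Here `x - s ≥ s`, and by monotonicity the increment of `ψ`
dominates its part over the shell. The resulting bound no longer involves `x`, and this gives
uniformity over all perturbations. -/
theorem mul_shellIncr_le_remainder {ρ ψ : ℝ → ℝ} (h : IsSubgradientChoice ρ ψ) {a : ℝ} (ha : 0 ≤ a)
    (k : ℕ) {e x : ℝ} (hx : 2 * (a / 2 ^ k) ≤ x) :
    a / 2 ^ k * shellIncr ψ a k e ≤ remainder ρ ψ e x := by
  set s := a / 2 ^ k
  have hs : 0 ≤ s := by positivity
  have h1 := h (e + s) (e + x)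
  have h2 := h e (e + s)
  have h3 : ψ e ≤ ψ (e + a / 2 ^ (k + 1)) := h.monotone (by linarith [show 0 ≤ a / 2 ^ (k + 1) by positivity])
  have h4 : ψ (e + a / 2 ^ (k + 1)) ≤ ψ (e + s) := by
    have := shellIncr_nonneg h.monotone ha k e
    unfold shellIncr at this
    linarith
  have h5 : 0 ≤ (ψ (e + s) - ψ e) * (x - 2 * s) :=
    mul_nonneg (by linarith) (by linarith)
  have h6 : 0 ≤ s * (ψ (e + a / 2 ^ (k + 1)) - ψ e) := mul_nonneg hs (by linarith)
  unfold remainder shellIncr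
  nlinarith

/-- Lower bound for the sum of the remainders over a cell on which the perturbation exceeds `s`. -/
theorem sum_remainder_ge_of_le {ι : Type*} {ρ ψ : ℝ → ℝ} (h : IsSubgradientChoice ρ ψ) {a ξ : ℝ}
    (ha : 0 < a) (hξ : 0 < ξ) {ν : ℕ → ℝ} (hν : ∀ k, ξ / 4 * (a / 2 ^ k) ≤ ν k) (M : ℕ)
    (J : Finset ι) (e x : ι → ℝ) {s : ℝ} (hs0 : 0 ≤ s) (hsa : s ≤ a) (hx : ∀ i ∈ J, s ≤ x i) :
    ξ / 128 * (J.card * s ^ 2) - ξ / 32 * (J.card * (a / 2 ^ M) ^ 2)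
        - ∑ k ∈ Finset.range (M + 1),
          2 / (J.card * ξ) * (∑ i ∈ J, shellIncr ψ a k (e i) - J.card * ν k) ^ 2
      ≤ ∑ i ∈ J, remainder ρ ψ (e i) (x i) := by
  have hrem : 0 ≤ ∑ i ∈ J, remainder ρ ψ (e i) (x i) :=
    Finset.sum_nonneg fun i _ => remainder_nonneg h _ _
  have hterm : ∀ k, 0 ≤ 2 / (J.card * ξ) *
      (∑ i ∈ J, shellIncr ψ a k (e i) - J.card * ν k) ^ 2 := fun k => by positivity
  have hE := Finset.sum_nonneg (s := Finset.range (M + 1)) fun k _ => hterm k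
  rcases J.eq_empty_or_nonempty with rfl | hJ
  · simp
  have hN : (0 : ℝ) < J.card := by exact_mod_cast hJ.card_pos
  -- Below the truncation level `M` the claimed lower bound is nonpositive, and the remainders are
  -- nonnegative.
  by_cases hsM : s < 2 * (a / 2 ^ M)
  · have h1 : s ^ 2 ≤ (2 * (a / 2 ^ M)) ^ 2 := by gcongr
    have h2 : ξ / 128 * (J.card * s ^ 2) ≤ ξ / 128 * (J.card * (2 * (a / 2 ^ M)) ^ 2) := by gcongr
    have h3 : ξ / 128 * (J.card * (2 * (a / 2 ^ M)) ^ 2)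
      = ξ / 32 * (J.card * (a / 2 ^ M) ^ 2) := by ring
    linarith
  · obtain ⟨k, hkM, hk1, hk2⟩ : ∃ k ≤ M, 2 * (a / 2 ^ k) ≤ s ∧ s ≤ 4 * (a / 2 ^ k) := by
      have hex : ∃ k, 2 * (a / 2 ^ k) ≤ s := ⟨M, not_lt.1 hsM⟩
      classical
      -- The smallest admissible level is comparable to `s`: either the preceding level fails, or
      -- the level is `0` and `s ≤ a` suffices.
      refine ⟨Nat.find hex, Nat.find_min' hex (not_lt.1 hsM), Nat.find_spec hex, ?_⟩
      rcases hk : Nat.find hex with _ | j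
      · simp only [pow_zero, div_one]; linarith
      · have := Nat.find_min hex (m := j) (by omega)
        rw [not_le] at this
        have e1 : 4 * (a / 2 ^ (j + 1)) = 2 * (a / 2 ^ j) := by
          rw [pow_succ]; field_simp; ring
        rw [e1]
        exact this.le
    set N : ℝ := (J.card : ℝ)
    set σ := a / 2 ^ k
    have hσ : 0 < σ := by positivity
    set Y := ∑ i ∈ J, shellIncr ψ a k (e i)
    have h1 : σ * Y ≤ ∑ i ∈ J, remainder ρ ψ (e i) (x i) := by
      rw [Finset.mul_sum]
      exact Finset.sum_le_sum fun i hi =>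
        mul_shellIncr_le_remainder h ha.le k (hk1.trans (hx i hi))
    have h2 : 2 / (N * ξ) * (Y - N * ν k) ^ 2 ≤ ∑ k ∈ Finset.range (M + 1),
          2 / (N * ξ) * (∑ i ∈ J, shellIncr ψ a k (e i) - N * ν k) ^ 2 :=
      Finset.single_le_sum (f := fun k => 2 / (N * ξ) *
        (∑ i ∈ J, shellIncr ψ a k (e i) - N * ν k) ^ 2) (fun k _ => hterm k)
        (Finset.mem_range.2 (by omega))
    -- The mean contributes `N ξ σ² / 4`. Completing the square spends half of it on the fluctuation
    -- of `Y`.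
    have h3 : N * ξ * σ ^ 2 / 8 - 2 / (N * ξ) * (Y - N * ν k) ^ 2 ≤ σ * Y := by
      have e1 : N * ξ * σ ^ 2 / 8 + 2 / (N * ξ) * (Y - N * ν k) ^ 2 + σ * (Y - N * ν k)
          = 2 / (N * ξ) * ((Y - N * ν k) + N * ξ * σ / 4) ^ 2 := by
        field_simp
        ring
      have e2 : 0 ≤ 2 / (N * ξ) * ((Y - N * ν k) + N * ξ * σ / 4) ^ 2 := by positivity
      have e3 : σ * (N * (ξ / 4 * σ)) ≤ σ * (N * ν k) := by
        have := hν k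
        gcongr
      nlinarith
    have h4 : ξ / 128 * (N * s ^ 2) ≤ N * ξ * σ ^ 2 / 8 := by
      have : s ^ 2 ≤ (4 * σ) ^ 2 := by gcongr
      calc ξ / 128 * (N * s ^ 2) ≤ ξ / 128 * (N * (4 * σ) ^ 2) := by gcongr
        _ = _ := by ring
    have h5 : 0 ≤ ξ / 32 * (N * (a / 2 ^ M) ^ 2) := by positivity
    linarith

/-- The stochastic error of the quadratic lower bound for the sum of the remainders over a cell. -/
noncomputable def cellError {ι : Type*} (ψ : ℝ → ℝ) (a ξ : ℝ) (ν₁ ν₂ : ℕ → ℝ) (M : ℕ)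
    (J : Finset ι) (e : ι → ℝ) : ℝ :=
  ∑ k ∈ Finset.range (M + 1), 2 / (J.card * ξ) *
    ((∑ i ∈ J, shellIncr ψ a k (e i) - J.card * ν₁ k) ^ 2
      + (∑ i ∈ J, shellIncr ψ (-a) k (e i) - J.card * ν₂ k) ^ 2)

/-- Quadratic lower bound for the sum of the remainders over a cell. -/
theorem sum_remainder_ge {ι : Type*} {ρ ψ : ℝ → ℝ} (h : IsSubgradientChoice ρ ψ) {a ξ : ℝ}
    (ha : 0 < a) (hξ : 0 < ξ) {ν₁ ν₂ : ℕ → ℝ} (hν₁ : ∀ k, ξ / 4 * (a / 2 ^ k) ≤ ν₁ k)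
    (hν₂ : ∀ k, ξ / 4 * (a / 2 ^ k) ≤ -ν₂ k) (M : ℕ) (J : Finset ι) (e x : ι → ℝ) {T : ℝ}
    (hT : 0 ≤ T) (hosc : ∀ i ∈ J, ∀ j ∈ J, (x i - x j) ^ 2 ≤ T) (hxa : ∀ i ∈ J, |x i| ≤ a) :
    ξ / 256 * ∑ i ∈ J, x i ^ 2 - ξ / 128 * (J.card * T) - ξ / 32 * (J.card * (a / 2 ^ M) ^ 2)
        - cellError ψ a ξ ν₁ ν₂ M J e ≤ ∑ i ∈ J, remainder ρ ψ (e i) (x i) := by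
  have hrem : 0 ≤ ∑ i ∈ J, remainder ρ ψ (e i) (x i) :=
    Finset.sum_nonneg fun i _ => remainder_nonneg h _ _
  have hsplit : cellError ψ a ξ ν₁ ν₂ M J e = ∑ k ∈ Finset.range (M + 1),
        2 / (J.card * ξ) * (∑ i ∈ J, shellIncr ψ a k (e i) - J.card * ν₁ k) ^ 2
      + ∑ k ∈ Finset.range (M + 1),
        2 / (J.card * ξ) * (∑ i ∈ J, shellIncr ψ (-a) k (e i) - J.card * ν₂ k) ^ 2 := by
    rw [← Finset.sum_add_distrib]
    exact Finset.sum_congr rfl fun k _ => mul_add _ _ _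
  have hE₁ : 0 ≤ ∑ k ∈ Finset.range (M + 1),
      2 / (J.card * ξ) * (∑ i ∈ J, shellIncr ψ a k (e i) - J.card * ν₁ k) ^ 2 :=
    Finset.sum_nonneg fun k _ => by positivity
  have hE₂ : 0 ≤ ∑ k ∈ Finset.range (M + 1),
      2 / (J.card * ξ) * (∑ i ∈ J, shellIncr ψ (-a) k (e i) - J.card * ν₂ k) ^ 2 :=
    Finset.sum_nonneg fun k _ => by positivity
  rcases J.eq_empty_or_nonempty with rfl | hJ
  · simp [cellError]
  -- If the largest perturbation is below the oscillation `τ`, the left side is nonpositive.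
  -- Otherwise every perturbation on the cell has the sign of the largest one and size at least `|x
  -- i₀| - τ`, so the one-sided bound applies.
  obtain ⟨i₀, hi₀, hmax⟩ := J.exists_max_image (fun i => |x i|) hJ
  set τ := Real.sqrt T
  have hτ : ∀ i ∈ J, ∀ j ∈ J, |x i - x j| ≤ τ := fun i hi j hj => Real.abs_le_sqrt (hosc i hi j hj)
  have hτT : τ ^ 2 = T := Real.sq_sqrt hT
  have hτ0 : 0 ≤ τ := Real.sqrt_nonneg T
  have hsum : ∑ i ∈ J, x i ^ 2 ≤ J.card * |x i₀| ^ 2 := by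
    rw [← nsmul_eq_mul]
    refine Finset.sum_le_card_nsmul _ _ _ fun i hi => ?_
    rw [← sq_abs]
    exact pow_le_pow_left₀ (abs_nonneg _) (hmax i hi) 2
  have hM0 : 0 ≤ ξ / 32 * (J.card * (a / 2 ^ M) ^ 2) := by positivity
  rcases le_total (|x i₀|) τ with hle | hle
  · have h1 : |x i₀| ^ 2 ≤ T := by rw [← hτT]; gcongr
    have h2 : ξ / 256 * ∑ i ∈ J, x i ^ 2 ≤ ξ / 256 * (J.card * T) := by
      gcongr
      exact hsum.trans (by gcongr)
    have h3 : 0 ≤ ξ / 256 * (J.card * T) := by positivity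
    linarith
  · have hs : 0 ≤ |x i₀| - τ := sub_nonneg.2 hle
    have hsa : |x i₀| - τ ≤ a := by linarith [hxa i₀ hi₀]
    have h1 : ξ / 256 * ∑ i ∈ J, x i ^ 2
        ≤ ξ / 128 * (J.card * (|x i₀| - τ) ^ 2) + ξ / 128 * (J.card * T) := by
      have : |x i₀| ^ 2 ≤ 2 * (|x i₀| - τ) ^ 2 + 2 * T := by
        rw [← hτT]; nlinarith [sq_nonneg (|x i₀| - 2 * τ)]
      calc ξ / 256 * ∑ i ∈ J, x i ^ 2 ≤ ξ / 256 * (J.card * (2 * (|x i₀| - τ) ^ 2 + 2 * T)) := by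
            gcongr
            exact hsum.trans (by gcongr)
        _ = _ := by ring
    rcases le_total 0 (x i₀) with hpos | hneg
    · have h2 := sum_remainder_ge_of_le h ha hξ hν₁ M J e x hs hsa fun i hi => by
        have := (abs_le.1 (hτ i₀ hi₀ i hi)).2
        rw [abs_of_nonneg hpos]
        linarith
      linarith
    · have h2 := sum_remainder_ge_of_le h.reflect ha hξ hν₂ M J (fun i => -e i) (fun i => -x i)
        hs hsa fun i hi => by
          have := (abs_le.1 (hτ i₀ hi₀ i hi)).1
          rw [abs_of_nonpos hneg]
          linarith
      have h3 : ∑ i ∈ J, remainder (fun y => ρ (-y)) (fun y => -ψ (-y)) (-e i) (-x i)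
          = ∑ i ∈ J, remainder ρ ψ (e i) (x i) := by
        refine Finset.sum_congr rfl fun i _ => ?_
        simp only [remainder]
        rw [show -(-e i + -x i) = e i + x i by ring, neg_neg]
        ring
      have h4 : ∀ k, (∑ i ∈ J, shellIncr (fun y => -ψ (-y)) a k (-e i) - J.card * -ν₂ k) ^ 2
          = (∑ i ∈ J, shellIncr ψ (-a) k (e i) - J.card * ν₂ k) ^ 2 := by
        intro k
        simp_rw [shellIncr_neg, Finset.sum_neg_distrib]
        ring
      rw [h3] at h2
      simp only [h4] at h2
      linarith

/-! ### Moment bounds for the stochastic terms -/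

section Moments

variable {Ω : Type*} [MeasurableSpace Ω] {P : Measure Ω} {ε : ℕ → Ω → ℝ}

theorem memLp_comp_of_identDistrib (hε_ident : ∀ i, IdentDistrib (ε i) (ε 0) P P) {φ : ℝ → ℝ}
    (hφ : Measurable φ) (hL : MemLp (fun ω => φ (ε 0 ω)) 2 P) (i : ℕ) :
    MemLp (fun ω => φ (ε i ω)) 2 P :=
  ((hε_ident i).comp hφ).symm.memLp_snd hL

theorem integral_comp_of_identDistrib (hε_ident : ∀ i, IdentDistrib (ε i) (ε 0) P P) {φ : ℝ → ℝ}
    (hφ : Measurable φ) (i : ℕ) : ∫ ω, φ (ε i ω) ∂P = ∫ ω, φ (ε 0 ω) ∂P :=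
  ((hε_ident i).comp hφ).integral_eq

/-- The second moment of a centred sum of functions of independent identically distributed random
variables. -/
theorem integral_sq_sum_sub_le [IsProbabilityMeasure P] (hε_indep : iIndepFun ε P)
    (hε_ident : ∀ i, IdentDistrib (ε i) (ε 0) P P) {φ : ℝ → ℝ} (hφ : Measurable φ)
    (hL : MemLp (fun ω => φ (ε 0 ω)) 2 P) {n : ℕ} (J : Finset (Fin n)) :
    Integrable (fun ω => (∑ i ∈ J, φ (ε i ω) - J.card * ∫ ω, φ (ε 0 ω) ∂P) ^ 2) P ∧
      ∫ ω, (∑ i ∈ J, φ (ε i ω) - J.card * ∫ ω, φ (ε 0 ω) ∂P) ^ 2 ∂P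
        ≤ J.card * ∫ ω, φ (ε 0 ω) ^ 2 ∂P := by
  have hLi := memLp_comp_of_identDistrib hε_ident hφ hL
  have hsum : MemLp (∑ i ∈ J, fun ω => φ (ε i ω)) 2 P := memLp_finsetSum' J fun i _ => hLi i
  have hmean : P[∑ i ∈ J, fun ω => φ (ε i ω)] = J.card * ∫ ω, φ (ε 0 ω) ∂P := by
    simp only [Finset.sum_apply]
    rw [integral_finsetSum _ fun (i : Fin n) _ => (hLi i).integrable one_le_two]
    simp_rw [integral_comp_of_identDistrib hε_ident hφ]
    rw [Finset.sum_const, nsmul_eq_mul]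
  have hfun : (fun ω => (∑ i ∈ J, φ (ε i ω) - J.card * ∫ ω, φ (ε 0 ω) ∂P) ^ 2)
      = fun ω => ((∑ i ∈ J, fun ω => φ (ε i ω)) ω - P[∑ i ∈ J, fun ω => φ (ε i ω)]) ^ 2 := by
    rw [hmean]
    funext ω
    rw [Finset.sum_apply]
  rw [hfun]
  refine ⟨(hsum.sub (memLp_const _)).integrable_sq, ?_⟩
  rw [← variance_eq_integral hsum.aemeasurable, IndepFun.variance_sum fun (i : Fin n) _ => hLi i]
  · calc ∑ i ∈ J, Var[fun ω => φ (ε i ω); P] ≤ ∑ _i ∈ J, ∫ ω, φ (ε 0 ω) ^ 2 ∂P := by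
          refine Finset.sum_le_sum fun i _ => ?_
          refine (variance_le_expectation_sq (hLi i).1).trans (le_of_eq ?_)
          exact integral_comp_of_identDistrib (φ := fun x => φ x ^ 2) hε_ident (hφ.pow_const 2) i
      _ = _ := by rw [Finset.sum_const, nsmul_eq_mul]
  · intro i _ j _ hij
    exact (hε_indep.indepFun (by simpa [Fin.val_inj] using hij)).comp hφ hφ

/-- The mean of a quadratic form in centred independent identically distributed random
variables. -/
theorem integral_quadraticForm [IsProbabilityMeasure P] (hε_indep : iIndepFun ε P)
    (hε_ident : ∀ i, IdentDistrib (ε i) (ε 0) P P) {φ : ℝ → ℝ} (hφ : Measurable φ)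
    (hL : MemLp (fun ω => φ (ε 0 ω)) 2 P) (hmean : ∫ ω, φ (ε 0 ω) ∂P = 0) {n : ℕ}
    (B : Fin n → Fin n → ℝ) :
    Integrable (fun ω => ∑ i : Fin n, ∑ j : Fin n, φ (ε i ω) * φ (ε j ω) * B i j) P ∧
      ∫ ω, ∑ i : Fin n, ∑ j : Fin n, φ (ε i ω) * φ (ε j ω) * B i j ∂P
        = (∫ ω, φ (ε 0 ω) ^ 2 ∂P) * ∑ i, B i i := by
  have hLi := memLp_comp_of_identDistrib hε_ident hφ hL
  have hint : ∀ i j : Fin n, Integrable (fun ω => φ (ε i ω) * φ (ε j ω) * B i j) P :=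
    fun i j => ((hLi i).integrable_mul (hLi j)).mul_const _
  refine ⟨integrable_finsetSum _ fun i _ => integrable_finsetSum _ fun j _ => hint i j, ?_⟩
  rw [integral_finsetSum _ fun i _ => integrable_finsetSum _ fun j _ => hint i j, Finset.mul_sum]
  refine Finset.sum_congr rfl fun i _ => ?_
  rw [integral_finsetSum _ fun j _ => hint i j, Finset.sum_eq_single i]
  · rw [integral_mul_const]
    congr 1
    simp_rw [← sq]
    exact integral_comp_of_identDistrib (φ := fun x => φ x ^ 2) hε_ident (hφ.pow_const 2) i
  -- Off-diagonal terms vanish by independence and centring.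
  · intro j _ hji
    rw [integral_mul_const]
    have hind : IndepFun (fun ω => φ (ε i ω)) (fun ω => φ (ε j ω)) P :=
      (hε_indep.indepFun (by simpa [Fin.val_inj] using hji.symm)).comp hφ hφ
    rw [hind.integral_fun_mul_eq_mul_integral (hLi i).1 (hLi j).1,
      integral_comp_of_identDistrib hε_ident hφ, hmean]
    simp
  · simp

theorem integral_sq_sum_mul {n : ℕ} (z : Fin n → ℝ) {a : Fin n → ℝ → ℝ}
    (ha : ∀ i, MemLp (a i) 2 unitMeasure) :
    ∫ x, (∑ i, z i * a i x) ^ 2 ∂unitMeasure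
      = ∑ i, ∑ j, z i * z j * ∫ x, a i x * a j x ∂unitMeasure := by
  have hint : ∀ i j : Fin n, Integrable (fun x => z i * z j * (a i x * a j x)) unitMeasure :=
    fun i j => ((ha i).integrable_mul (ha j)).const_mul _
  have : ∀ x, (∑ i, z i * a i x) ^ 2 = ∑ i, ∑ j, z i * z j * (a i x * a j x) := by
    intro x
    rw [sq, Finset.sum_mul_sum]
    exact Finset.sum_congr rfl fun i _ => Finset.sum_congr rfl fun j _ => by ring
  simp_rw [this]
  rw [integral_finsetSum _ fun i _ => integrable_finsetSum _ fun j _ => hint i j]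
  refine Finset.sum_congr rfl fun i _ => ?_
  rw [integral_finsetSum _ fun j _ => hint i j]
  exact Finset.sum_congr rfl fun j _ => integral_const_mul _ _

/-- A uniform bound for weighted sums of function values with centred random weights. -/
theorem exists_score_bound [IsProbabilityMeasure P] (hε_indep : iIndepFun ε P)
    (hε_ident : ∀ i, IdentDistrib (ε i) (ε 0) P P) {φ : ℝ → ℝ} (hφ : Measurable φ)
    (hL : MemLp (fun ω => φ (ε 0 ω)) 2 P) (hmean : ∫ ω, φ (ε 0 ω) ∂P = 0) {n : ℕ} (hn : 1 ≤ n)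
    {t : Fin n → ℝ} (ht : ∀ i, t i ∈ Icc (0 : ℝ) 1) {l : ℝ} (hl : 0 < l) (hl1 : l ≤ 1) :
    ∃ S : Ω → ℝ, (∀ ω, 0 ≤ S ω) ∧ Integrable S P ∧
      ∫ ω, S ω ∂P ≤ 4 * (∫ ω, φ (ε 0 ω) ^ 2 ∂P) * (n * l)⁻¹ ∧
      ∀ ω, ∀ f g : ℝ → ℝ, L2Primitive f g →
        ((1 / (n : ℝ)) * ∑ i : Fin n, φ (ε i ω) * f (t i)) ^ 2
          ≤ S ω * (∫ x, f x ^ 2 ∂unitMeasure + l ^ 2 * ∫ x, g x ^ 2 ∂unitMeasure) := by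
  -- The weighted sum is a pairing of `f` and `g` with two random functions. Cauchy-Schwarz leaves
  -- their squared norms `A` and `B` as the only random factors, and their means reduce to the
  -- diagonal, at most a multiple of `n / l` and `n * l`.
  choose a b ha hb ha2 hb2 H using fun i => exists_evaluation_kernel hl hl1 (ht i)
  set A : Ω → ℝ := fun ω => ∫ x, (∑ i : Fin n, φ (ε i ω) * a i x) ^ 2 ∂unitMeasure
  set B : Ω → ℝ := fun ω => ∫ x, (∑ i : Fin n, φ (ε i ω) * b i x) ^ 2 ∂unitMeasure
  have hA0 : ∀ ω, 0 ≤ A ω := fun ω => integral_nonneg fun x => sq_nonneg _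
  have hB0 : ∀ ω, 0 ≤ B ω := fun ω => integral_nonneg fun x => sq_nonneg _
  have hAeq : A = fun ω => ∑ i : Fin n, ∑ j : Fin n, φ (ε i ω) * φ (ε j ω) * ∫ x, a i x * a j x ∂unitMeasure :=
    funext fun ω => integral_sq_sum_mul _ ha
  have hBeq : B = fun ω => ∑ i : Fin n, ∑ j : Fin n, φ (ε i ω) * φ (ε j ω) * ∫ x, b i x * b j x ∂unitMeasure :=
    funext fun ω => integral_sq_sum_mul _ hb
  obtain ⟨hAi, hAm⟩ := integral_quadraticForm hε_indep hε_ident hφ hL hmean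
    fun i j => ∫ x, a i x * a j x ∂unitMeasure
  obtain ⟨hBi, hBm⟩ := integral_quadraticForm hε_indep hε_ident hφ hL hmean
    fun i j => ∫ x, b i x * b j x ∂unitMeasure
  rw [← hAeq] at hAi
  rw [← hBeq] at hBi
  have hσ : 0 ≤ ∫ ω, φ (ε 0 ω) ^ 2 ∂P := integral_nonneg fun ω => sq_nonneg _
  have hn0 : (0 : ℝ) < n := by exact_mod_cast hn
  have hAle : ∫ ω, A ω ∂P ≤ (∫ ω, φ (ε 0 ω) ^ 2 ∂P) * (n * (1 / l)) := by
    rw [hAeq, hAm]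
    gcongr
    calc ∑ i, ∫ x, a i x * a i x ∂unitMeasure ≤ ∑ _i : Fin n, 1 / l :=
          Finset.sum_le_sum fun i _ => by simpa only [sq] using ha2 i
      _ = _ := by simp
  have hBle : ∫ ω, B ω ∂P ≤ (∫ ω, φ (ε 0 ω) ^ 2 ∂P) * (n * l) := by
    rw [hBeq, hBm]
    gcongr
    calc ∑ i, ∫ x, b i x * b i x ∂unitMeasure ≤ ∑ _i : Fin n, l :=
          Finset.sum_le_sum fun i _ => by simpa only [sq] using hb2 i
      _ = _ := by simp
  refine ⟨fun ω => 2 / (n : ℝ) ^ 2 * (A ω + (l ^ 2)⁻¹ * B ω), fun ω => ?_, ?_, ?_, ?_⟩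
  · have := hA0 ω
    have := hB0 ω
    positivity
  · exact (hAi.add (hBi.const_mul _)).const_mul _
  · rw [integral_const_mul, integral_add hAi (hBi.const_mul _), integral_const_mul]
    calc 2 / (n : ℝ) ^ 2 * (∫ ω, A ω ∂P + (l ^ 2)⁻¹ * ∫ ω, B ω ∂P)
        ≤ 2 / (n : ℝ) ^ 2 * ((∫ ω, φ (ε 0 ω) ^ 2 ∂P) * (n * (1 / l))
          + (l ^ 2)⁻¹ * ((∫ ω, φ (ε 0 ω) ^ 2 ∂P) * (n * l))) := by gcongr
      _ = _ := by
        field_simp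
        ring
  · intro ω f g hfg
    have hAmem : MemLp (fun x => ∑ i : Fin n, φ (ε i ω) * a i x) 2 unitMeasure :=
      memLp_finsetSum _ fun i _ => (ha i).const_mul _
    have hBmem : MemLp (fun x => ∑ i : Fin n, φ (ε i ω) * b i x) 2 unitMeasure :=
      memLp_finsetSum _ fun i _ => (hb i).const_mul _
    have hrep : ∑ i : Fin n, φ (ε i ω) * f (t i)
        = ∫ x, (∑ i : Fin n, φ (ε i ω) * a i x) * f x ∂unitMeasure
          + ∫ x, (∑ i : Fin n, φ (ε i ω) * b i x) * g x ∂unitMeasure := by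
      simp_rw [Finset.sum_mul]
      rw [integral_finsetSum, integral_finsetSum, ← Finset.sum_add_distrib]
      · refine Finset.sum_congr rfl fun i _ => ?_
        simp_rw [mul_assoc]
        rw [integral_const_mul, integral_const_mul, ← mul_add, H i f g hfg]
      · exact fun i _ => ((hb i).const_mul _).integrable_mul hfg.memLp
      · exact fun i _ => ((ha i).const_mul _).integrable_mul hfg.memLp_fun
    have h1 := sq_integral_mul_le hAmem hfg.memLp_fun
    have h2 := sq_integral_mul_le hBmem hfg.memLp
    have hf0 : 0 ≤ ∫ x, f x ^ 2 ∂unitMeasure := integral_nonneg fun x => sq_nonneg _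
    have hg0 : 0 ≤ ∫ x, g x ^ 2 ∂unitMeasure := integral_nonneg fun x => sq_nonneg _
    have hA0' := hA0 ω
    have hB0' := hB0 ω
    rw [mul_pow, hrep]
    set U := ∫ x, (∑ i : Fin n, φ (ε i ω) * a i x) * f x ∂unitMeasure
    set V := ∫ x, (∑ i : Fin n, φ (ε i ω) * b i x) * g x ∂unitMeasure
    change U ^ 2 ≤ A ω * _ at h1
    change V ^ 2 ≤ B ω * _ at h2
    have h3 : (U + V) ^ 2 ≤ 2 * U ^ 2 + 2 * V ^ 2 := by nlinarith [sq_nonneg (U - V)]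
    have h4 : (A ω + (l ^ 2)⁻¹ * B ω)
          * (∫ x, f x ^ 2 ∂unitMeasure + l ^ 2 * ∫ x, g x ^ 2 ∂unitMeasure)
        = A ω * ∫ x, f x ^ 2 ∂unitMeasure + B ω * ∫ x, g x ^ 2 ∂unitMeasure
          + (A ω * (l ^ 2 * ∫ x, g x ^ 2 ∂unitMeasure)
            + (l ^ 2)⁻¹ * B ω * ∫ x, f x ^ 2 ∂unitMeasure) := by
      field_simp
      ring
    have h5 : 0 ≤ A ω * (l ^ 2 * ∫ x, g x ^ 2 ∂unitMeasure)
            + (l ^ 2)⁻¹ * B ω * ∫ x, f x ^ 2 ∂unitMeasure := by positivity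
    calc (1 / (n : ℝ)) ^ 2 * (U + V) ^ 2
        ≤ (1 / (n : ℝ)) ^ 2 * (2 * ((A ω + (l ^ 2)⁻¹ * B ω)
          * (∫ x, f x ^ 2 ∂unitMeasure + l ^ 2 * ∫ x, g x ^ 2 ∂unitMeasure))) := by
          gcongr
          linarith
      _ = _ := by ring

/-- The increments are nonnegative and telescope, so the sum of their squares is at most the square
of their sum. The bound is free of `M`, hence the number of dyadic levels costs no logarithm. -/
theorem sum_sq_shellIncr_le {ψ : ℝ → ℝ} (hψ : Monotone ψ) {a : ℝ} (ha : 0 ≤ a) (M : ℕ) (e : ℝ) :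
    ∑ k ∈ Finset.range (M + 1), shellIncr ψ a k e ^ 2 ≤ (ψ (e + a) - ψ e) ^ 2 := by
  have h1 : ∑ k ∈ Finset.range (M + 1), shellIncr ψ a k e
      = ψ (e + a) - ψ (e + a / 2 ^ (M + 1)) := by
    have := Finset.sum_range_sub' (fun k : ℕ => ψ (e + a / 2 ^ k)) (M + 1)
    simpa [shellIncr] using this
  have h0 := fun k => shellIncr_nonneg hψ ha k e
  calc ∑ k ∈ Finset.range (M + 1), shellIncr ψ a k e ^ 2
      ≤ (∑ k ∈ Finset.range (M + 1), shellIncr ψ a k e) ^ 2 :=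
        Finset.sum_sq_le_sq_sum_of_nonneg fun k _ => h0 k
    _ ≤ (ψ (e + a) - ψ e) ^ 2 := by
        refine pow_le_pow_left₀ (Finset.sum_nonneg fun k _ => h0 k) ?_ 2
        rw [h1]
        have : ψ e ≤ ψ (e + a / 2 ^ (M + 1)) :=
          hψ (by linarith [show 0 ≤ a / 2 ^ (M + 1) by positivity])
        linarith

theorem sum_sq_shellIncr_neg_le {ψ : ℝ → ℝ} (hψ : Monotone ψ) {a : ℝ} (ha : 0 ≤ a) (M : ℕ)
    (e : ℝ) :
    ∑ k ∈ Finset.range (M + 1), shellIncr ψ (-a) k e ^ 2 ≤ (ψ (e + -a) - ψ e) ^ 2 := by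
  have h := sum_sq_shellIncr_le (ψ := fun y => -ψ (-y))
    (fun x y hxy => neg_le_neg (hψ (neg_le_neg hxy))) ha M (-e)
  simp_rw [shellIncr_neg, neg_sq]
  refine h.trans (le_of_eq ?_)
  rw [neg_neg, neg_add, neg_neg]
  ring

theorem measurable_shellIncr {ψ : ℝ → ℝ} (hψ : Monotone ψ) (b : ℝ) (k : ℕ) :
    Measurable (shellIncr ψ b k) :=
  (hψ.measurable.comp (measurable_id.add_const _)).sub
    (hψ.measurable.comp (measurable_id.add_const _))

/-- The expected stochastic error of a cell is bounded uniformly. -/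
theorem integral_cellError_le [IsProbabilityMeasure P] (hε_indep : iIndepFun ε P)
    (hε_ident : ∀ i, IdentDistrib (ε i) (ε 0) P P) {ψ : ℝ → ℝ} (hψ : Monotone ψ) {a ξ : ℝ}
    (ha : 0 < a) (hξ : 0 < ξ) (hL : ∀ s : ℝ, |s| ≤ a → MemLp (fun ω => ψ (ε 0 ω + s)) 2 P) (M : ℕ)
    {n : ℕ} (J : Finset (Fin n)) :
    Integrable (fun ω => cellError ψ a ξ (fun k => ∫ ω, shellIncr ψ a k (ε 0 ω) ∂P)
      (fun k => ∫ ω, shellIncr ψ (-a) k (ε 0 ω) ∂P) M J fun i => ε i ω) P ∧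
    ∫ ω, cellError ψ a ξ (fun k => ∫ ω, shellIncr ψ a k (ε 0 ω) ∂P)
      (fun k => ∫ ω, shellIncr ψ (-a) k (ε 0 ω) ∂P) M J (fun i => ε i ω) ∂P
      ≤ 2 / ξ * (∫ ω, (ψ (ε 0 ω + a) - ψ (ε 0 ω)) ^ 2 ∂P
        + ∫ ω, (ψ (ε 0 ω + -a) - ψ (ε 0 ω)) ^ 2 ∂P) := by
  have hpow : ∀ k : ℕ, a / 2 ^ k ≤ a := fun k =>
    div_le_self ha.le (one_le_pow₀ (by norm_num))
  have hpow0 : ∀ k : ℕ, 0 ≤ a / 2 ^ k := fun k => by positivity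
  have hLp : ∀ k, MemLp (fun ω => shellIncr ψ a k (ε 0 ω)) 2 P := fun k =>
    (hL _ (by rw [abs_of_nonneg (hpow0 _)]; exact hpow _)).sub
      (hL _ (by rw [abs_of_nonneg (hpow0 _)]; exact hpow _))
  have hLm : ∀ k, MemLp (fun ω => shellIncr ψ (-a) k (ε 0 ω)) 2 P := fun k =>
    (hL _ (by rw [neg_div, abs_neg, abs_of_nonneg (hpow0 _)]; exact hpow _)).sub
      (hL _ (by rw [neg_div, abs_neg, abs_of_nonneg (hpow0 _)]; exact hpow _))
  have h0 : MemLp (fun ω => ψ (ε 0 ω)) 2 P := by simpa using hL 0 (by simpa using ha.le)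
  have hWp := ((hL a (abs_of_pos ha).le).sub h0).integrable_sq
  have hWm := ((hL (-a) (by rw [abs_neg, abs_of_pos ha])).sub h0).integrable_sq
  have Hp := fun k => integral_sq_sum_sub_le hε_indep hε_ident (measurable_shellIncr hψ a k)
    (hLp k) J
  have Hm := fun k => integral_sq_sum_sub_le hε_indep hε_ident (measurable_shellIncr hψ (-a) k)
    (hLm k) J
  have hint : ∀ k, Integrable (fun ω => 2 / (J.card * ξ) *
      ((∑ i ∈ J, shellIncr ψ a k (ε i ω) - J.card * ∫ ω, shellIncr ψ a k (ε 0 ω) ∂P) ^ 2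
      + (∑ i ∈ J, shellIncr ψ (-a) k (ε i ω) - J.card * ∫ ω, shellIncr ψ (-a) k (ε 0 ω) ∂P) ^ 2))
      P := fun k => ((Hp k).1.add (Hm k).1).const_mul (2 / (J.card * ξ))
  refine ⟨integrable_finsetSum _ fun k _ => hint k, ?_⟩
  unfold cellError
  rw [integral_finsetSum _ fun k _ => hint k]
  have hsp : ∑ k ∈ Finset.range (M + 1), ∫ ω, shellIncr ψ a k (ε 0 ω) ^ 2 ∂P
      ≤ ∫ ω, (ψ (ε 0 ω + a) - ψ (ε 0 ω)) ^ 2 ∂P := by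
    rw [← integral_finsetSum _ fun k _ => (hLp k).integrable_sq]
    exact integral_mono (integrable_finsetSum _ fun k _ => (hLp k).integrable_sq) hWp
      fun ω => sum_sq_shellIncr_le hψ ha.le M _
  have hsm : ∑ k ∈ Finset.range (M + 1), ∫ ω, shellIncr ψ (-a) k (ε 0 ω) ^ 2 ∂P
      ≤ ∫ ω, (ψ (ε 0 ω + -a) - ψ (ε 0 ω)) ^ 2 ∂P := by
    rw [← integral_finsetSum _ fun k _ => (hLm k).integrable_sq]
    exact integral_mono (integrable_finsetSum _ fun k _ => (hLm k).integrable_sq) hWm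
      fun ω => sum_sq_shellIncr_neg_le hψ ha.le M _
  refine le_trans (Finset.sum_le_sum (g := fun k => 2 / ξ * (∫ ω, shellIncr ψ a k (ε 0 ω) ^ 2 ∂P
      + ∫ ω, shellIncr ψ (-a) k (ε 0 ω) ^ 2 ∂P)) fun k _ => ?_) ?_
  · rw [integral_const_mul, integral_add (Hp k).1 (Hm k).1]
    -- For an empty cell the weight `2 / (J.card * ξ)` is a division by zero and equals `0`. For a
    -- nonempty one it cancels the factor `J.card` of the variance.
    rcases J.eq_empty_or_nonempty with rfl | hJ
    · simp only [Finset.card_empty, Nat.cast_zero, zero_mul, div_zero]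
      have h1 : 0 ≤ ∫ ω, shellIncr ψ a k (ε 0 ω) ^ 2 ∂P := integral_nonneg fun ω => sq_nonneg _
      have h2 : 0 ≤ ∫ ω, shellIncr ψ (-a) k (ε 0 ω) ^ 2 ∂P := integral_nonneg fun ω => sq_nonneg _
      positivity
    · have hN : (0 : ℝ) < J.card := by exact_mod_cast hJ.card_pos
      calc _ ≤ 2 / (J.card * ξ) * (J.card * ∫ ω, shellIncr ψ a k (ε 0 ω) ^ 2 ∂P
            + J.card * ∫ ω, shellIncr ψ (-a) k (ε 0 ω) ^ 2 ∂P) := by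
            gcongr
            · exact (Hp k).2
            · exact (Hm k).2
        _ = _ := by field_simp
  · rw [← Finset.mul_sum, Finset.sum_add_distrib]
    gcongr

end Moments

/-! ### Existence of minimizers -/

/-- The adjoint of the iterated primitive. -/
theorem exists_adjoint_iterPrimitive (j : ℕ) : ∀ k : ℝ → ℝ, MemLp k 2 unitMeasure →
    ∃ k' : ℝ → ℝ, MemLp k' 2 unitMeasure ∧ ∀ g : ℝ → ℝ, MemLp g 2 unitMeasure →
      ∫ x, k x * iterPrimitive j g x ∂unitMeasure = ∫ x, k' x * g x ∂unitMeasure := by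
  induction j with
  | zero => exact fun k hk => ⟨k, hk, fun g _ => rfl⟩
  | succ j ih =>
    intro k hk
    have hK := L2Primitive.of_integral hk
    set K : ℝ → ℝ := fun x => ∫ u in (0 : ℝ)..x, k u
    -- `K 1 - K x` is the integral of `k` from `x` to `1`, the adjoint of one integration from `0`.
    obtain ⟨k', hk', H⟩ := ih (fun x => K 1 - K x) ((memLp_const _).sub hK.memLp_fun)
    refine ⟨k', hk', fun g hg => ?_⟩
    rw [← H g hg]
    have hI := memLp_iterPrimitive hg j
    have hP := L2Primitive.of_integral hI
    have h1 := hP.integral_mul_eq hK (a := 0) (b := 1) (by simp) (by simp)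
    rw [integral_unit, integral_unit] at h1
    have h2 : ∫ x, k x * iterPrimitive (j + 1) g x ∂unitMeasure
        = ∫ x, (∫ u in (0 : ℝ)..x, iterPrimitive j g u) * k x ∂unitMeasure := by
      simp_rw [mul_comm (k _)]
      rfl
    rw [h2, h1]
    have h3 : Integrable (fun x => K x * iterPrimitive j g x) unitMeasure :=
      hK.memLp_fun.integrable_mul hI
    have h4 : ∫ x in (0 : ℝ)..1, iterPrimitive j g x * K x
        = ∫ x, K x * iterPrimitive j g x ∂unitMeasure := by
      rw [integral_unit]
      simp_rw [mul_comm]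
    simp_rw [sub_mul]
    rw [integral_sub ((hI.integrable one_le_two).const_mul _) h3, integral_const_mul, h4,
      intervalIntegral.integral_same]
    ring

/-- The value at `t` pairs the `(m-1)`-fold primitive with the indicator of `(0, t]`; the adjoint
carries this over to `g`. -/
theorem exists_kernel_iterPrimitive {m : ℕ} (hm : 1 ≤ m) {t : ℝ} (ht : t ∈ Icc (0 : ℝ) 1) :
    ∃ k : ℝ → ℝ, MemLp k 2 unitMeasure ∧ ∀ g : ℝ → ℝ, MemLp g 2 unitMeasure →
      iterPrimitive m g t = ∫ x, k x * g x ∂unitMeasure := by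
  obtain ⟨j, rfl⟩ : ∃ j, m = j + 1 := ⟨m - 1, by omega⟩
  obtain ⟨k, hk, H⟩ := exists_adjoint_iterPrimitive j ((Ioc 0 t).indicator fun _ => 1)
    ((memLp_const (1 : ℝ)).indicator measurableSet_Ioc)
  refine ⟨k, hk, fun g hg => ?_⟩
  change ∫ u in (0 : ℝ)..t, iterPrimitive j g u = _
  rw [← H g hg, ← integral_indicator_Ioc_unit le_rfl ht.1 ht.2]
  refine integral_congr_ae (Eventually.of_forall fun x => ?_)
  simp only [indicator_apply]
  split_ifs <;> simp

/-- A convex function whose subgradients take both signs grows at least linearly. -/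
theorem IsSubgradientChoice.exists_linear_lower_bound {ρ ψ : ℝ → ℝ} (h : IsSubgradientChoice ρ ψ)
    {u v : ℝ} (hu : 0 < ψ u) (hv : ψ v < 0) :
    ∃ α β : ℝ, 0 < α ∧ ∀ z, α * |z| - β ≤ ρ z := by
  set α := min (ψ u) (-ψ v)
  have hα : 0 < α := lt_min hu (by linarith)
  refine ⟨α, |ρ u - ψ u * u| + |ρ v - ψ v * v|, hα, fun z => ?_⟩
  have h1 := h u z
  have h2 := h v z
  have e1 := neg_abs_le (ρ u - ψ u * u)
  have e2 := neg_abs_le (ρ v - ψ v * v)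
  have e3 := abs_nonneg (ρ u - ψ u * u)
  have e4 := abs_nonneg (ρ v - ψ v * v)
  rcases le_total 0 z with hz | hz
  · have : α * |z| ≤ ψ u * z := by
      rw [abs_of_nonneg hz]
      exact mul_le_mul_of_nonneg_right (min_le_left _ _) hz
    linarith
  · have : α * |z| ≤ ψ v * z := by
      rw [abs_of_nonpos hz]
      have := mul_le_mul_of_nonneg_right (min_le_right (ψ u) (-ψ v)) (neg_nonneg.2 hz)
      linarith
    linarith

/-- Attainment of the minimum for a coercive penalized loss over a finite dimensional space. -/
theorem exists_min_penalized {n : ℕ} (hn : 1 ≤ n) {H : Type*} [NormedAddCommGroup H]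
    [InnerProductSpace ℝ H] (U : Submodule ℝ H) [FiniteDimensional ℝ U]
    (A : Submodule ℝ (Fin n → ℝ)) (κ : Fin n → H) {ρ : ℝ → ℝ} (hρ : Continuous ρ) {α β : ℝ}
    (hα : 0 < α) (hlow : ∀ z, α * |z| - β ≤ ρ z) {lam : ℝ} (hlam : 0 < lam) (y : Fin n → ℝ) :
    ∃ x₀ : A × U, ∀ x : A × U,
      (1 / (n : ℝ)) * ∑ i, ρ (y i - ((x₀.1 : Fin n → ℝ) i + inner ℝ (κ i) (x₀.2 : H)))
          + lam * ‖(x₀.2 : H)‖ ^ 2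
        ≤ (1 / (n : ℝ)) * ∑ i, ρ (y i - ((x.1 : Fin n → ℝ) i + inner ℝ (κ i) (x.2 : H)))
          + lam * ‖(x.2 : H)‖ ^ 2 := by
  set Φ : A × U → ℝ := fun x =>
    (1 / (n : ℝ)) * ∑ i, ρ (y i - ((x.1 : Fin n → ℝ) i + inner ℝ (κ i) (x.2 : H)))
      + lam * ‖(x.2 : H)‖ ^ 2
  have hn0 : (0 : ℝ) < n := by exact_mod_cast hn
  have hcont : Continuous Φ := by
    refine Continuous.add (continuous_const.mul (continuous_finsetSum _ fun i _ => hρ.comp ?_)) ?_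
    · have h1 : Continuous fun x : A × U => (x.1 : Fin n → ℝ) i :=
        (continuous_apply i).comp (continuous_subtype_val.comp continuous_fst)
      have h2 : Continuous fun x : A × U => inner ℝ (κ i) (x.2 : H) :=
        continuous_const.inner (continuous_subtype_val.comp continuous_snd)
      exact continuous_const.sub (h1.add h2)
    · exact continuous_const.mul ((continuous_subtype_val.comp continuous_snd).norm.pow 2)
  -- Coercivity: below the value at `0` the penalty bounds the `U` component, linear growth of `ρ`
  -- bounds the residuals, and the two together bound the null-space component. That component is
  -- recorded by its design values, so coincident design points do no harm.
  refine hcont.exists_forall_le' 0 ?_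
  rw [← Metric.cobounded_eq_cocompact]
  set c := Φ 0
  set R₁ := Real.sqrt ((c + β) / lam)
  set R₂ := ∑ i, (|y i| + n * (c + β) / α + ‖κ i‖ * R₁)
  have hbd : ∀ x : A × U, Φ x < c → ‖x‖ ≤ max R₂ R₁ := by
    intro x hx
    have hmean : α * ((1 / (n : ℝ)) * ∑ i, |y i - ((x.1 : Fin n → ℝ) i + inner ℝ (κ i) (x.2 : H))|)
        - β + lam * ‖(x.2 : H)‖ ^ 2 ≤ Φ x := by
      have h1 := Finset.sum_le_sum fun (i : Fin n) (_ : i ∈ Finset.univ) =>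
        hlow (y i - ((x.1 : Fin n → ℝ) i + inner ℝ (κ i) (x.2 : H)))
      rw [Finset.sum_sub_distrib, ← Finset.mul_sum, Finset.sum_const, Finset.card_univ,
        Fintype.card_fin, nsmul_eq_mul] at h1
      have h2 := mul_le_mul_of_nonneg_left h1 (show 0 ≤ 1 / (n : ℝ) by positivity)
      have h3 : 1 / (n : ℝ) * (n * β) = β := by field_simp
      rw [mul_sub, h3] at h2
      simp only [Φ]
      linarith
    set z : Fin n → ℝ := fun i => y i - ((x.1 : Fin n → ℝ) i + inner ℝ (κ i) (x.2 : H))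
    have hS0 : 0 ≤ ∑ i, |z i| := Finset.sum_nonneg fun i _ => abs_nonneg _
    have hpos1 : 0 ≤ α * ((1 / (n : ℝ)) * ∑ i, |z i|) := by positivity
    have hpos2 : 0 ≤ lam * ‖(x.2 : H)‖ ^ 2 := by positivity
    have hu : ‖(x.2 : H)‖ ≤ R₁ := by
      refine Real.le_sqrt_of_sq_le ?_
      rw [le_div_iff₀ hlam]
      linarith
    have hz : ∀ i, |z i| ≤ n * (c + β) / α := by
      intro i
      have h1 : |z i| ≤ ∑ i, |z i| :=
        Finset.single_le_sum (f := fun i => |z i|) (fun i _ => abs_nonneg _) (Finset.mem_univ i)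
      refine h1.trans ?_
      rw [le_div_iff₀ hα]
      have h2 : α * ((1 / (n : ℝ)) * ∑ i, |z i|) ≤ c + β := by linarith
      calc (∑ i, |z i|) * α = n * (α * ((1 / (n : ℝ)) * ∑ i, |z i|)) := by field_simp
        _ ≤ n * (c + β) := by gcongr
    have hv : ∀ i, |(x.1 : Fin n → ℝ) i| ≤ |y i| + n * (c + β) / α + ‖κ i‖ * R₁ := by
      intro i
      have h1 : (x.1 : Fin n → ℝ) i = y i - z i - inner ℝ (κ i) (x.2 : H) := by
        simp only [z]; ring
      have h2 : |inner ℝ (κ i) (x.2 : H)| ≤ ‖κ i‖ * R₁ :=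
        (abs_real_inner_le_norm _ _).trans (by gcongr)
      rw [h1]
      calc |y i - z i - inner ℝ (κ i) (x.2 : H)|
          ≤ |y i - z i| + |inner ℝ (κ i) (x.2 : H)| := abs_sub _ _
        _ ≤ |y i| + |z i| + |inner ℝ (κ i) (x.2 : H)| := by gcongr; exact abs_sub _ _
        _ ≤ _ := by gcongr; exact hz i
    have hnn : ∀ i, 0 ≤ |y i| + n * (c + β) / α + ‖κ i‖ * R₁ := fun i => (abs_nonneg _).trans (hv i)
    rw [Prod.norm_def]
    refine max_le_max ?_ hu
    rw [Submodule.coe_norm, pi_norm_le_iff_of_nonneg (Finset.sum_nonneg fun i _ => hnn i)]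
    intro i
    rw [Real.norm_eq_abs]
    exact (hv i).trans (Finset.single_le_sum (f := fun i =>
      |y i| + n * (c + β) / α + ‖κ i‖ * R₁) (fun i _ => hnn i) (Finset.mem_univ i))
  rw [Filter.Eventually, ← Bornology.isCobounded_def, ← Bornology.isBounded_compl_iff]
  refine isBounded_iff_forall_norm_le.2 ⟨max R₂ R₁, fun x hx => hbd x ?_⟩
  simpa using hx

/-- The values at the design points of the functions whose derivative of order `m` vanishes. -/
def nullSpaceValues {m : ℕ} (hm : 1 ≤ m) {n : ℕ} (t : Fin n → ℝ) : Submodule ℝ (Fin n → ℝ) where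
  carrier := {v | ∃ q : ℝ → ℝ, MemSobolev m q ∧ derivI m q =ᵐ[unitMeasure] (fun _ => 0) ∧
    ∀ i, q (t i) = v i}
  add_mem' := by
    rintro v w ⟨q, hq, hq0, hv⟩ ⟨r, hr, hr0, hw⟩
    obtain ⟨h1, h2⟩ := hq.add hr hm
    refine ⟨_, h1, ?_, fun i => by simp [hv, hw]⟩
    filter_upwards [h2 m le_rfl, hq0, hr0] with x e1 e2 e3
    rw [e1, e2, e3, add_zero]
  zero_mem' := by
    obtain ⟨h1, h2⟩ := memSobolev_iterPrimitive (memLp_const (0 : ℝ)) hm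
    obtain ⟨h3, h4⟩ := h1.const_mul hm 0
    refine ⟨_, h3, ?_, fun i => by simp⟩
    filter_upwards [h4 m le_rfl] with x e
    rw [e, zero_mul]
  smul_mem' := by
    rintro c v ⟨q, hq, hq0, hv⟩
    obtain ⟨h1, h2⟩ := hq.const_mul hm c
    refine ⟨_, h1, ?_, fun i => by simp [hv]⟩
    filter_upwards [h2 m le_rfl, hq0] with x e1 e2
    rw [e1, e2, mul_zero]

theorem norm_sq_eq_integral (u : Lp ℝ 2 unitMeasure) : ‖u‖ ^ 2 = ∫ x, u x ^ 2 ∂unitMeasure := by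
  rw [← real_inner_self_eq_norm_sq, L2.inner_def]
  simp [sq]

/-- Existence of M-type smoothing splines. -/
theorem exists_isMSpline {m : ℕ} (hm : 1 ≤ m) {ρ : ℝ → ℝ} (hρ : Continuous ρ) {α β : ℝ}
    (hα : 0 < α) (hlow : ∀ z, α * |z| - β ≤ ρ z) {lam : ℝ} (hlam : 0 < lam) {n : ℕ} (hn : 1 ≤ n)
    {t : Fin n → ℝ} (ht : ∀ i, t i ∈ Icc (0 : ℝ) 1) (y : Fin n → ℝ) :
    ∃ f, IsMSpline m ρ lam t y f := by
  choose k hk H using fun i => exists_kernel_iterPrimitive hm (ht i)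
  set κ : Fin n → Lp ℝ 2 unitMeasure := fun i => (hk i).toLp
  set U := Submodule.span ℝ (range κ)
  have : FiniteDimensional ℝ U := FiniteDimensional.span_of_finite ℝ (finite_range κ)
  have hκ : ∀ i (u : Lp ℝ 2 unitMeasure), inner ℝ (κ i) u = ∫ x, k i x * u x ∂unitMeasure := by
    intro i u
    rw [L2.inner_def]
    refine integral_congr_ae ?_
    filter_upwards [(hk i).coeFn_toLp] with x hx
    simp only [κ, hx]
    simp [mul_comm]
  obtain ⟨⟨⟨v₀, q, hq, hq0, hqv⟩, u₀⟩, hmin⟩ :=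
    exists_min_penalized hn U (nullSpaceValues hm t) κ hρ hα hlow hlam y
  obtain ⟨hI, hIm⟩ := memSobolev_iterPrimitive (Lp.memLp (u₀ : Lp ℝ 2 unitMeasure)) hm
  obtain ⟨hf, hfm⟩ := hq.add hI hm
  refine ⟨_, hf, fun g hg => ?_⟩
  obtain ⟨hJ, hJm⟩ := memSobolev_iterPrimitive hg.memLp_two hm
  obtain ⟨hr, hrm⟩ := hg.sub hJ hm
  set G : Lp ℝ 2 unitMeasure := hg.memLp_two.toLp
  have hGae : (G : ℝ → ℝ) =ᵐ[unitMeasure] derivI m g := hg.memLp_two.coeFn_toLp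
  have hmem : (fun i => g (t i) - iterPrimitive m (derivI m g) (t i)) ∈ nullSpaceValues hm t := by
    refine ⟨_, hr, ?_, fun i => rfl⟩
    filter_upwards [hrm m le_rfl, hJm] with x e1 e2
    rw [e1, e2, sub_self]
  -- Write `g` as a null-space function plus the iterated primitive of its `m`-th derivative.
  -- Projecting that derivative onto the span of the kernels preserves the design values and cannot
  -- increase the penalty.
  have key := hmin (⟨_, hmem⟩, U.orthogonalProjectionOnto G)
  simp only at key
  have e1 : ∫ x in (0 : ℝ)..1, derivI m (fun x => q x + iterPrimitive m u₀ x) x ^ 2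
      = ‖(u₀ : Lp ℝ 2 unitMeasure)‖ ^ 2 := by
    rw [integral_unit, norm_sq_eq_integral]
    refine integral_congr_ae ?_
    filter_upwards [hfm m le_rfl, hq0, hIm] with x a1 a2 a3
    rw [a1, a2, a3, zero_add]
  have e2 : ∫ x in (0 : ℝ)..1, derivI m g x ^ 2 = ‖G‖ ^ 2 := by
    rw [integral_unit, norm_sq_eq_integral]
    refine integral_congr_ae ?_
    filter_upwards [hGae] with x a1
    rw [a1]
  have e3 : ∀ i, q (t i) + iterPrimitive m u₀ (t i)
      = v₀ i + inner ℝ (κ i) (u₀ : Lp ℝ 2 unitMeasure) := fun i => by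
    rw [hqv, H i _ (Lp.memLp _), hκ]
  have e4 : ∀ i, g (t i) - iterPrimitive m (derivI m g) (t i)
      + inner ℝ (κ i) (U.orthogonalProjectionOnto G : Lp ℝ 2 unitMeasure) = g (t i) := fun i => by
    have h1 : inner ℝ (κ i) (U.orthogonalProjectionOnto G : Lp ℝ 2 unitMeasure) = inner ℝ (κ i) G := by
      have h2 := Submodule.inner_orthogonalProjectionOnto_eq_of_mem_left
        (⟨κ i, Submodule.subset_span (mem_range_self i)⟩ : U) G
      exact h2
    have h3 : ∫ x, k i x * G x ∂unitMeasure = ∫ x, k i x * derivI m g x ∂unitMeasure := by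
      refine integral_congr_ae ?_
      filter_upwards [hGae] with x a1
      rw [a1]
    rw [h1, hκ, h3, H i _ hg.memLp_two]
    ring
  have e5 : ‖(U.orthogonalProjectionOnto G : Lp ℝ 2 unitMeasure)‖ ^ 2 ≤ ‖G‖ ^ 2 := by
    gcongr
    exact Submodule.norm_orthogonalProjectionOnto_apply_le U G
  unfold objective
  rw [e1, e2]
  simp only [e3]
  refine key.trans ?_
  simp only [e4]
  gcongr

/-! ### The quadratic lower bound over the whole interval -/

theorem sqNorm_eq (m : ℕ) (lam : ℝ) (f : ℝ → ℝ) :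
    sqNorm m lam f = ∫ x, f x ^ 2 ∂unitMeasure + lam * ∫ x, derivI m f x ^ 2 ∂unitMeasure := by
  rw [sqNorm, integral_unit, integral_unit]

theorem sqNorm_nonneg (m : ℕ) {lam : ℝ} (hlam : 0 ≤ lam) (f : ℝ → ℝ) : 0 ≤ sqNorm m lam f := by
  rw [sqNorm_eq]
  have h1 : 0 ≤ ∫ x, f x ^ 2 ∂unitMeasure := integral_nonneg fun x => sq_nonneg _
  have h2 : 0 ≤ ∫ x, derivI m f x ^ 2 ∂unitMeasure := integral_nonneg fun x => sq_nonneg _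
  positivity

theorem integral_sq_le_sqNorm (m : ℕ) {lam : ℝ} (hlam : 0 ≤ lam) (f : ℝ → ℝ) :
    ∫ x, f x ^ 2 ∂unitMeasure ≤ sqNorm m lam f := by
  rw [sqNorm_eq]
  have h2 : 0 ≤ ∫ x, derivI m f x ^ 2 ∂unitMeasure := integral_nonneg fun x => sq_nonneg _
  linarith [mul_nonneg hlam h2]

theorem sqNorm_const_mul {m : ℕ} (hm : 1 ≤ m) (lam : ℝ) {f : ℝ → ℝ} (hf : MemSobolev m f) (θ : ℝ) :
    sqNorm m lam (fun x => θ * f x) = θ ^ 2 * sqNorm m lam f := by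
  have h : ∫ x, derivI m (fun x => θ * f x) x ^ 2 ∂unitMeasure
      = θ ^ 2 * ∫ x, derivI m f x ^ 2 ∂unitMeasure := by
    rw [← integral_const_mul]
    refine integral_congr_ae ?_
    filter_upwards [(hf.const_mul hm θ).2 m le_rfl] with x hx
    rw [hx, mul_pow]
  rw [sqNorm_eq, sqNorm_eq, h]
  simp_rw [mul_pow]
  rw [integral_const_mul]
  ring

/-- The norm of order one is dominated by the norm of order `m`. -/
theorem exists_sqNorm_one_le (m : ℕ) (hm : 1 ≤ m) :
    ∃ C : ℝ, 0 < C ∧ ∀ f : ℝ → ℝ, MemSobolev m f → ∀ h : ℝ, 0 < h → h ≤ 1 →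
      ∫ x, f x ^ 2 ∂unitMeasure + h ^ 2 * ∫ x, derivI 1 f x ^ 2 ∂unitMeasure
        ≤ C * sqNorm m (h ^ (2 * m)) f := by
  obtain ⟨K, hK, H⟩ := exists_sobolev_interpolation m hm
  refine ⟨K + 1, by positivity, fun f hf h h0 h1 => ?_⟩
  have e1 := H _ (hf.chain hm) h h0 h1
  simp only [derivI_zero] at e1
  rw [← sqNorm_eq] at e1
  have e2 := integral_sq_le_sqNorm m (show 0 ≤ h ^ (2 * m) by positivity) f
  linarith

theorem MemSobolev.l2Primitive {m : ℕ} (hm : 1 ≤ m) {f : ℝ → ℝ} (hf : MemSobolev m f) :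
    L2Primitive f (derivI 1 f) := by
  have := hf.chain hm 0 hm
  simpa only [derivI_zero] using this

/-- The design points in the `k`-th cell of length `1 / p`. -/
noncomputable def cell {n : ℕ} (t : Fin n → ℝ) (p k : ℕ) : Finset (Fin n) :=
  Finset.univ.filter fun i => ⌊t i * p⌋₊ = k

/-- The stochastic error of the quadratic lower bound for the averaged remainders. -/
noncomputable def totalError (ψ : ℝ → ℝ) (a ξ : ℝ) (ν₁ ν₂ : ℕ → ℝ) (M p : ℕ) {n : ℕ}
    (t : Fin n → ℝ) (e : Fin n → ℝ) : ℝ :=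
  (1 / (n : ℝ)) * ∑ k ∈ Finset.range (p + 1), cellError ψ a ξ ν₁ ν₂ M (cell t p k) e

/-- Quadratic lower bound for the averaged remainders. -/
theorem sum_remainder_ge_of_primitive {ρ ψ : ℝ → ℝ} (hψ : IsSubgradientChoice ρ ψ) {a ξ : ℝ}
    (ha : 0 < a) (hξ : 0 < ξ) {ν₁ ν₂ : ℕ → ℝ} (hν₁ : ∀ k, ξ / 4 * (a / 2 ^ k) ≤ ν₁ k)
    (hν₂ : ∀ k, ξ / 4 * (a / 2 ^ k) ≤ -ν₂ k) (M : ℕ) {p : ℕ} (hp : 1 ≤ p) {n : ℕ} (hn : 1 ≤ n)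
    {c : ℝ} (hc : 0 < c) {t : Fin n → ℝ} (ht : ∀ i, t i ∈ Icc (0 : ℝ) 1)
    (H : ∀ f g : ℝ → ℝ, L2Primitive f g →
      |(1 / (n : ℝ)) * ∑ i, f (t i) - ∫ x, f x ∂unitMeasure|
        ≤ c / n * Real.sqrt (∫ x, g x ^ 2 ∂unitMeasure))
    (e : Fin n → ℝ) {f g : ℝ → ℝ} (hfg : L2Primitive f g) (hfa : ∀ x ∈ Icc (0 : ℝ) 1, |f x| ≤ a) :
    ξ / 256 * ((1 / (n : ℝ)) * ∑ i, f (t i) ^ 2)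
        - ξ / 128 * ((2 * Real.pi / p ^ 2 + 2 * c / n) * ∫ x, g x ^ 2 ∂unitMeasure)
        - ξ / 32 * (a / 2 ^ M) ^ 2 - totalError ψ a ξ ν₁ ν₂ M p t e
      ≤ (1 / (n : ℝ)) * ∑ i, remainder ρ ψ (e i) (-f (t i)) := by
  have hp0 : (0 : ℝ) < p := by exact_mod_cast hp
  have hn0 : (0 : ℝ) < n := by exact_mod_cast hn
  obtain ⟨T, hT0, hTsum, hT⟩ := hfg.exists_oscillation hp
  have hmaps : ∀ i ∈ (Finset.univ : Finset (Fin n)), ⌊t i * p⌋₊ ∈ Finset.range (p + 1) := by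
    intro i _
    rw [Finset.mem_range]
    refine Nat.lt_succ_of_le (Nat.floor_le_of_le ?_)
    exact mul_le_of_le_one_left hp0.le (ht i).2
  have hfib : ∀ u : Fin n → ℝ, ∑ k ∈ Finset.range (p + 1), ∑ i ∈ cell t p k, u i = ∑ i, u i :=
    fun u => Finset.sum_fiberwise_of_maps_to hmaps u
  have hcell : ∀ k, ξ / 256 * ∑ i ∈ cell t p k, f (t i) ^ 2
      - ξ / 128 * ((cell t p k).card * T k) - ξ / 32 * ((cell t p k).card * (a / 2 ^ M) ^ 2)
      - cellError ψ a ξ ν₁ ν₂ M (cell t p k) e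
        ≤ ∑ i ∈ cell t p k, remainder ρ ψ (e i) (-f (t i)) := by
    intro k
    have h1 := sum_remainder_ge hψ ha hξ hν₁ hν₂ M (cell t p k) e (fun i => -f (t i)) (hT0 k) ?_ ?_
    · simpa only [neg_sq] using h1
    · intro i hi j hj
      have hi' : ⌊t i * p⌋₊ = k := (Finset.mem_filter.1 hi).2
      have hj' : ⌊t j * p⌋₊ = k := (Finset.mem_filter.1 hj).2
      have := hT _ (ht i) _ (ht j) (hi'.trans hj'.symm)
      rw [hi'] at this
      calc (-f (t i) - -f (t j)) ^ 2 = (f (t i) - f (t j)) ^ 2 := by ring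
        _ ≤ _ := this
    · intro i _
      rw [abs_neg]
      exact hfa _ (ht i)
  have hcard : ∀ k, ((cell t p k).card : ℝ) ≤ n * (2 * Real.pi / p + 2 * c * p / n) := by
    intro k
    -- All points of the `k`-th cell lie within `1 / p` of its left end point.
    have h1 := card_near_le H hc ((k : ℝ) / p) (l := 1 / p) (by positivity) (cell t p k) ?_
    · rw [div_le_iff₀ hn0] at h1
      refine h1.trans (le_of_eq ?_)
      field_simp
    · intro i hi
      have hi' : ⌊t i * p⌋₊ = k := (Finset.mem_filter.1 hi).2
      have e1 := Nat.floor_le (mul_nonneg (ht i).1 hp0.le)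
      have e2 := (Nat.lt_floor_add_one (t i * p)).le
      rw [hi'] at e1 e2
      rw [abs_le, le_sub_iff_add_le, sub_le_iff_le_add, ← add_div, le_div_iff₀ hp0]
      refine ⟨?_, by linarith⟩
      rw [neg_add_eq_sub, ← sub_div, div_le_iff₀ hp0]
      linarith
  have hsum := Finset.sum_le_sum fun k (_ : k ∈ Finset.range (p + 1)) => hcell k
  simp only [Finset.sum_sub_distrib, ← Finset.mul_sum] at hsum
  rw [hfib, hfib, ← Finset.sum_mul] at hsum
  have hcards : ∑ k ∈ Finset.range (p + 1), ((cell t p k).card : ℝ) = n := by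
    have := hfib fun _ => 1
    simpa using this
  rw [hcards] at hsum
  have hosc : ∑ k ∈ Finset.range (p + 1), ((cell t p k).card : ℝ) * T k
      ≤ n * ((2 * Real.pi / p ^ 2 + 2 * c / n) * ∫ x, g x ^ 2 ∂unitMeasure) := by
    calc ∑ k ∈ Finset.range (p + 1), ((cell t p k).card : ℝ) * T k
        ≤ ∑ k ∈ Finset.range (p + 1), n * (2 * Real.pi / p + 2 * c * p / n) * T k :=
          Finset.sum_le_sum fun k _ => mul_le_mul_of_nonneg_right (hcard k) (hT0 k)
      _ = n * (2 * Real.pi / p + 2 * c * p / n) * (1 / p * ∫ x, g x ^ 2 ∂unitMeasure) := by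
          rw [← Finset.mul_sum, hTsum]
      _ = _ := by field_simp
  have h2 := mul_le_mul_of_nonneg_left hosc (show 0 ≤ ξ / 128 by positivity)
  have h3 : ξ / 256 * ∑ i, f (t i) ^ 2
        - ξ / 128 * (n * ((2 * Real.pi / p ^ 2 + 2 * c / n) * ∫ x, g x ^ 2 ∂unitMeasure))
        - ξ / 32 * (n * (a / 2 ^ M) ^ 2)
        - ∑ k ∈ Finset.range (p + 1), cellError ψ a ξ ν₁ ν₂ M (cell t p k) e
      ≤ ∑ i, remainder ρ ψ (e i) (-f (t i)) := by linarith
  have h4 := mul_le_mul_of_nonneg_left h3 (show 0 ≤ 1 / (n : ℝ) by positivity)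
  refine le_trans (le_of_eq ?_) h4
  rw [totalError]
  field_simp

/-- The averaged remainders and the penalty dominate the squared norm up to errors. -/
theorem sum_remainder_add_penalty_ge {ρ ψ : ℝ → ℝ} (hψ : IsSubgradientChoice ρ ψ) {a ξ : ℝ}
    (ha : 0 < a) (hξ : 0 < ξ) {ν₁ ν₂ : ℕ → ℝ} (hν₁ : ∀ k, ξ / 4 * (a / 2 ^ k) ≤ ν₁ k)
    (hν₂ : ∀ k, ξ / 4 * (a / 2 ^ k) ≤ -ν₂ k) (M : ℕ) {p : ℕ} (hp : 1 ≤ p) {n : ℕ} (hn : 1 ≤ n)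
    {c : ℝ} (hc : 0 < c) {t : Fin n → ℝ} (ht : ∀ i, t i ∈ Icc (0 : ℝ) 1)
    (H : ∀ f g : ℝ → ℝ, L2Primitive f g →
      |(1 / (n : ℝ)) * ∑ i, f (t i) - ∫ x, f x ∂unitMeasure|
        ≤ c / n * Real.sqrt (∫ x, g x ^ 2 ∂unitMeasure))
    {m : ℕ} (hm : 1 ≤ m) {h : ℝ} (h0 : 0 < h) (h1 : h ≤ 1) {C κ : ℝ} (hC : 0 < C)
    (hinterp : ∀ f : ℝ → ℝ, MemSobolev m f → ∫ x, f x ^ 2 ∂unitMeasure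
      + h ^ 2 * ∫ x, derivI 1 f x ^ 2 ∂unitMeasure ≤ C * sqNorm m (h ^ (2 * m)) f)
    (hκ : κ ≤ ξ / 256) (hκ1 : κ ≤ 1) (hκp : ξ / 128 * (2 * Real.pi / (p * h) ^ 2 * C) ≤ κ / 8)
    (hκn : ξ / 32 * (c * C / (n * h ^ 2)) ≤ κ / 8) (e : Fin n → ℝ) {f : ℝ → ℝ}
    (hf : MemSobolev m f) (hfa : 2 / h * (C * sqNorm m (h ^ (2 * m)) f) ≤ a ^ 2) :
    3 / 4 * κ * sqNorm m (h ^ (2 * m)) f - ξ / 32 * (a / 2 ^ M) ^ 2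
        - totalError ψ a ξ ν₁ ν₂ M p t e
      ≤ (1 / (n : ℝ)) * ∑ i, remainder ρ ψ (e i) (-f (t i))
        + h ^ (2 * m) * ∫ x, derivI m f x ^ 2 ∂unitMeasure := by
  have hn0 : (0 : ℝ) < n := by exact_mod_cast hn
  have hp0 : (0 : ℝ) < p := by exact_mod_cast hp
  have hfg := hf.l2Primitive hm
  have hq := hinterp f hf
  set q := sqNorm m (h ^ (2 * m)) f with hqdef
  have hq0 : 0 ≤ q := sqNorm_nonneg m (by positivity) f
  set G := ∫ x, derivI 1 f x ^ 2 ∂unitMeasure with hG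
  have hG0 : 0 ≤ G := integral_nonneg fun x => sq_nonneg _
  have hF0 : 0 ≤ ∫ x, f x ^ 2 ∂unitMeasure := integral_nonneg fun x => sq_nonneg _
  have hGq : G ≤ C * q / h ^ 2 := by
    rw [le_div_iff₀ (by positivity)]
    linarith
  have hsup : ∀ x ∈ Icc (0 : ℝ) 1, f x ^ 2 ≤ 2 / h * (C * q) := by
    intro x hx
    refine (hfg.sq_le h0 h1 hx).trans ?_
    calc 2 / h * ∫ x, f x ^ 2 ∂unitMeasure + 2 * h * G
        = 2 / h * (∫ x, f x ^ 2 ∂unitMeasure + h ^ 2 * G) := by field_simp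
      _ ≤ _ := by gcongr
  have hlow := sum_remainder_ge_of_primitive hψ ha hξ hν₁ hν₂ M hp hn hc ht H e hfg fun x hx =>
    abs_le_of_sq_le_sq ((hsup x hx).trans hfa) ha.le
  set S := Real.sqrt (2 / h * (C * q)) with hS
  have hemp := integral_sq_sub_le_sum H hc hfg (Real.sqrt_nonneg (2 / h * (C * q)))
    fun x hx => Real.abs_le_sqrt (hsup x hx)
  rw [← hS, ← hG] at hemp
  have hSG : S * Real.sqrt G ≤ 2 * (C * q / h ^ 2) := by
    rw [hS, ← Real.sqrt_mul (by positivity)]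
    refine Real.sqrt_le_left (by positivity) |>.2 ?_
    calc 2 / h * (C * q) * G ≤ 2 / h * (C * q) * (C * q / h ^ 2) := by gcongr
      _ = (2 * h) * (C * q / h ^ 2) ^ 2 := by field_simp
      _ ≤ 4 * (C * q / h ^ 2) ^ 2 := by gcongr; linarith
      _ = _ := by ring
  have e1 : 2 * c / n * (S * Real.sqrt G) ≤ 2 * c / n * (2 * (C * q / h ^ 2)) := by gcongr
  have e2 : ξ / 256 * (∫ x, f x ^ 2 ∂unitMeasure - 2 * c / n * (2 * (C * q / h ^ 2)))
      ≤ ξ / 256 * ((1 / (n : ℝ)) * ∑ i, f (t i) ^ 2) := by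
    gcongr
    linarith
  have e3 : ξ / 128 * ((2 * Real.pi / p ^ 2 + 2 * c / n) * G)
      ≤ ξ / 128 * ((2 * Real.pi / p ^ 2 + 2 * c / n) * (C * q / h ^ 2)) := by
    have := Real.pi_pos
    gcongr
  -- Oscillation and discretization errors become multiples of `q`, each capped at `κ / 8`; this
  -- leaves `3/4 κ` of the quadratic term.
  have e4 : ξ / 256 * (2 * c / n * (2 * (C * q / h ^ 2)))
        + ξ / 128 * ((2 * Real.pi / p ^ 2 + 2 * c / n) * (C * q / h ^ 2))
      = ξ / 128 * (2 * Real.pi / (p * h) ^ 2 * C) * q + ξ / 32 * (c * C / (n * h ^ 2)) * q := by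
    field_simp
    ring
  have e5 := mul_le_mul_of_nonneg_right hκp hq0
  have e6 := mul_le_mul_of_nonneg_right hκn hq0
  have e7 := mul_le_mul_of_nonneg_right hκ hF0
  have hV0 : 0 ≤ h ^ (2 * m) * ∫ x, derivI m f x ^ 2 ∂unitMeasure :=
    mul_nonneg (by positivity) (integral_nonneg fun x => sq_nonneg _)
  have e8 := mul_le_mul_of_nonneg_right hκ1 hV0
  have e9 : q = ∫ x, f x ^ 2 ∂unitMeasure + h ^ (2 * m) * ∫ x, derivI m f x ^ 2 ∂unitMeasure :=
    sqNorm_eq _ _ _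
  have e10 : κ * q = κ * ∫ x, f x ^ 2 ∂unitMeasure
      + κ * (h ^ (2 * m) * ∫ x, derivI m f x ^ 2 ∂unitMeasure) := by rw [e9]; ring
  rw [mul_sub] at e2
  linarith

/-! ### The deterministic error bound -/

/-- The basic inequality for an M-type smoothing spline, localized by convexity. -/
theorem IsMSpline.basic_inequality {m : ℕ} (hm : 1 ≤ m) {ρ ψ : ℝ → ℝ}
    (hρ : ConvexOn ℝ Set.univ ρ) {lam : ℝ} (hlam : 0 ≤ lam) {n : ℕ} {t e : Fin n → ℝ}
    {fo f : ℝ → ℝ} (hfo : MemSobolev m fo) (hf : IsMSpline m ρ lam t (fun i => fo (t i) + e i) f)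
    {θ : ℝ} (hθ0 : 0 ≤ θ) (hθ1 : θ ≤ 1) :
    (1 / (n : ℝ)) * ∑ i, remainder ρ ψ (e i) (-(θ * (f (t i) - fo (t i))))
        + lam * (θ ^ 2 * ∫ x, derivI m (fun x => f x - fo x) x ^ 2 ∂unitMeasure)
      ≤ θ * ((1 / (n : ℝ)) * ∑ i, ψ (e i) * (f (t i) - fo (t i)))
        - 2 * lam * θ * ∫ x, derivI m fo x * derivI m (fun x => f x - fo x) x ∂unitMeasure := by
  obtain ⟨hd, hdm⟩ := hf.1.sub hfo hm
  set d : ℝ → ℝ := fun x => f x - fo x with hddef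
  set I := ∫ x, derivI m fo x * derivI m d x ∂unitMeasure
  set V := ∫ x, derivI m d x ^ 2 ∂unitMeasure
  have hV0 : 0 ≤ V := integral_nonneg fun x => sq_nonneg _
  have hobj := hf.2 fo hfo
  unfold objective at hobj
  rw [integral_unit, integral_unit] at hobj
  have hexp : ∫ x, derivI m f x ^ 2 ∂unitMeasure
      = ∫ x, derivI m fo x ^ 2 ∂unitMeasure + 2 * I + V := by
    have i1 := hfo.memLp_two.integrable_sq
    have i2 : Integrable (fun x => 2 * (derivI m fo x * derivI m d x)) unitMeasure :=
      (hfo.memLp_two.integrable_mul hd.memLp_two).const_mul 2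
    have i3 := hd.memLp_two.integrable_sq
    have h1 : ∫ x, derivI m f x ^ 2 ∂unitMeasure = ∫ x, (derivI m fo x ^ 2
        + 2 * (derivI m fo x * derivI m d x)) + derivI m d x ^ 2 ∂unitMeasure := by
      refine integral_congr_ae ?_
      filter_upwards [hdm m le_rfl] with x hx
      rw [hx]
      ring
    rw [h1, integral_add _ i3, integral_add i1 i2, integral_const_mul]
    exact i1.add i2
  rw [hexp] at hobj
  have hy1 : ∀ i, fo (t i) + e i - f (t i) = e i - d (t i) := fun i => by simp only [d]; ring
  have hy2 : ∀ i, fo (t i) + e i - fo (t i) = e i := fun i => by ring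
  simp only [hy1, hy2] at hobj
  -- Convexity on the segment from `e i` to `e i - d (t i)`: the minimizing property, known only for
  -- the full step, passes to the step shortened by `θ`.
  have hconv : ∀ i, remainder ρ ψ (e i) (-(θ * d (t i)))
      ≤ θ * (ρ (e i - d (t i)) - ρ (e i)) + θ * (ψ (e i) * d (t i)) := by
    intro i
    have h1 := hρ.2 (mem_univ (e i)) (mem_univ (e i - d (t i))) (sub_nonneg.2 hθ1) hθ0
      (sub_add_cancel 1 θ)
    simp only [smul_eq_mul] at h1
    have h2 : (1 - θ) * e i + θ * (e i - d (t i)) = e i + -(θ * d (t i)) := by ring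
    rw [h2] at h1
    unfold remainder
    linarith
  have hsum := Finset.sum_le_sum fun i (_ : i ∈ (Finset.univ : Finset (Fin n))) => hconv i
  rw [Finset.sum_add_distrib, ← Finset.mul_sum, ← Finset.mul_sum, Finset.sum_sub_distrib] at hsum
  have hsum' := mul_le_mul_of_nonneg_left hsum (show 0 ≤ 1 / (n : ℝ) by positivity)
  have hobj' := mul_le_mul_of_nonneg_left hobj hθ0
  have hθV : lam * (θ ^ 2 * V) ≤ θ * (lam * V) := by
    have : θ ^ 2 ≤ θ := by nlinarith
    calc lam * (θ ^ 2 * V) ≤ lam * (θ * V) := by gcongr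
      _ = _ := by ring
  linarith

/-- The error bound for an M-type smoothing spline when the stochastic terms are controlled. -/
theorem IsMSpline.sqNorm_sub_le {ρ ψ : ℝ → ℝ} (hρ : ConvexOn ℝ Set.univ ρ)
    (hψ : IsSubgradientChoice ρ ψ) {a ξ : ℝ}
    (ha : 0 < a) (hξ : 0 < ξ) {ν₁ ν₂ : ℕ → ℝ} (hν₁ : ∀ k, ξ / 4 * (a / 2 ^ k) ≤ ν₁ k)
    (hν₂ : ∀ k, ξ / 4 * (a / 2 ^ k) ≤ -ν₂ k) {M : ℕ} {p : ℕ} (hp : 1 ≤ p) {n : ℕ} (hn : 1 ≤ n)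
    {c : ℝ} (hc : 0 < c) {t : Fin n → ℝ} (ht : ∀ i, t i ∈ Icc (0 : ℝ) 1)
    (H : ∀ f g : ℝ → ℝ, L2Primitive f g →
      |(1 / (n : ℝ)) * ∑ i, f (t i) - ∫ x, f x ∂unitMeasure|
        ≤ c / n * Real.sqrt (∫ x, g x ^ 2 ∂unitMeasure))
    {m : ℕ} (hm : 1 ≤ m) {h : ℝ} (h0 : 0 < h) (h1 : h ≤ 1) {C κ : ℝ} (hC : 0 < C)
    (hinterp : ∀ f : ℝ → ℝ, MemSobolev m f → ∫ x, f x ^ 2 ∂unitMeasure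
      + h ^ 2 * ∫ x, derivI 1 f x ^ 2 ∂unitMeasure ≤ C * sqNorm m (h ^ (2 * m)) f)
    (hκ : κ ≤ ξ / 256) (hκ1 : κ ≤ 1) (hκp : ξ / 128 * (2 * Real.pi / (p * h) ^ 2 * C) ≤ κ / 8)
    (hκn : ξ / 32 * (c * C / (n * h ^ 2)) ≤ κ / 8) {e : Fin n → ℝ} {fo f : ℝ → ℝ}
    (hfo : MemSobolev m fo) {B : ℝ} (hB0 : 0 ≤ B)
    (hB : ∀ g : ℝ → ℝ, MemSobolev m g → (∫ x, derivI m fo x * derivI m g x ∂unitMeasure) ^ 2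
      ≤ B ^ 2 * ∫ x, g x ^ 2 ∂unitMeasure)
    {S : ℝ} (hS : ∀ f g : ℝ → ℝ, L2Primitive f g → ((1 / (n : ℝ)) * ∑ i, ψ (e i) * f (t i)) ^ 2
      ≤ S * (∫ x, f x ^ 2 ∂unitMeasure + h ^ 2 * ∫ x, g x ^ 2 ∂unitMeasure))
    {δ L₁ L₂ K : ℝ} (hδ : 0 < δ) (hL₁ : 0 ≤ L₁) (hδlam : h ^ (2 * m) ≤ δ) (hδM : a / 2 ^ M ≤ δ)
    (hSδ : S ≤ L₁ * δ ^ 2) (hQδ : totalError ψ a ξ ν₁ ν₂ M p t e ≤ L₂ * δ ^ 2) (hK : 0 < K)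
    (hKlarge : ξ / 32 + L₂ + (Real.sqrt (C * L₁) + 2 * B) * K < 3 / 4 * κ * K ^ 2)
    (hKa : 2 / h * (C * (K * δ) ^ 2) ≤ a ^ 2)
    (hf : IsMSpline m ρ (h ^ (2 * m)) t (fun i => fo (t i) + e i) f) :
    sqNorm m (h ^ (2 * m)) (fun x => f x - fo x) ≤ (K * δ) ^ 2 := by
  -- If the error leaves the ball of radius `r = K δ`, shrink it to the sphere by `θ = r / √q`.
  -- There `hKa` keeps the sup norm below `a`, which the quadratic lower bound requires.
  by_contra! hlt
  obtain ⟨hd, -⟩ := hf.1.sub hfo hm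
  set lam := h ^ (2 * m) with hlam_def
  have hlam0 : 0 ≤ lam := by positivity
  set d : ℝ → ℝ := fun x => f x - fo x with hddef
  set q := sqNorm m lam d with hq
  set r := K * δ with hr
  have hr0 : 0 < r := by positivity
  have hq0 : 0 < q := lt_of_le_of_lt (sq_nonneg _) hlt
  have hsq0 : 0 < Real.sqrt q := Real.sqrt_pos.2 hq0
  set θ := r / Real.sqrt q with hθ
  have hθ0 : 0 ≤ θ := by positivity
  have hθ1 : θ ≤ 1 := by
    rw [hθ, div_le_one hsq0]
    exact Real.le_sqrt_of_sq_le hlt.le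
  have hθq : θ ^ 2 * q = r ^ 2 := by
    rw [hθ, div_pow, Real.sq_sqrt hq0.le, div_mul_cancel₀ _ hq0.ne']
  obtain ⟨hθd, hθdm⟩ := hd.const_mul hm θ
  have hnorm : sqNorm m lam (fun x => θ * d x) = r ^ 2 := by
    rw [sqNorm_const_mul hm lam hd, ← hq, hθq]
  have hpen : ∫ x, derivI m (fun x => θ * d x) x ^ 2 ∂unitMeasure
      = θ ^ 2 * ∫ x, derivI m d x ^ 2 ∂unitMeasure := by
    rw [← integral_const_mul]
    refine integral_congr_ae ?_
    filter_upwards [hθdm m le_rfl] with x hx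
    rw [hx, mul_pow]
  have hlow := sum_remainder_add_penalty_ge hψ ha hξ hν₁ hν₂ M hp hn hc ht H hm h0 h1 hC hinterp
    hκ hκ1 hκp hκn e hθd (by rw [← hlam_def, hnorm]; exact hKa)
  rw [← hlam_def, hnorm, hpen] at hlow
  have hbasic := hf.basic_inequality (ψ := ψ) hm hρ hlam0 hfo hθ0 hθ1
  rw [← hddef] at hbasic
  set I := ∫ x, derivI m fo x * derivI m d x ∂unitMeasure
  have hscore : θ * ((1 / (n : ℝ)) * ∑ i, ψ (e i) * d (t i)) ≤ Real.sqrt (C * L₁) * δ * r := by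
    refine le_of_abs_le (abs_le_of_sq_le_sq ?_ (by positivity))
    have e1 := hS d _ (hd.l2Primitive hm)
    have e2 := hinterp d hd
    rw [← hq] at e2
    have hd0 : 0 ≤ ∫ x, d x ^ 2 ∂unitMeasure + h ^ 2 * ∫ x, derivI 1 d x ^ 2 ∂unitMeasure :=
      add_nonneg (integral_nonneg fun x => sq_nonneg _)
        (mul_nonneg (by positivity) (integral_nonneg fun x => sq_nonneg _))
    calc (θ * ((1 / (n : ℝ)) * ∑ i, ψ (e i) * d (t i))) ^ 2
        = θ ^ 2 * ((1 / (n : ℝ)) * ∑ i, ψ (e i) * d (t i)) ^ 2 := mul_pow _ _ _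
      _ ≤ θ ^ 2 * (L₁ * δ ^ 2 * (C * q)) := by
          refine mul_le_mul_of_nonneg_left (e1.trans ?_) (sq_nonneg _)
          exact mul_le_mul hSδ e2 hd0 (by positivity)
      _ = C * L₁ * δ ^ 2 * (θ ^ 2 * q) := by ring
      _ = (Real.sqrt (C * L₁) * δ * r) ^ 2 := by
          rw [hθq, mul_pow (_ * δ) r, mul_pow (Real.sqrt _) δ, Real.sq_sqrt (by positivity)]
  have hbias : -(θ * I) ≤ B * r := by
    refine (neg_le_abs _).trans (abs_le_of_sq_le_sq ?_ (by positivity))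
    calc (θ * I) ^ 2 = θ ^ 2 * I ^ 2 := mul_pow _ _ _
      _ ≤ θ ^ 2 * (B ^ 2 * q) := by
          gcongr
          exact (hB d hd).trans (by gcongr; exact integral_sq_le_sqNorm m hlam0 d)
      _ = B ^ 2 * (θ ^ 2 * q) := by ring
      _ = (B * r) ^ 2 := by rw [hθq, mul_pow B r]
  have hbias' : -(2 * lam * θ * I) ≤ 2 * B * δ * r := by
    have e1 := mul_le_mul_of_nonneg_left hbias (show 0 ≤ 2 * lam by positivity)
    have e2 : lam * (B * r) ≤ δ * (B * r) := by gcongr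
    linarith
  have hM2 : ξ / 32 * (a / 2 ^ M) ^ 2 ≤ ξ / 32 * δ ^ 2 := by gcongr
  have hfin : 3 / 4 * κ * r ^ 2
      ≤ (ξ / 32 + L₂) * δ ^ 2 + (Real.sqrt (C * L₁) + 2 * B) * δ * r := by linarith
  have hδ2 : 0 < δ ^ 2 := by positivity
  have := mul_lt_mul_of_pos_right hKlarge hδ2
  rw [hr] at hfin
  linarith

/-! ### Probability bounds, rates and bandwidths -/

theorem measure_ge_le_ofReal {Ω : Type*} [MeasurableSpace Ω] {P : Measure Ω}
    [IsProbabilityMeasure P] {X : Ω → ℝ} (hX0 : ∀ ω, 0 ≤ X ω) (hX : Integrable X P) {L x : ℝ}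
    (hL : 0 < L) (hx : ∫ ω, X ω ∂P ≤ L * x) : P {ω | L ≤ X ω} ≤ ENNReal.ofReal x := by
  have h1 := mul_meas_ge_le_integral_of_nonneg (Eventually.of_forall hX0) hX L
  have h2 : P.real {ω | L ≤ X ω} ≤ x := le_of_mul_le_mul_left (h1.trans hx) hL
  rw [← ENNReal.ofReal_toReal (measure_ne_top P {ω | L ≤ X ω})]
  exact ENNReal.ofReal_le_ofReal h2

theorem IsBigOInProb.mono {Ω : Type*} [MeasurableSpace Ω] {P : Measure Ω} {X Y : ℕ → Ω → ℝ}
    {a b : ℕ → ℝ} (h : IsBigOInProb P X a) (hXY : ∀ᶠ n in atTop, ∀ ω, |Y n ω| ≤ |X n ω|) {D : ℝ}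
    (hD : 0 < D) (hab : ∀ᶠ n in atTop, a n ≤ D * b n) : IsBigOInProb P Y b := by
  intro δ hδ
  obtain ⟨K, hK, H⟩ := h δ hδ
  refine ⟨K * D, by positivity, ?_⟩
  filter_upwards [H, hab, hXY] with n h1 h2 h3
  refine (measure_mono fun ω hω => ?_).trans h1
  have h4 : K * a n ≤ K * D * b n := by rw [mul_assoc]; gcongr
  exact h4.trans_lt (lt_of_lt_of_le hω (h3 ω))

/-- The two terms balance: `1 - 1 / (4m + 1) = 4m / (4m + 1)`, twice the exponent of `lam`. -/
theorem rate_le_of_isTheta {m : ℕ} (hm : 1 ≤ m) {lam : ℕ → ℝ} (hlam : ∀ n, 0 < lam n)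
    (hΘ : lam =Θ[atTop] (fun n : ℕ => (n : ℝ) ^ (-(2 * (m : ℝ) / (4 * m + 1))))) :
    ∃ D : ℝ, 0 < D ∧ ∀ᶠ n : ℕ in atTop,
      lam n ^ 2 + ((n : ℝ) * lam n ^ (1 / (2 * (m : ℝ))))⁻¹
        ≤ D * (n : ℝ) ^ (-(4 * (m : ℝ) / (4 * m + 1))) := by
  obtain ⟨D₁, hD₁, h1⟩ := hΘ.1.exists_pos
  obtain ⟨D₂, hD₂, h2⟩ := hΘ.2.exists_pos
  have hm0 : (0 : ℝ) < m := by exact_mod_cast hm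
  refine ⟨D₁ ^ 2 + ((D₂⁻¹) ^ (1 / (2 * (m : ℝ))))⁻¹, by positivity, ?_⟩
  filter_upwards [h1.bound, h2.bound, eventually_ge_atTop 1] with n e1 e2 hn
  have hn0 : (0 : ℝ) < n := by exact_mod_cast hn
  have hpow : 0 < (n : ℝ) ^ (-(2 * (m : ℝ) / (4 * m + 1))) := Real.rpow_pos_of_pos hn0 _
  rw [Real.norm_of_nonneg (hlam n).le, Real.norm_of_nonneg hpow.le] at e1 e2
  rw [add_mul]
  refine add_le_add ?_ ?_
  · calc lam n ^ 2 ≤ (D₁ * (n : ℝ) ^ (-(2 * (m : ℝ) / (4 * m + 1)))) ^ 2 :=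
          pow_le_pow_left₀ (hlam n).le e1 2
      _ = D₁ ^ 2 * (n : ℝ) ^ (-(4 * (m : ℝ) / (4 * m + 1))) := by
          rw [mul_pow, ← Real.rpow_natCast ((n : ℝ) ^ _), ← Real.rpow_mul hn0.le]
          congr 2
          push_cast
          ring
  · have e3 : D₂⁻¹ * (n : ℝ) ^ (-(2 * (m : ℝ) / (4 * m + 1))) ≤ lam n := by
      rw [inv_mul_le_iff₀ hD₂]
      exact e2
    have e4 : (D₂⁻¹) ^ (1 / (2 * (m : ℝ))) * (n : ℝ) ^ (4 * (m : ℝ) / (4 * m + 1))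
        ≤ n * lam n ^ (1 / (2 * (m : ℝ))) := by
      have e5 : (D₂⁻¹ * (n : ℝ) ^ (-(2 * (m : ℝ) / (4 * m + 1)))) ^ (1 / (2 * (m : ℝ)))
          ≤ lam n ^ (1 / (2 * (m : ℝ))) := Real.rpow_le_rpow (by positivity) e3 (by positivity)
      refine le_trans (le_of_eq ?_) (mul_le_mul_of_nonneg_left e5 hn0.le)
      rw [Real.mul_rpow (by positivity) hpow.le, ← Real.rpow_mul hn0.le]
      have e6 : (n : ℝ) ^ (4 * (m : ℝ) / (4 * m + 1))
          = n * (n : ℝ) ^ (-(2 * (m : ℝ) / (4 * m + 1)) * (1 / (2 * (m : ℝ)))) := by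
        nth_rewrite 2 [← Real.rpow_one (n : ℝ)]
        rw [← Real.rpow_add hn0]
        congr 1
        field_simp
        ring
      rw [e6]
      ring
    rw [Real.rpow_neg hn0.le, ← mul_inv]
    exact inv_anti₀ (by positivity) e4

section Score

variable {Ω : Type*} [MeasurableSpace Ω] {P : Measure Ω}

/-- Near the origin the shifted score is square integrable and its mean is almost linear. -/
theorem exists_score_radius {ψ : ℝ → ℝ} (hψ : Monotone ψ) {e : Ω → ℝ} (he : Measurable e)
    (hcont : Tendsto (fun s : ℝ => ∫⁻ ω, ENNReal.ofReal ((ψ (e ω + s) - ψ (e ω)) ^ 2) ∂P) (𝓝 0)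
      (𝓝 0)) (hsq : MemLp (fun ω => ψ (e ω)) 2 P) {ξ : ℝ} (hξ : 0 < ξ)
    (hlin : (fun s : ℝ => (∫ ω, ψ (e ω + s) ∂P) - ξ * s) =o[𝓝 0] fun s : ℝ => |s|) :
    ∃ a : ℝ, 0 < a ∧ ∀ s : ℝ, |s| ≤ a → MemLp (fun ω => ψ (e ω + s)) 2 P ∧
      |(∫ ω, ψ (e ω + s) ∂P) - ξ * s| ≤ ξ / 8 * |s| := by
  have h1 := hlin.def (show 0 < ξ / 8 by positivity)
  have h2 : ∀ᶠ s in 𝓝 (0 : ℝ),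
      ∫⁻ ω, ENNReal.ofReal ((ψ (e ω + s) - ψ (e ω)) ^ 2) ∂P < 1 :=
    hcont.eventually_lt_const zero_lt_one
  obtain ⟨r, hr, H⟩ := Metric.eventually_nhds_iff_ball.1 (h1.and h2)
  refine ⟨r / 2, by positivity, fun s hs => ?_⟩
  obtain ⟨e1, e2⟩ := H s (by rw [mem_ball_zero_iff, Real.norm_eq_abs]; linarith)
  refine ⟨?_, by simpa using e1⟩
  have hmeas : Measurable fun ω => ψ (e ω + s) - ψ (e ω) :=
    (hψ.measurable.comp (he.add_const s)).sub (hψ.measurable.comp he)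
  have hdiff : MemLp (fun ω => ψ (e ω + s) - ψ (e ω)) 2 P := by
    rw [memLp_two_iff_integrable_sq hmeas.aestronglyMeasurable]
    refine ⟨(hmeas.pow_const 2).aestronglyMeasurable, ?_⟩
    rw [hasFiniteIntegral_iff_ofReal (Eventually.of_forall fun ω => sq_nonneg _)]
    exact e2.trans ENNReal.one_lt_top
  have := hdiff.add hsq
  refine this.ae_eq (Eventually.of_forall fun ω => ?_)
  simp

theorem exists_pos_of_integral_pos {X : Ω → ℝ} (h : 0 < ∫ ω, X ω ∂P) : ∃ ω, 0 < X ω := by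
  by_contra! hc
  exact absurd h (not_lt.2 (integral_nonpos hc))

end Score

theorem bandwidth_pow {m : ℕ} (hm : 1 ≤ m) {x : ℝ} (hx : 0 ≤ x) :
    (x ^ (1 / (2 * (m : ℝ)))) ^ (2 * m) = x := by
  have : (1 / (2 * (m : ℝ))) = ((2 * m : ℕ) : ℝ)⁻¹ := by push_cast; rw [one_div]
  rw [this]
  exact Real.rpow_inv_natCast_pow hx (by omega)

theorem tendsto_bandwidth {m : ℕ} (hm : 1 ≤ m) {lam : ℕ → ℝ}
    (hlam_zero : Tendsto lam atTop (𝓝 0)) :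
    Tendsto (fun n => lam n ^ (1 / (2 * (m : ℝ)))) atTop (𝓝 0) := by
  have hm0 : (0 : ℝ) < m := by exact_mod_cast hm
  have h := hlam_zero.rpow_const (p := 1 / (2 * (m : ℝ))) (Or.inr (by positivity))
  rwa [Real.zero_rpow (by positivity)] at h

/-- The `m`-th power of `n h²` is `n^m lam`. -/
theorem tendsto_mul_bandwidth_sq {m : ℕ} (hm : 1 ≤ m) {lam : ℕ → ℝ} (hlam_pos : ∀ n, 0 < lam n)
    (hlam_inf : Tendsto (fun n : ℕ => (n : ℝ) ^ m * lam n) atTop atTop) :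
    Tendsto (fun n : ℕ => (n : ℝ) * (lam n ^ (1 / (2 * (m : ℝ)))) ^ 2) atTop atTop := by
  refine tendsto_atTop.2 fun b => ?_
  filter_upwards [hlam_inf.eventually_ge_atTop (max b 0 ^ m)] with n hn
  refine (le_max_left b 0).trans (le_of_pow_le_pow_left₀ (show m ≠ 0 by omega) ?_ (hn.trans ?_))
  · have := hlam_pos n
    positivity
  · rw [mul_pow, ← pow_mul, bandwidth_pow hm (hlam_pos n).le]

/-! ### The stochastic rate -/

set_option maxHeartbeats 1000000 in
/-- The rate of convergence of M-type smoothing splines. -/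
theorem isBigOInProb_sqNorm {Ω : Type*} [MeasurableSpace Ω] (P : Measure Ω)
    [IsProbabilityMeasure P] {m : ℕ} (hm : 1 ≤ m) {ρ ψ : ℝ → ℝ} (hρ : ConvexOn ℝ Set.univ ρ)
    (hψ : IsSubgradientChoice ρ ψ) {ε : ℕ → Ω → ℝ} (hε_indep : iIndepFun ε P)
    (hε_ident : ∀ i, IdentDistrib (ε i) (ε 0) P P)
    (hψ_sq : MemLp (fun ω => ψ (ε 0 ω)) 2 P) (hψ_mean : ∫ ω, ψ (ε 0 ω) ∂P = 0) {ξ : ℝ}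
    (hξ : 0 < ξ) {a : ℝ} (ha : 0 < a)
    (hscore : ∀ s : ℝ, |s| ≤ a → MemLp (fun ω => ψ (ε 0 ω + s)) 2 P ∧
      |(∫ ω, ψ (ε 0 ω + s) ∂P) - ξ * s| ≤ ξ / 8 * |s|)
    {t : (n : ℕ) → Fin n → ℝ} (ht_mem : ∀ n i, t n i ∈ Set.Icc (0 : ℝ) 1) (ht : QuasiUniform t)
    {lam : ℕ → ℝ} (hlam_pos : ∀ n, 0 < lam n) (hlam_zero : Tendsto lam atTop (𝓝 0))
    (hlam_inf : Tendsto (fun n : ℕ => (n : ℝ) ^ m * lam n) atTop atTop)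
    {fo : ℝ → ℝ} (hfo : MemSobolev (2 * m) fo)
    (hfo_bdry : ∀ s : ℕ, m ≤ s → s ≤ 2 * m - 1 → derivI s fo 0 = 0 ∧ derivI s fo 1 = 0)
    {fhat : (n : ℕ) → (Fin n → ℝ) → ℝ → ℝ}
    (hfhat : ∀ n : ℕ, m ≤ n → ∀ y : Fin n → ℝ, IsMSpline m ρ (lam n) (t n) y (fhat n y)) :
    IsBigOInProb P
      (fun n ω => sqNorm m (lam n)
        (fun x => fhat n (fun i : Fin n => fo (t n i) + ε i ω) x - fo x))
      (fun n => lam n ^ 2 + ((n : ℝ) * lam n ^ (1 / (2 * (m : ℝ))))⁻¹) := by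
  intro δp hδp
  have hψm := hψ.monotone
  obtain ⟨c, hc, H⟩ := ht.exists_bound
  obtain ⟨C, hC, hinterp⟩ := exists_sqNorm_one_le m hm
  set h : ℕ → ℝ := fun n => lam n ^ (1 / (2 * (m : ℝ))) with hh
  have h0 : ∀ n, 0 < h n := fun n => Real.rpow_pos_of_pos (hlam_pos n) _
  have hhm : ∀ n, h n ^ (2 * m) = lam n := fun n => bandwidth_pow hm (hlam_pos n).le
  have hh_zero : Tendsto h atTop (𝓝 0) := tendsto_bandwidth hm hlam_zero
  have hh_inf : Tendsto (fun n : ℕ => (n : ℝ) * h n ^ 2) atTop atTop :=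
    tendsto_mul_bandwidth_sq hm hlam_pos hlam_inf
  -- means of the increments over dyadic shells
  set ν₁ : ℕ → ℝ := fun k => ∫ ω, shellIncr ψ a k (ε 0 ω) ∂P with hν₁_def
  set ν₂ : ℕ → ℝ := fun k => ∫ ω, shellIncr ψ (-a) k (ε 0 ω) ∂P with hν₂_def
  have hpow : ∀ k : ℕ, 0 ≤ a / 2 ^ k ∧ a / 2 ^ k ≤ a := fun k =>
    ⟨by positivity, div_le_self ha.le (one_le_pow₀ (by norm_num))⟩
  have hhalf : ∀ k : ℕ, a / 2 ^ (k + 1) = a / 2 ^ k / 2 := fun k => by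
    rw [pow_succ, div_mul_eq_div_div]
  -- With `s = a / 2^k`, the means differ by at least `ξ s / 2 - ξ/8 * (s + s/2) = 5/16 * ξ s`.
  have hν₁ : ∀ k, ξ / 4 * (a / 2 ^ k) ≤ ν₁ k := by
    intro k
    obtain ⟨l1, b1⟩ := hscore (a / 2 ^ k) (by rw [abs_of_nonneg (hpow k).1]; exact (hpow k).2)
    obtain ⟨l2, b2⟩ := hscore (a / 2 ^ (k + 1))
      (by rw [abs_of_nonneg (hpow _).1]; exact (hpow _).2)
    have e1 : ν₁ k = ∫ ω, ψ (ε 0 ω + a / 2 ^ k) ∂P - ∫ ω, ψ (ε 0 ω + a / 2 ^ (k + 1)) ∂P :=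
      integral_sub (l1.integrable one_le_two) (l2.integrable one_le_two)
    rw [abs_of_nonneg (hpow _).1] at b1 b2
    have b1' := (abs_le.1 b1).1
    have b2' := (abs_le.1 b2).2
    rw [e1]
    rw [hhalf] at b2' ⊢
    nlinarith [mul_nonneg hξ.le (hpow k).1]
  have hν₂ : ∀ k, ξ / 4 * (a / 2 ^ k) ≤ -ν₂ k := by
    intro k
    obtain ⟨l1, b1⟩ := hscore (-a / 2 ^ k)
      (by rw [neg_div, abs_neg, abs_of_nonneg (hpow k).1]; exact (hpow k).2)
    obtain ⟨l2, b2⟩ := hscore (-a / 2 ^ (k + 1))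
      (by rw [neg_div, abs_neg, abs_of_nonneg (hpow _).1]; exact (hpow _).2)
    have e1 : ν₂ k = ∫ ω, ψ (ε 0 ω + -a / 2 ^ k) ∂P - ∫ ω, ψ (ε 0 ω + -a / 2 ^ (k + 1)) ∂P :=
      integral_sub (l1.integrable one_le_two) (l2.integrable one_le_two)
    rw [neg_div, abs_neg, abs_of_nonneg (hpow _).1] at b1 b2
    have b1' := (abs_le.1 b1).2
    have b2' := (abs_le.1 b2).1
    rw [e1, neg_div, neg_div]
    rw [hhalf] at b2' ⊢
    nlinarith [mul_nonneg hξ.le (hpow k).1]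
  set W := ∫ ω, (ψ (ε 0 ω + a) - ψ (ε 0 ω)) ^ 2 ∂P + ∫ ω, (ψ (ε 0 ω + -a) - ψ (ε 0 ω)) ^ 2 ∂P
  have hW : 0 ≤ W :=
    add_nonneg (integral_nonneg fun ω => sq_nonneg _) (integral_nonneg fun ω => sq_nonneg _)
  set σ2 := ∫ ω, ψ (ε 0 ω) ^ 2 ∂P
  have hσ2 : 0 ≤ σ2 := integral_nonneg fun ω => sq_nonneg _
  -- the bias
  set B := Real.sqrt (∫ x, derivI (2 * m) fo x ^ 2 ∂unitMeasure)
  have hfo_m : MemSobolev m fo := hfo.mono hm (by omega)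
  have hB : ∀ g : ℝ → ℝ, MemSobolev m g → (∫ x, derivI m fo x * derivI m g x ∂unitMeasure) ^ 2
      ≤ B ^ 2 * ∫ x, g x ^ 2 ∂unitMeasure := by
    intro g hg
    have := sq_integral_mul_le_of_boundary (hfo.chain (by omega)) (hg.chain hm)
      (fun s hs1 hs2 => hfo_bdry s hs1 (by omega)) hm
    rw [Real.sq_sqrt (integral_nonneg fun x => sq_nonneg _)]
    simpa only [derivI_zero] using this
  -- constants
  set κ := min (ξ / 256) 1
  have hκ0 : 0 < κ := lt_min (by positivity) one_pos
  -- Cells no longer than `η h` make the oscillation error exactly fit the budget `κ / 8`.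
  set η := Real.sqrt (8 * κ / (Real.pi * ξ * C)) with hη
  have hπ := Real.pi_pos
  have hη0 : 0 < η := Real.sqrt_pos.2 (by positivity)
  have hη2 : η ^ 2 = 8 * κ / (Real.pi * ξ * C) := Real.sq_sqrt (by positivity)
  -- At most `(1/η + 2) / h` cells, each with expected error at most `2 W / ξ`.
  set C₂ := (1 / η + 2) * (2 / ξ * W)
  have hC₂ : 0 ≤ C₂ := by positivity
  -- Markov thresholds spending `δp / 2` on each stochastic term; the `+ 1` keeps them positive even
  -- when the moments vanish.
  set L₁ := 2 * (4 * σ2) / δp + 1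
  have hL₁ : 0 < L₁ := by positivity
  set L₂ := 2 * C₂ / δp + 1
  have hL₂ : 0 < L₂ := by positivity
  set A := ξ / 32 + L₂
  set D := Real.sqrt (C * L₁) + 2 * B
  have hA : 0 < A := by positivity
  have hD : 0 ≤ D := by positivity
  set K := 4 / (3 * κ) * (A + D) + 1
  have hK1 : 1 < K := by
    have : 0 < 4 / (3 * κ) * (A + D) := by positivity
    linarith
  have hKlarge : A + D * K < 3 / 4 * κ * K ^ 2 := by
    have e1 : A + D < 3 / 4 * κ * K := by
      have : 3 / 4 * κ * K = A + D + 3 / 4 * κ := by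
        simp only [K]
        field_simp
      linarith [show 0 < 3 / 4 * κ by positivity]
    have e2 : (A + D) * K < 3 / 4 * κ * K * K := mul_lt_mul_of_pos_right e1 (by linarith)
    have e3 : A ≤ A * K := le_mul_of_one_le_right hA.le hK1.le
    nlinarith
  refine ⟨K ^ 2, by positivity, ?_⟩
  -- This makes the sup norm on the sphere of radius `K δ` at most `a`, since `lam ≤ h` gives `δ² /
  -- h ≤ h + 1/(n h²)`. It is here that `n^m lam → ∞` enters the localization.
  have hsup : ∀ᶠ n : ℕ in atTop, h n + ((n : ℝ) * h n ^ 2)⁻¹ < a ^ 2 / (2 * C * K ^ 2) := by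
    have : Tendsto (fun n : ℕ => h n + ((n : ℝ) * h n ^ 2)⁻¹) atTop (𝓝 (0 + 0)) :=
      hh_zero.add hh_inf.inv_tendsto_atTop
    rw [add_zero] at this
    exact this.eventually_lt_const (by positivity)
  filter_upwards [eventually_ge_atTop 2, eventually_ge_atTop m,
    hh_zero.eventually_lt_const one_pos, hsup,
    hh_inf.eventually_ge_atTop (ξ * c * C / (4 * κ))] with n hn2 hnm hn1 hnsup hninf
  have hn0 : (0 : ℝ) < n := by exact_mod_cast (by omega : 0 < n)
  have hhn := h0 n
  set p := ⌈1 / (η * h n)⌉₊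
  have hp : 1 ≤ p := Nat.one_le_ceil_iff.2 (by positivity)
  have hp_ge : 1 / (η * h n) ≤ p := Nat.le_ceil _
  have hp_le : (p : ℝ) + 1 ≤ (1 / η + 2) / h n := by
    have e1 := (Nat.ceil_lt_add_one (show 0 ≤ 1 / (η * h n) by positivity)).le
    have e2 : (1 / η + 2) / h n = 1 / (η * h n) + 2 / h n := by field_simp
    have e3 : 2 ≤ 2 / h n := by rw [le_div_iff₀ hhn]; linarith
    rw [e2]
    linarith
  set δ := Real.sqrt (lam n ^ 2 + ((n : ℝ) * h n)⁻¹) with hδ_def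
  have hδ2 : δ ^ 2 = lam n ^ 2 + ((n : ℝ) * h n)⁻¹ := Real.sq_sqrt (by positivity)
  have hδ0 : 0 < δ := Real.sqrt_pos.2 (by positivity)
  have hnh : ((n : ℝ) * h n)⁻¹ ≤ δ ^ 2 := by rw [hδ2]; linarith [sq_nonneg (lam n)]
  have hδlam : h n ^ (2 * m) ≤ δ := by
    rw [hhm]
    refine Real.le_sqrt_of_sq_le ?_
    linarith [show 0 < ((n : ℝ) * h n)⁻¹ by positivity]
  -- `M` may depend on `n`, since the cell errors are bounded uniformly in `M`.
  obtain ⟨M, hM⟩ : ∃ M : ℕ, a / 2 ^ M ≤ δ := by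
    obtain ⟨M, hM⟩ := exists_pow_lt_of_lt_one (show 0 < δ / a by positivity)
      (show (1 / 2 : ℝ) < 1 by norm_num)
    refine ⟨M, ?_⟩
    rw [lt_div_iff₀ ha] at hM
    calc a / 2 ^ M = (1 / 2) ^ M * a := by rw [one_div_pow]; ring
      _ ≤ δ := hM.le
  -- the stochastic terms
  obtain ⟨S, hS0, hSint, hSle, hS⟩ := exists_score_bound hε_indep hε_ident hψm.measurable hψ_sq
    hψ_mean (by omega : 1 ≤ n) (ht_mem n) hhn hn1.le
  set Q : Ω → ℝ := fun ω => totalError ψ a ξ ν₁ ν₂ M p (t n) fun i => ε i ω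
  have hfrac : ∀ x y u v : ℝ, 1 / u * (x / v * y) = x * y * (u * v)⁻¹ := fun x y u v => by
    rw [mul_inv]
    ring
  have hthr : ∀ x y : ℝ, (2 * x / δp + 1) * y * (δp / 2) = (x + δp / 2) * y := fun x y => by
    field_simp
  have hcell := fun k => integral_cellError_le (n := n) hε_indep hε_ident hψm ha hξ
    (fun s hs => (hscore s hs).1) M (cell (t n) p k)
  have hQ0 : ∀ ω, 0 ≤ Q ω := fun ω =>
    mul_nonneg (by positivity) (Finset.sum_nonneg fun k _ => Finset.sum_nonneg fun j _ =>
      mul_nonneg (by positivity) (add_nonneg (sq_nonneg _) (sq_nonneg _)))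
  have hQint : Integrable Q P :=
    (integrable_finsetSum _ fun k _ => (hcell k).1).const_mul _
  have hQle : ∫ ω, Q ω ∂P ≤ C₂ * ((n : ℝ) * h n)⁻¹ := by
    simp only [Q, totalError]
    rw [integral_const_mul, integral_finsetSum _ fun k _ => (hcell k).1]
    calc 1 / (n : ℝ) * ∑ k ∈ Finset.range (p + 1), ∫ ω, cellError ψ a ξ ν₁ ν₂ M (cell (t n) p k)
          (fun i => ε i ω) ∂P
        ≤ 1 / (n : ℝ) * ∑ _k ∈ Finset.range (p + 1), 2 / ξ * W := by
          gcongr with k hk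
          exact (hcell k).2
      _ = 1 / (n : ℝ) * (((p : ℝ) + 1) * (2 / ξ * W)) := by
          rw [Finset.sum_const, Finset.card_range, nsmul_eq_mul]
          push_cast
          ring
      _ ≤ 1 / (n : ℝ) * ((1 / η + 2) / h n * (2 / ξ * W)) := by gcongr
      _ = _ := hfrac _ _ _ _
  have hPS : P {ω | L₁ * ((n : ℝ) * h n)⁻¹ ≤ S ω} ≤ ENNReal.ofReal (δp / 2) := by
    refine measure_ge_le_ofReal hS0 hSint (by positivity) (hSle.trans ?_)
    have e1 : L₁ * ((n : ℝ) * h n)⁻¹ * (δp / 2) = (4 * σ2 + δp / 2) * ((n : ℝ) * h n)⁻¹ :=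
      hthr _ _
    rw [e1]
    gcongr
    linarith
  have hPQ : P {ω | L₂ * ((n : ℝ) * h n)⁻¹ ≤ Q ω} ≤ ENNReal.ofReal (δp / 2) := by
    refine measure_ge_le_ofReal hQ0 hQint (by positivity) (hQle.trans ?_)
    have e1 : L₂ * ((n : ℝ) * h n)⁻¹ * (δp / 2) = (C₂ + δp / 2) * ((n : ℝ) * h n)⁻¹ :=
      hthr _ _
    rw [e1]
    gcongr
    linarith
  have hκp : ξ / 128 * (2 * Real.pi / (p * h n) ^ 2 * C) ≤ κ / 8 := by
    have e1 : 1 / η ≤ p * h n := by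
      rw [div_le_iff₀ (by positivity)] at hp_ge ⊢
      linarith
    calc ξ / 128 * (2 * Real.pi / (p * h n) ^ 2 * C)
        ≤ ξ / 128 * (2 * Real.pi / (1 / η) ^ 2 * C) := by gcongr
      _ = ξ / 64 * Real.pi * C * η ^ 2 := by field_simp; ring
      _ = κ / 8 := by rw [hη2]; field_simp; ring
  have hκn : ξ / 32 * (c * C / (n * h n ^ 2)) ≤ κ / 8 := by
    rw [div_le_iff₀ (by positivity)] at hninf
    have e1 : c * C / (n * h n ^ 2) ≤ 4 * κ / ξ := by
      rw [div_le_div_iff₀ (by positivity) hξ]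
      linarith
    calc ξ / 32 * (c * C / (n * h n ^ 2)) ≤ ξ / 32 * (4 * κ / ξ) := by gcongr
      _ = κ / 8 := by field_simp; ring
  have hKa : 2 / h n * (C * (K * δ) ^ 2) ≤ a ^ 2 := by
    have hlamh : lam n ≤ h n := by
      rw [← hhm]
      exact pow_le_of_le_one hhn.le hn1.le (by omega)
    have e1 : lam n ^ 2 ≤ h n ^ 2 := pow_le_pow_left₀ (hlam_pos n).le hlamh 2
    rw [lt_div_iff₀ (by positivity)] at hnsup
    calc 2 / h n * (C * (K * δ) ^ 2)
        = 2 / h n * (C * (K ^ 2 * (lam n ^ 2 + ((n : ℝ) * h n)⁻¹))) := by rw [mul_pow K δ, hδ2]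
      _ ≤ 2 / h n * (C * (K ^ 2 * (h n ^ 2 + ((n : ℝ) * h n)⁻¹))) := by gcongr
      _ = (h n + ((n : ℝ) * h n ^ 2)⁻¹) * (2 * C * K ^ 2) := by field_simp
      _ ≤ a ^ 2 := hnsup.le
  -- An inclusion in events of `S` and `Q` suffices for outer probability, so the estimator need not
  -- be measurable in `ω`.
  have hsub : {ω | K ^ 2 * (lam n ^ 2 + ((n : ℝ) * lam n ^ (1 / (2 * (m : ℝ))))⁻¹)
        < |sqNorm m (lam n) (fun x => fhat n (fun i : Fin n => fo (t n i) + ε i ω) x - fo x)|}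
      ⊆ {ω | L₁ * ((n : ℝ) * h n)⁻¹ ≤ S ω} ∪ {ω | L₂ * ((n : ℝ) * h n)⁻¹ ≤ Q ω} := by
    intro ω hω
    by_contra hgood
    rw [mem_union, not_or] at hgood
    have g1 : S ω ≤ L₁ * δ ^ 2 := (not_le.1 hgood.1).le.trans (by gcongr)
    have g2 : Q ω ≤ L₂ * δ ^ 2 := (not_le.1 hgood.2).le.trans (by gcongr)
    have hspline := hfhat n hnm fun i => fo (t n i) + ε i ω
    rw [← hhm] at hspline
    have hmain := hspline.sqNorm_sub_le hρ hψ ha hξ hν₁ hν₂ hp (by omega) hc (ht_mem n) (H n hn2)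
      hm hhn hn1.le hC (fun f hf => hinterp f hf (h n) hhn hn1.le) (min_le_left _ _)
      (min_le_right _ _) hκp hκn hfo_m (Real.sqrt_nonneg _) hB (hS ω) hδ0 hL₁.le hδlam hM g1 g2
      (by linarith) hKlarge hKa
    rw [hhm, mul_pow, hδ2] at hmain
    have hω' : K ^ 2 * (lam n ^ 2 + ((n : ℝ) * h n)⁻¹)
        < |sqNorm m (lam n) (fun x => fhat n (fun i : Fin n => fo (t n i) + ε i ω) x - fo x)| := hω
    rw [abs_of_nonneg (sqNorm_nonneg m (hlam_pos n).le _)] at hω'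
    exact absurd hmain (not_le.2 hω')
  calc _ ≤ P ({ω | L₁ * ((n : ℝ) * h n)⁻¹ ≤ S ω} ∪ {ω | L₂ * ((n : ℝ) * h n)⁻¹ ≤ Q ω}) :=
        measure_mono hsub
    _ ≤ ENNReal.ofReal (δp / 2) + ENNReal.ofReal (δp / 2) :=
        (measure_union_le _ _).trans (add_le_add hPS hPQ)
    _ = ENNReal.ofReal δp := by
        rw [← ENNReal.ofReal_add (by positivity) (by positivity), add_halves]

end MSpline

/-! ### The main theorem -/

theorem corollary2 {Ω : Type*} [MeasurableSpace Ω] (P : Measure Ω) [IsProbabilityMeasure P]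
    (m : ℕ) (hm : 1 ≤ m)
    -- the loss function and a choice of its subgradient
    (ρ ψ : ℝ → ℝ) (hρ : ConvexOn ℝ Set.univ ρ) (hψ : MSpline.IsSubgradientChoice ρ ψ)
    -- independent and identically distributed errors
    (ε : ℕ → Ω → ℝ) (hε_meas : ∀ i, Measurable (ε i)) (hε_indep : iIndepFun ε P)
    (hε_ident : ∀ i, IdentDistrib (ε i) (ε 0) P P)
    -- mean-square continuity at zero
    (hψ_cont : Tendsto
      (fun s : ℝ => ∫⁻ ω, ENNReal.ofReal ((ψ (ε 0 ω + s) - ψ (ε 0 ω)) ^ 2) ∂P) (𝓝 0) (𝓝 0))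
    -- moments and linearization of the score
    (hψ_sq : MemLp (fun ω => ψ (ε 0 ω)) 2 P)
    (hψ_mean : ∫ ω, ψ (ε 0 ω) ∂P = 0)
    (ξ : ℝ) (hξ : 0 < ξ)
    (hψ_lin : (fun s : ℝ => (∫ ω, ψ (ε 0 ω + s) ∂P) - ξ * s) =o[𝓝 0] fun s : ℝ => |s|)
    -- quasi-uniform design
    (t : (n : ℕ) → Fin n → ℝ) (ht_mem : ∀ n i, t n i ∈ Set.Icc (0 : ℝ) 1)
    (ht : MSpline.QuasiUniform t)
    -- smoothing parameter
    (lam : ℕ → ℝ) (hlam_pos : ∀ n, 0 < lam n) (hlam_zero : Tendsto lam atTop (𝓝 0))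
    (hlam_inf : Tendsto (fun n : ℕ => (n : ℝ) ^ m * lam n) atTop atTop)
    -- regression function
    (fo : ℝ → ℝ) (hfo : MSpline.MemSobolev (2 * m) fo)
    (hfo_bdry : ∀ s : ℕ, m ≤ s → s ≤ 2 * m - 1 →
      MSpline.derivI s fo 0 = 0 ∧ MSpline.derivI s fo 1 = 0) :
    -- the estimator is a function of the responses
    ∃ fhat : (n : ℕ) → (Fin n → ℝ) → ℝ → ℝ,
      (∀ n : ℕ, m ≤ n → ∀ y : Fin n → ℝ, MSpline.IsMSpline m ρ (lam n) (t n) y (fhat n y)) ∧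
      MSpline.IsBigOInProb P
        (fun n ω => MSpline.sqNorm m (lam n)
          (fun x => fhat n (fun i : Fin n => fo (t n i) + ε i ω) x - fo x))
        (fun n => lam n ^ 2 + ((n : ℝ) * lam n ^ (1 / (2 * (m : ℝ))))⁻¹) ∧
      (lam =Θ[atTop] (fun n : ℕ => (n : ℝ) ^ (-(2 * (m : ℝ) / (4 * m + 1)))) →
        MSpline.IsBigOInProb P
          (fun n ω => MSpline.sqNorm m (lam n)
            (fun x => fhat n (fun i : Fin n => fo (t n i) + ε i ω) x - fo x))
          (fun n => (n : ℝ) ^ (-(4 * (m : ℝ) / (4 * m + 1)))) ∧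
        MSpline.IsBigOInProb P
          (fun n ω => ∫ x in (0 : ℝ)..1,
            (fhat n (fun i : Fin n => fo (t n i) + ε i ω) x - fo x) ^ 2)
          (fun n => (n : ℝ) ^ (-(4 * (m : ℝ) / (4 * m + 1))))) := by
  obtain ⟨a, ha, hscore⟩ := MSpline.exists_score_radius hψ.monotone (hε_meas 0) hψ_cont hψ_sq hξ
    hψ_lin
  have hρ_cont : Continuous ρ := by
    rw [← continuousOn_univ]
    exact hρ.continuousOn isOpen_univ
  -- The linearized means at `a` and `-a` have opposite signs, so `ψ` takes both signs and `ρ` grows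
  -- linearly in both directions, as existence requires.
  obtain ⟨ω₁, hω₁⟩ : ∃ ω, 0 < ψ (ε 0 ω + a) := by
    refine MSpline.exists_pos_of_integral_pos (P := P) ?_
    have h1 := (abs_le.1 (hscore a (abs_of_pos ha).le).2).1
    rw [abs_of_pos ha] at h1
    nlinarith [mul_pos hξ ha]
  obtain ⟨ω₂, hω₂⟩ : ∃ ω, 0 < -ψ (ε 0 ω + -a) := by
    refine MSpline.exists_pos_of_integral_pos (P := P) ?_
    have h1 := (abs_le.1 (hscore (-a) (by rw [abs_neg, abs_of_pos ha])).2).2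
    rw [abs_neg, abs_of_pos ha] at h1
    rw [integral_neg]
    nlinarith [mul_pos hξ ha]
  obtain ⟨α, β, hα, hlow⟩ := hψ.exists_linear_lower_bound hω₁ (neg_pos.1 hω₂)
  have hex : ∀ n : ℕ, ∀ y : Fin n → ℝ, ∃ f : ℝ → ℝ,
      m ≤ n → MSpline.IsMSpline m ρ (lam n) (t n) y f := by
    intro n y
    by_cases hmn : m ≤ n
    · obtain ⟨f, hf⟩ := MSpline.exists_isMSpline hm hρ_cont hα hlow (hlam_pos n) (hm.trans hmn)
        (ht_mem n) y
      exact ⟨f, fun _ => hf⟩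
    · exact ⟨0, fun h => absurd h hmn⟩
  choose fhat hfhat' using hex
  have hfhat : ∀ n : ℕ, m ≤ n → ∀ y : Fin n → ℝ,
      MSpline.IsMSpline m ρ (lam n) (t n) y (fhat n y) := fun n hn y => hfhat' n y hn
  have hrate := MSpline.isBigOInProb_sqNorm P hm hρ hψ hε_indep hε_ident hψ_sq hψ_mean hξ ha hscore
    ht_mem ht hlam_pos hlam_zero hlam_inf hfo hfo_bdry hfhat
  refine ⟨fhat, hfhat, hrate, fun hΘ => ?_⟩
  obtain ⟨D, hD, hrate_le⟩ := MSpline.rate_le_of_isTheta hm hlam_pos hΘ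
  refine ⟨hrate.mono (Eventually.of_forall fun n ω => le_rfl) hD hrate_le,
    hrate.mono (Eventually.of_forall fun n ω => ?_) hD hrate_le⟩
  rw [MSpline.integral_unit, abs_of_nonneg (integral_nonneg fun x => sq_nonneg _),
    abs_of_nonneg (MSpline.sqNorm_nonneg m (hlam_pos n).le _)]
  exact MSpline.integral_sq_le_sqNorm m (hlam_pos n).le _
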